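/- **Setting.** For each $n$ let $(\mathbf A,X)\sim\mathrm{CSBM}(p,q,\mu,\sigma)$ on $n$ nodes: the class labels $\epsilon_1,\dots,\epsilon_n$ are independent $\mathrm{Bern}(1/2)$; given the labels, each unordered pair of distinct nodes is joined by an edge independently, with probability $p$ if the labels agree and $q$ if they differ ($\mathbf A$ is the symmetric adjacency matrix, with zero diagonal), and independently of the graph the features $X_i\sim N((2\epsilon_i-1)\mu,\sigma^2)$ are independent. The parameters $p,q,\mu,\sigma,t$ and $L$ may depend on $n$; assume $0\le q<p\le1$, $p,q=\Omega(\log^2 n/n)$, $\mu,\sigma,t>0$, $L=O(n)$, $\mathrm{SNR}=\mu/\sigma=\omega(\sqrt{\log n})$ and $t=\omega(\sqrt{\log n})$. "W.h.p." means with probability $1-o(1)$ as $n\to\infty$. Let $$\gamma(X)=\tfrac1{\sqrt n}\bigl\|X-\tfrac1n\mathbf 1\mathbf 1^{T}X\bigr\|_2 .$$ A GCN has the layers $X^{(l)}_i=\sum_j \mathbf A_{ij}X^{(l-1)}_j/\deg(i)$. A GAT with attention intensity $t$ has the layers $X^{(l)}_i=\sum_j\mathbf A_{ij}c_{ij}X^{(l-1)}_j$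 with $c_{ij}=e^{\Psi_{ij}}/\sum_{k}\mathbf A_{ik}e^{\Psi_{ik}}$, where $\Psi_{ij}=t$ if $X^{(l-1)}_iX^{(l-1)}_j\ge0$ and $\Psi_{ij}=-t$ otherwise. In both cases $X^{(0)}=X$. *Over-smoothing* with constants $C_1,C_2>0$ means that $\gamma(X^{(l)})\le C_1e^{-C_2l}\gamma(X^{(0)})$ for all $l\in\{1,\dots,L\}$. **Theorem.** (1) The GCN over-smooths. (a) If $p=O(q)$ (that is, $(p-q)/(p+q)$ is bounded away from $1$), there are constants $C_1,C_2>0$ independent of $n$ such that w.h.p. $\gamma(X^{(l)})\le C_1e^{-C_2l}\gamma(X^{(0)})$ for all $1\le l\le L$. (b) Without that restriction, there is a constant $C_1>0$ such that for every fixed $\eta\in(0,1)$, w.h.p. for all $1\le l\le L$, $$\gamma(X^{(l)})\le C_1\Bigl(1-(1-\eta)\bigl(1-\tfrac{p-q}{p+q}\bigr)\Bigr)^{l}\gamma(X^{(0)}).$$ (c) The decay factor per layer is $\frac{p-q}{p+q}$: for every fixed $\delta>0$, w.h.p. for all $1\le l\le L$, $$\Bigl|\gamma(X^{(l)})-\bigl(\tfrac{p-q}{p+q}\bigr)^{l}\gamma(X^{(0)})\Bigr|\le\delta\,\gamma(X^{(0)}).$$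 (2) The GAT with intensity $t$ avoids over-smoothing. (a) If $L\to\infty$, then for all constants $C_1,C_2>0$ the probability that $\gamma(X^{(l)})\le C_1e^{-C_2l}\gamma(X^{(0)})$ holds for all $1\le l\le L$ is $o(1)$. (b) For every fixed $\delta>0$, w.h.p. for all $1\le l\le L$, $$\Bigl|\gamma(X^{(l)})-\Bigl(\tfrac{pe^{t}-qe^{-t}}{pe^{t}+qe^{-t}}\Bigr)^{l}\gamma(X^{(0)})\Bigr|\le\delta\,\gamma(X^{(0)}).$$ (c) If $Lq=O(pe^{2t})$ (in particular if $n=O(e^{2t})$), then $\gamma(X^{(l)})=\Theta(\gamma(X^{(0)}))$ uniformly in $l$: there are constants $c,C>0$ such that w.h.p. $c\,\gamma(X^{(0)})\le\gamma(X^{(l)})\le C\,\gamma(X^{(0)})$ for all $1\le l\le L$. -/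

import Mathlib

open MeasureTheory ProbabilityTheory Filter Topology Asymptotics
open scoped BigOperators

namespace GraphAttention

/-! ### The contextual stochastic block model -/

/-- Unordered pairs of distinct nodes, written as `i < j`. -/
abbrev NodePair (n : ℕ) : Type := {e : Fin n × Fin n // e.1 < e.2}

/-- An outcome of the model with `n` nodes: class labels, edge indicators, node features. -/
abbrev Outcome (n : ℕ) : Type := (Fin n → Bool) × (NodePair n → Bool) × (Fin n → ℝ)

/-- The law `Bern(p)` on `Bool` (the parameter is clipped to `[0, 1]`). -/
noncomputable def bern (p : ℝ) : Measure Bool :=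
  bernoulliMeasure true false (Set.projIcc (0 : ℝ) 1 zero_le_one p)

/-- Conditional law of the edge indicators given the labels: independent over pairs, `Bern(p)`
inside a class and `Bern(q)` between the classes. -/
noncomputable def edgeLaw (n : ℕ) (p q : ℝ) (ε : Fin n → Bool) : Measure (NodePair n → Bool) :=
  Measure.pi fun e : NodePair n => bern (if ε e.1.1 = ε e.1.2 then p else q)

/-- Conditional law of the features given the labels: independent over nodes,
`N(μ, σ²)` in the class `true` and `N(-μ, σ²)` in the class `false`. -/
noncomputable def featureLaw (n : ℕ) (μ σ : ℝ) (ε : Fin n → Bool) : Measure (Fin n → ℝ) :=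
  Measure.pi fun i : Fin n => gaussianReal (if ε i then μ else -μ) (σ ^ 2).toNNReal

/-- `CSBM(p, q, μ, σ)` on `n` nodes: the labels are `n` independent fair coins, and given the
labels the graph and the features are independent with the laws above. -/
noncomputable def csbm (n : ℕ) (p q μ σ : ℝ) : Measure (Outcome n) :=
  ∑ ε : Fin n → Bool, ((2 : ENNReal)⁻¹ ^ n) •
    (Measure.dirac ε).prod ((edgeLaw n p q ε).prod (featureLaw n μ σ ε))

/-- The (symmetric, zero-diagonal) adjacency matrix of a sampled graph. -/
def adj {n : ℕ} (ω : Outcome n) : Matrix (Fin n) (Fin n) ℝ := fun i j =>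
  if h : i < j then (if ω.2.1 ⟨(i, j), h⟩ then 1 else 0)
  else if h : j < i then (if ω.2.1 ⟨(j, i), h⟩ then 1 else 0)
  else 0

/-- The sampled node features. -/
def feat {n : ℕ} (ω : Outcome n) : Fin n → ℝ := ω.2.2

/-- "With probability `1 - o(1)`" for a sequence of events, one for each number of nodes. -/
def WithHighProbability (p q μ σ : ℕ → ℝ) (E : ∀ n, Set (Outcome n)) : Prop :=
  Tendsto (fun n => csbm n (p n) (q n) (μ n) (σ n) (E n)) atTop (𝓝 1)

/-- "With probability `o(1)`" for a sequence of events, one for each number of nodes. -/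
def WithVanishingProbability (p q μ σ : ℕ → ℝ) (E : ∀ n, Set (Outcome n)) : Prop :=
  Tendsto (fun n => csbm n (p n) (q n) (μ n) (σ n) (E n)) atTop (𝓝 0)

/-! ### Graph convolution and graph attention layers -/

/-- One graph convolution layer: `X'_i = ∑_j A_ij X_j / deg(i)`. -/
noncomputable def gcnLayer {n : ℕ} (A : Matrix (Fin n) (Fin n) ℝ) (X : Fin n → ℝ) : Fin n → ℝ :=
  fun i => ∑ j, A i j * (∑ k, A i k)⁻¹ * X j

/-- The attention function with intensity `t`. -/
noncomputable def attention (t x y : ℝ) : ℝ := if 0 ≤ x * y then t else -t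

/-- The attention coefficient `c_ij`: the softmax of `attention` over the neighbours of `i`
(for a 0-1 matrix `A`). -/
noncomputable def attentionCoeff {n : ℕ} (t : ℝ) (A : Matrix (Fin n) (Fin n) ℝ) (X : Fin n → ℝ)
    (i j : Fin n) : ℝ :=
  Real.exp (attention t (X i) (X j)) / ∑ k, A i k * Real.exp (attention t (X i) (X k))

/-- One graph attention layer: `X'_i = ∑_j A_ij c_ij X_j`. -/
noncomputable def gatLayer {n : ℕ} (t : ℝ) (A : Matrix (Fin n) (Fin n) ℝ) (X : Fin n → ℝ) :
    Fin n → ℝ :=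
  fun i => ∑ j, A i j * attentionCoeff t A X i j * X j

/-- `X^(l)` in a graph convolutional network. -/
noncomputable def gcnFeat {n : ℕ} (ω : Outcome n) (l : ℕ) : Fin n → ℝ :=
  (gcnLayer (adj ω))^[l] (feat ω)

/-- `X^(l)` in a graph attention network all of whose layers have intensity `t`; the
coefficients are recomputed from the current features in every layer. -/
noncomputable def gatFeat {n : ℕ} (t : ℝ) (ω : Outcome n) (l : ℕ) : Fin n → ℝ :=
  (gatLayer t (adj ω))^[l] (feat ω)

/-! ### Node similarity and over-smoothing -/

/-- The axioms of a node-similarity measure. -/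
structure IsNodeSimilarityMeasure {n : ℕ} (g : (Fin n → ℝ) → ℝ) : Prop where
  nonneg : ∀ X, 0 ≤ g X
  eq_zero_iff : ∀ X, (∃ c : ℝ, ∀ i, X i = c) ↔ g X = 0
  add_le : ∀ X Y, g (X + Y) ≤ g X + g Y

/-- The normalized deviation from the mean, `n^(-1/2) ‖X - (1 1ᵀ / n) X‖`. -/
noncomputable def gam {n : ℕ} (X : Fin n → ℝ) : ℝ :=
  (√(n : ℝ))⁻¹ * √(∑ i, (X i - (∑ j, X j) / n) ^ 2)

theorem gam_isNodeSimilarityMeasure (n : ℕ) :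
    IsNodeSimilarityMeasure (gam : (Fin n → ℝ) → ℝ) where
  nonneg X := by unfold gam; positivity
  eq_zero_iff X := by
    rcases Nat.eq_zero_or_pos n with rfl | hn
    · simp [gam]
    have hn' : (0 : ℝ) < n := by exact_mod_cast hn
    have hs : (√(n : ℝ))⁻¹ ≠ 0 := by positivity
    constructor
    · rintro ⟨c, hc⟩
      have : (n : ℝ) * c / n = c := by field_simp
      simp [gam, hc, this]
    · intro h
      unfold gam at h
      have h1 := (mul_eq_zero.mp h).resolve_left hs
      rw [Real.sqrt_eq_zero (by positivity),
        Finset.sum_eq_zero_iff_of_nonneg (fun i _ => sq_nonneg _)] at h1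
      exact ⟨(∑ j, X j) / n, fun i => sub_eq_zero.mp (pow_eq_zero_iff two_ne_zero |>.mp
        (h1 i (Finset.mem_univ i)))⟩
  add_le X Y := by
    have key : ∀ Z : Fin n → ℝ, √(∑ i, (Z i - (∑ j, Z j) / n) ^ 2)
        = ‖WithLp.toLp 2 (fun i => Z i - (∑ j, Z j) / n)‖ := by
      intro Z; simp [EuclideanSpace.norm_eq]
    unfold gam
    rw [← mul_add, key, key, key]
    refine mul_le_mul_of_nonneg_left ?_ (by positivity)
    refine le_trans (le_of_eq ?_) (norm_add_le _ _)
    congr 1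
    ext i
    simp [Finset.sum_add_distrib, add_div]
    ring

/-- The over-smoothing inequalities with constants `C₁`, `C₂` for the layers `1, …, L` of a
network whose successive node features are `X 0, X 1, …`. -/
def OverSmooths {n : ℕ} (C₁ C₂ : ℝ) (L : ℕ) (X : ℕ → Fin n → ℝ) : Prop :=
  ∀ l : ℕ, 1 ≤ l → l ≤ L → gam (X l) ≤ C₁ * Real.exp (-C₂ * l) * gam (X 0)

end GraphAttention

/-! On an event of probability 1 - o(1) the model is almost deterministic, and the rest is
deterministic analysis. On this event (`goodEvent`) the labels are nearly balanced, each node has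
about np/2 neighbours in its own class and nq/2 in the other, each feature is within δμ of μ or -μ
according to its label, and the quadratic forms of the within-class and between-class parts of the
adjacency matrix are close to those of their conditional means.

Attention. While the features carry the signs of the labels, the weights are e^t inside and e^(-t)
across the classes, so a layer multiplies the signal by 1 - 2 `leak`, with an error proportional to
`leak` times the current signal. These errors telescope over the layers to O(δμ). Once the signal
itself has sunk to order δμ, signs no longer matter, because averaging cannot increase the largest
absolute value. Hence `abs_iterate_gatLayer_sub_le`, uniformly in the number of layers. Intensity 0
gives the convolution; large intensity makes `leak` at most e^(-2t), which tends to 0, and this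
rules out over-smoothing.

Exponential decay. An additive error δγ(X^(0)) cannot give exponential decay in deep layers. There
the convolution is used as a self-adjoint operator for the degree weights: a bound for the form of
the adjacency matrix on vectors orthogonal to the degrees is a contraction factor
(`sum_deg_mul_gcnLayer_sq_le`). The gap 2q/(p+q) may tend to 0, so an error of order δnp would
destroy it. In `IsTypicalGraph.le_laplacian` this error never meets the critical direction, because
the within-class Laplacian vanishes on vectors that are constant on the classes.

Quadratic forms. The norm of the centered matrix M is bounded by moments, without counting walks.
Integration by parts for Bernoulli variables and a trace inequality bound E tr M^(2r+2) by (2r+1)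
times a degree bound times E tr M^(2r), up to a rare event (`bernMean_trace_pow_le`). About log n
rounds give a norm of order √(log n · nr) for edge probability r, provided that nr is at least of
order log² n; this is o(nr). -/

namespace GraphAttention

/-! ### Trace inequalities for symmetric matrices -/

section TraceInequalities

open Matrix

variable {ι : Type*} [Fintype ι] [DecidableEq ι]

theorem exists_orthogonal_diagonalization {W : Matrix ι ι ℝ} (hW : W.IsSymm) :
    ∃ (U : Matrix ι ι ℝ) (d : ι → ℝ), Uᵀ * U = 1 ∧ U * Uᵀ = 1 ∧ W = U * diagonal d * Uᵀ := by
  have hH : W.IsHermitian := by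
    rw [Matrix.IsHermitian, conjTranspose_eq_transpose_of_trivial]; exact hW
  refine ⟨hH.eigenvectorUnitary, hH.eigenvalues, ?_, ?_, ?_⟩
  · have := Unitary.coe_star_mul_self hH.eigenvectorUnitary
    rwa [star_eq_conjTranspose, conjTranspose_eq_transpose_of_trivial] at this
  · have := Unitary.coe_mul_star_self hH.eigenvectorUnitary
    rwa [Unitary.coe_star, star_eq_conjTranspose, conjTranspose_eq_transpose_of_trivial] at this
  · have := hH.spectral_theorem
    rw [Unitary.conjStarAlgAut_apply, star_eq_conjTranspose,
      conjTranspose_eq_transpose_of_trivial] at this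
    exact this

theorem diagonalization_pow {U : Matrix ι ι ℝ} {d : ι → ℝ} (h1 : Uᵀ * U = 1) (h2 : U * Uᵀ = 1)
    (a : ℕ) : (U * diagonal d * Uᵀ) ^ a = U * diagonal (fun i => d i ^ a) * Uᵀ := by
  induction a with
  | zero => simp [h2]
  | succ a ih =>
    rw [pow_succ, ih]
    calc U * diagonal (fun i => d i ^ a) * Uᵀ * (U * diagonal d * Uᵀ)
        = U * (diagonal (fun i => d i ^ a) * (Uᵀ * U) * diagonal d) * Uᵀ := by noncomm_ring
      _ = _ := by rw [h1, mul_one, diagonal_mul_diagonal]; simp [pow_succ]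

/-- In eigenbases of the two matrices the trace becomes a sum with the nonnegative weights
(VᵀHU)ᵢⱼ², so inequalities between traces reduce to inequalities between monomials in the
eigenvalues. -/
theorem trace_mul_pow_mul_pow {H U V : Matrix ι ι ℝ} {d g : ι → ℝ} (hH : H.IsSymm)
    (hU1 : Uᵀ * U = 1) (hU2 : U * Uᵀ = 1) (hV1 : Vᵀ * V = 1) (hV2 : V * Vᵀ = 1) (a b : ℕ) :
    (H * (U * diagonal d * Uᵀ) ^ a * H * (V * diagonal g * Vᵀ) ^ b).trace
      = ∑ i, ∑ j, (Vᵀ * H * U) i j ^ 2 * (d j ^ a * g i ^ b) := by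
  rw [diagonalization_pow hU1 hU2, diagonalization_pow hV1 hV2]
  have e : (Vᵀ * H * U)ᵀ = Uᵀ * H * V := by
    rw [transpose_mul, transpose_mul, transpose_transpose, hH.eq, mul_assoc]
  have : (H * (U * diagonal (fun i => d i ^ a) * Uᵀ) * H *
      (V * diagonal (fun i => g i ^ b) * Vᵀ)).trace
      = ((Vᵀ * H * U) * diagonal (fun i => d i ^ a) * (Vᵀ * H * U)ᵀ *
        diagonal (fun i => g i ^ b)).trace := by
    rw [e, ← mul_assoc, trace_mul_comm]
    congr 1
    noncomm_ring
  rw [this]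
  refine Finset.sum_congr rfl fun i _ => ?_
  rw [diag_apply, mul_diagonal, Matrix.mul_apply, Finset.sum_mul]
  refine Finset.sum_congr rfl fun j _ => ?_
  rw [mul_diagonal, transpose_apply]
  ring

/-- A mixed monomial is at most the pure power of whichever variable is larger in absolute value;
the even total degree makes both pure powers nonnegative. -/
theorem abs_pow_mul_pow_le (x y : ℝ) (a b r : ℕ) (hab : a + b = 2 * r) :
    x ^ a * y ^ b ≤ x ^ (2 * r) + y ^ (2 * r) := by
  have hx : x ^ (2 * r) = |x| ^ (2 * r) := by rw [pow_mul, pow_mul, sq_abs]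
  have hy : y ^ (2 * r) = |y| ^ (2 * r) := by rw [pow_mul, pow_mul, sq_abs]
  have h1 : x ^ a * y ^ b ≤ |x| ^ a * |y| ^ b := by
    rw [← abs_pow, ← abs_pow, ← abs_mul]; exact le_abs_self _
  refine h1.trans ?_
  rw [hx, hy, ← hab]
  rcases le_total |x| |y| with h | h
  · calc |x| ^ a * |y| ^ b ≤ |y| ^ a * |y| ^ b := by gcongr
      _ ≤ _ := by rw [← pow_add]; exact le_add_of_nonneg_left (by positivity)
  · calc |x| ^ a * |y| ^ b ≤ |x| ^ a * |x| ^ b := by gcongr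
      _ ≤ _ := by rw [← pow_add]; exact le_add_of_nonneg_right (by positivity)

/-- Separates two noncommuting matrices: after passing to eigenvalues the mixed monomials are
replaced by pure powers, and each resulting trace involves only one of the matrices. -/
theorem trace_mul_pow_mul_pow_le {H W Y : Matrix ι ι ℝ} (hH : H.IsSymm) (hW : W.IsSymm)
    (hY : Y.IsSymm) {a b r : ℕ} (hab : a + b = 2 * r) :
    (H * W ^ a * H * Y ^ b).trace ≤
      (H * H * W ^ (2 * r)).trace + (H * H * Y ^ (2 * r)).trace := by
  obtain ⟨U, d, hU1, hU2, rfl⟩ := exists_orthogonal_diagonalization hW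
  obtain ⟨V, g, hV1, hV2, rfl⟩ := exists_orthogonal_diagonalization hY
  have e1 := trace_mul_pow_mul_pow (d := d) (g := g) hH hU1 hU2 hV1 hV2 (2 * r) 0
  have e2 := trace_mul_pow_mul_pow (d := d) (g := g) hH hU1 hU2 hV1 hV2 0 (2 * r)
  rw [pow_zero, mul_one] at e1 e2
  have e3 : (H * H * (U * diagonal d * Uᵀ) ^ (2 * r)).trace
      = (H * (U * diagonal d * Uᵀ) ^ (2 * r) * H).trace := by
    rw [mul_assoc, trace_mul_comm]
  rw [e3, e1, e2, trace_mul_pow_mul_pow hH hU1 hU2 hV1 hV2, ← Finset.sum_add_distrib]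
  refine Finset.sum_le_sum fun i _ => ?_
  rw [← Finset.sum_add_distrib]
  refine Finset.sum_le_sum fun j _ => ?_
  rw [← mul_add, pow_zero, pow_zero, mul_one, one_mul]
  exact mul_le_mul_of_nonneg_left (abs_pow_mul_pow_le _ _ _ _ _ hab) (sq_nonneg _)

theorem pow_sub_pow_telescope (W Y : Matrix ι ι ℝ) (m : ℕ) :
    W ^ m - Y ^ m = ∑ a ∈ Finset.range m, W ^ a * (W - Y) * Y ^ (m - 1 - a) := by
  induction m with
  | zero => simp
  | succ m ih =>
    rw [Finset.sum_range_succ]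
    have : ∑ a ∈ Finset.range m, W ^ a * (W - Y) * Y ^ (m + 1 - 1 - a)
        = (∑ a ∈ Finset.range m, W ^ a * (W - Y) * Y ^ (m - 1 - a)) * Y := by
      rw [Finset.sum_mul]
      refine Finset.sum_congr rfl fun a ha => ?_
      have : m + 1 - 1 - a = (m - 1 - a) + 1 := by have := Finset.mem_range.mp ha; omega
      rw [this, pow_succ]; noncomm_ring
    rw [this, ← ih, Nat.add_sub_cancel, Nat.sub_self, pow_zero, mul_one, pow_succ, pow_succ]
    noncomm_ring

/-- The difference of powers telescopes into 2r+1 terms, each with a second factor H and 2r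
remaining factors. This is the discrete derivative of tr(H W^(2r+1)) in the direction H. -/
theorem trace_mul_pow_sub_pow_le {H W Y : Matrix ι ι ℝ} (hH : H.IsSymm) (hW : W.IsSymm)
    (hY : Y.IsSymm) (hWY : W - Y = H) (r : ℕ) :
    (H * (W ^ (2 * r + 1) - Y ^ (2 * r + 1))).trace ≤
      (2 * r + 1) * ((H * H * W ^ (2 * r)).trace + (H * H * Y ^ (2 * r)).trace) := by
  rw [pow_sub_pow_telescope, Finset.mul_sum, trace_sum, hWY]
  calc _ ≤ ∑ _a ∈ Finset.range (2 * r + 1),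
        ((H * H * W ^ (2 * r)).trace + (H * H * Y ^ (2 * r)).trace) := by
        refine Finset.sum_le_sum fun a ha => ?_
        rw [← mul_assoc, ← mul_assoc]
        exact trace_mul_pow_mul_pow_le hH hW hY (by have := Finset.mem_range.mp ha; omega)
    _ = _ := by simp [mul_add]

theorem pow_even_diag_nonneg {W : Matrix ι ι ℝ} (hW : W.IsSymm) (r : ℕ) (i : ι) :
    0 ≤ (W ^ (2 * r)) i i := by
  have : W ^ (2 * r) = W ^ r * (W ^ r)ᵀ := by
    rw [transpose_pow, hW.eq, ← pow_add, two_mul]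
  rw [this, mul_apply]
  exact Finset.sum_nonneg fun j _ => mul_self_nonneg _

/-- The trace of an even power is a sum of nonnegative eigenvalue powers, so it dominates each of
them. -/
theorem abs_quadForm_le_of_trace_pow_le {W : Matrix ι ι ℝ} (hW : W.IsSymm) {r : ℕ} (hr : r ≠ 0)
    {c : ℝ} (hc : 0 ≤ c) (h : (W ^ (2 * r)).trace ≤ c ^ (2 * r)) (x : ι → ℝ) :
    |x ⬝ᵥ W *ᵥ x| ≤ c * ∑ i, x i ^ 2 := by
  obtain ⟨U, d, hU1, hU2, rfl⟩ := exists_orthogonal_diagonalization hW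
  rw [diagonalization_pow hU1 hU2, trace_mul_comm, ← mul_assoc, hU1, one_mul, trace_diagonal] at h
  have hd : ∀ i, |d i| ≤ c := fun i => by
    refine le_of_pow_le_pow_left₀ (n := 2 * r) (by omega) hc ?_
    refine le_trans ?_ h
    have e : ∀ j, d j ^ (2 * r) = |d j| ^ (2 * r) := fun j => by rw [pow_mul, pow_mul, sq_abs]
    rw [Finset.sum_congr rfl fun j _ => e j]
    exact Finset.single_le_sum (f := fun j => |d j| ^ (2 * r)) (fun j _ => by positivity)
      (Finset.mem_univ i)
  have e1 : x ⬝ᵥ (U * diagonal d * Uᵀ) *ᵥ x = ∑ i, d i * (Uᵀ *ᵥ x) i ^ 2 := by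
    rw [← mulVec_mulVec, ← mulVec_mulVec, dotProduct_mulVec, ← mulVec_transpose]
    simp only [dotProduct, mulVec_diagonal]
    exact Finset.sum_congr rfl fun i _ => by ring
  have e2 : ∑ i, x i ^ 2 = ∑ i, (Uᵀ *ᵥ x) i ^ 2 := by
    have : (Uᵀ *ᵥ x) ⬝ᵥ (Uᵀ *ᵥ x) = x ⬝ᵥ x := by
      rw [dotProduct_mulVec, ← mulVec_transpose, transpose_transpose, mulVec_mulVec, hU2,
        one_mulVec]
    simpa [dotProduct, sq] using this.symm
  rw [e1, e2, Finset.mul_sum]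
  refine (Finset.abs_sum_le_sum_abs _ _).trans (Finset.sum_le_sum fun i _ => ?_)
  rw [abs_mul, abs_of_nonneg (sq_nonneg ((Uᵀ *ᵥ x) i))]
  exact mul_le_mul_of_nonneg_right (hd i) (sq_nonneg _)

/-- A crude bound, needed only on the rare event where some node has too many neighbours. -/
theorem abs_pow_apply_le {W : Matrix ι ι ℝ} (hW : ∀ i j, |W i j| ≤ 1) (m : ℕ) (i j : ι) :
    |(W ^ m) i j| ≤ (Fintype.card ι : ℝ) ^ m := by
  induction m generalizing i j with
  | zero =>
    rw [pow_zero, pow_zero, one_apply]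
    split_ifs <;> simp
  | succ m ih =>
    rw [pow_succ, mul_apply]
    calc _ ≤ ∑ k, |(W ^ m) i k * W k j| := Finset.abs_sum_le_sum_abs _ _
      _ ≤ ∑ _k : ι, (Fintype.card ι : ℝ) ^ m := by
        refine Finset.sum_le_sum fun k _ => ?_
        rw [abs_mul]
        calc _ ≤ (Fintype.card ι : ℝ) ^ m * 1 :=
              mul_le_mul (ih i k) (hW k j) (abs_nonneg _) (by positivity)
          _ = _ := mul_one _
      _ = _ := by simp [pow_succ, mul_comm]

end TraceInequalities

/-! ### Products of Bernoulli variables -/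

section Bernoulli

variable {ι : Type*} [Fintype ι] {p : ι → ℝ}

/-- The indicator of an edge, as a real number. -/
def ind (b : Bool) : ℝ := if b then 1 else 0

/-- The probability of `a` under the product of the laws `Bern(p e)`. -/
noncomputable def bernWeight (p : ι → ℝ) (a : ι → Bool) : ℝ := ∏ e, if a e then p e else 1 - p e

theorem bernWeight_nonneg (h0 : ∀ e, 0 ≤ p e) (h1 : ∀ e, p e ≤ 1) (a : ι → Bool) :
    0 ≤ bernWeight p a :=
  Finset.prod_nonneg fun e _ => by split_ifs <;> [exact h0 e; exact sub_nonneg.mpr (h1 e)]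

variable [DecidableEq ι]

/-- The expectation of `f` under the product of the laws `Bern(p e)`. -/
noncomputable def bernMean (p : ι → ℝ) (f : (ι → Bool) → ℝ) : ℝ := ∑ a, bernWeight p a * f a

open Classical in
/-- The probability of `S` under the product of the laws `Bern(p e)`. -/
noncomputable def bernProb (p : ι → ℝ) (S : Set (ι → Bool)) : ℝ :=
  bernMean p fun a => if a ∈ S then 1 else 0

theorem bernMean_mono (h0 : ∀ e, 0 ≤ p e) (h1 : ∀ e, p e ≤ 1) {f g : (ι → Bool) → ℝ}
    (h : ∀ a, f a ≤ g a) : bernMean p f ≤ bernMean p g :=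
  Finset.sum_le_sum fun a _ => mul_le_mul_of_nonneg_left (h a) (bernWeight_nonneg h0 h1 a)

theorem bernMean_add (f g : (ι → Bool) → ℝ) :
    bernMean p (fun a => f a + g a) = bernMean p f + bernMean p g := by
  simp only [bernMean, mul_add, Finset.sum_add_distrib]

theorem bernMean_const_mul (c : ℝ) (f : (ι → Bool) → ℝ) :
    bernMean p (fun a => c * f a) = c * bernMean p f := by
  simp only [bernMean, Finset.mul_sum]
  exact Finset.sum_congr rfl fun a _ => by ring

theorem bernMean_sum {κ : Type*} (s : Finset κ) (f : κ → (ι → Bool) → ℝ) :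
    bernMean p (fun a => ∑ k ∈ s, f k a) = ∑ k ∈ s, bernMean p (f k) := by
  simp only [bernMean, Finset.mul_sum]
  exact Finset.sum_comm

theorem bernMean_prod (g : ι → Bool → ℝ) :
    bernMean p (fun a => ∏ e, g e (a e)) = ∏ e, (p e * g e true + (1 - p e) * g e false) := by
  have h := Finset.prod_univ_sum (fun _ : ι => (Finset.univ : Finset Bool))
    (fun e b => (if b then p e else 1 - p e) * g e b)
  rw [Fintype.piFinset_univ] at h
  simp only [Fintype.sum_bool, if_true, Bool.false_eq_true, if_false] at h
  rw [h, bernMean]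
  exact Finset.sum_congr rfl fun a _ => by rw [bernWeight, ← Finset.prod_mul_distrib]

theorem bernMean_const (c : ℝ) : bernMean p (fun _ => c) = c := by
  have := bernMean_prod (p := p) (fun _ _ => 1)
  simp only [Finset.prod_const_one, mul_one, add_sub_cancel] at this
  have h := bernMean_const_mul (p := p) c (fun _ => 1)
  simp only [mul_one] at h
  rw [h, this, mul_one]

theorem bernProb_le_bernMean (h0 : ∀ e, 0 ≤ p e) (h1 : ∀ e, p e ≤ 1) {S : Set (ι → Bool)}
    {f : (ι → Bool) → ℝ} (hf : ∀ a, 0 ≤ f a) (h : ∀ a ∈ S, 1 ≤ f a) :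
    bernProb p S ≤ bernMean p f :=
  bernMean_mono h0 h1 fun a => by
    split_ifs with ha
    · exact h a ha
    · exact hf a

theorem bernProb_nonneg (h0 : ∀ e, 0 ≤ p e) (h1 : ∀ e, p e ≤ 1) (S : Set (ι → Bool)) :
    0 ≤ bernProb p S := by
  have := bernMean_mono (p := p) h0 h1 (f := fun _ => 0)
    (g := fun a => open Classical in if a ∈ S then 1 else 0) (fun a => by split_ifs <;> norm_num)
  rwa [bernMean_const] at this

theorem bernProb_mono (h0 : ∀ e, 0 ≤ p e) (h1 : ∀ e, p e ≤ 1) {S T : Set (ι → Bool)}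
    (h : S ⊆ T) : bernProb p S ≤ bernProb p T :=
  bernProb_le_bernMean h0 h1 (fun a => by split_ifs <;> norm_num) fun a ha => by simp [h ha]

theorem bernProb_union_le (h0 : ∀ e, 0 ≤ p e) (h1 : ∀ e, p e ≤ 1) (S T : Set (ι → Bool)) :
    bernProb p (S ∪ T) ≤ bernProb p S + bernProb p T := by
  unfold bernProb
  rw [← bernMean_add]
  refine bernMean_mono h0 h1 fun a => ?_
  by_cases hS : a ∈ S <;> by_cases hT : a ∈ T <;> simp [hS, hT]

theorem bernProb_iUnion_le {κ : Type*} [Fintype κ] (h0 : ∀ e, 0 ≤ p e) (h1 : ∀ e, p e ≤ 1)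
    (S : κ → Set (ι → Bool)) : bernProb p (⋃ k, S k) ≤ ∑ k, bernProb p (S k) := by
  unfold bernProb
  rw [← bernMean_sum]
  refine bernProb_le_bernMean h0 h1 (fun a => Finset.sum_nonneg fun k _ => ?_) fun a ha => ?_
  · split_ifs <;> norm_num
  · obtain ⟨k, hk⟩ := Set.mem_iUnion.mp ha
    refine le_trans (by simp [hk]) (Finset.single_le_sum (f := fun k => _)
      (fun k _ => ?_) (Finset.mem_univ k))
    split_ifs <;> norm_num

theorem bernMean_exp_le (h0 : ∀ e, 0 ≤ p e) (h1 : ∀ e, p e ≤ 1) {u : ι → ℝ}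
    (hu : ∀ e, u e = 0 ∨ u e = 1) (θ : ℝ) :
    bernMean p (fun a => Real.exp (θ * ∑ e, ind (a e) * u e)) ≤
      Real.exp ((Real.exp θ - 1) * ∑ e, p e * u e) := by
  have : ∀ a : ι → Bool, Real.exp (θ * ∑ e, ind (a e) * u e)
      = ∏ e, Real.exp (θ * (ind (a e) * u e)) := fun a => by
    rw [← Real.exp_sum, Finset.mul_sum]
  simp only [this]
  rw [bernMean_prod (fun e b => Real.exp (θ * (ind b * u e))), Finset.mul_sum, Real.exp_sum]
  refine Finset.prod_le_prod (fun e _ => ?_) fun e _ => ?_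
  · have := h0 e; have := sub_nonneg.mpr (h1 e); positivity
  · refine le_trans (le_of_eq ?_) (Real.add_one_le_exp _)
    rcases hu e with h | h
    · simp [h]
    · simp [ind, h]; ring

/-- Upper tail far above the mean. -/
theorem bernProb_lt_sum_le (h0 : ∀ e, 0 ≤ p e) (h1 : ∀ e, p e ≤ 1) {u : ι → ℝ}
    (hu : ∀ e, u e = 0 ∨ u e = 1) {D : ℝ} (hD : ∑ e, p e * u e ≤ D) (K : ℝ) :
    bernProb p {a | K < ∑ e, ind (a e) * u e} ≤ Real.exp (2 * D - K) := by
  calc _ ≤ bernMean p (fun a => Real.exp (-K) * Real.exp (1 * ∑ e, ind (a e) * u e)) := by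
        refine bernProb_le_bernMean h0 h1 (fun a => by positivity) fun a ha => ?_
        rw [← Real.exp_add, Real.one_le_exp_iff]
        have : K < ∑ e, ind (a e) * u e := ha
        linarith
    _ ≤ Real.exp (-K) * Real.exp ((Real.exp 1 - 1) * ∑ e, p e * u e) := by
        rw [bernMean_const_mul]
        exact mul_le_mul_of_nonneg_left (bernMean_exp_le h0 h1 hu 1) (by positivity)
    _ ≤ _ := by
        rw [← Real.exp_add, Real.exp_le_exp]
        -- Markov's inequality is applied with θ = 1; the factor e - 1 in the exponent is rounded up
        -- to 2.
        have h3 : Real.exp 1 ≤ 3 := by have := Real.exp_one_lt_d9; linarith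
        have hs : 0 ≤ ∑ e, p e * u e := Finset.sum_nonneg fun e _ =>
          mul_nonneg (h0 e) (by rcases hu e with h | h <;> simp [h])
        nlinarith

/-- Multiplicative Chernoff bound. -/
theorem bernProb_abs_sub_gt_le (h0 : ∀ e, 0 ≤ p e) (h1 : ∀ e, p e ≤ 1) {u : ι → ℝ}
    (hu : ∀ e, u e = 0 ∨ u e = 1) {δ : ℝ} (hδ : 0 < δ) (hδ1 : δ ≤ 1) :
    bernProb p {a | δ * ∑ e, p e * u e < |∑ e, ind (a e) * u e - ∑ e, p e * u e|} ≤
      2 * Real.exp (-(δ ^ 2 / 4 * ∑ e, p e * u e)) := by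
  set m := ∑ e, p e * u e with hm
  have hm0 : 0 ≤ m := Finset.sum_nonneg fun e _ =>
    mul_nonneg (h0 e) (by rcases hu e with h | h <;> simp [h])
  -- Both tails at once, with θ = ±δ/2. By e^θ - 1 - θ ≤ θ² = δ²/4 the exponent is at most -δ²m/2 +
  -- δ²m/4.
  have key : ∀ θ : ℝ, |θ| = δ / 2 →
      bernProb p {a | δ * m * (δ / 2) < θ * (∑ e, ind (a e) * u e - m)} ≤
        Real.exp (-(δ ^ 2 / 4 * m)) := fun θ hθ => by
    have hsq : θ ^ 2 = δ ^ 2 / 4 := by rw [← sq_abs, hθ]; ring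
    calc _ ≤ bernMean p (fun a => Real.exp (-(δ * m * (δ / 2)) - θ * m) *
          Real.exp (θ * ∑ e, ind (a e) * u e)) := by
          refine bernProb_le_bernMean h0 h1 (fun a => by positivity) fun a ha => ?_
          rw [← Real.exp_add, Real.one_le_exp_iff]
          have : δ * m * (δ / 2) < θ * (∑ e, ind (a e) * u e - m) := ha
          linarith
      _ ≤ Real.exp (-(δ * m * (δ / 2)) - θ * m) * Real.exp ((Real.exp θ - 1) * m) := by
          rw [bernMean_const_mul]
          exact mul_le_mul_of_nonneg_left (bernMean_exp_le h0 h1 hu θ) (by positivity)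
      _ ≤ _ := by
          rw [← Real.exp_add, Real.exp_le_exp]
          have := Real.abs_exp_sub_one_sub_id_le (x := θ) (by rw [hθ]; linarith)
          have := (abs_le.mp this).2
          nlinarith
  refine le_trans (bernProb_mono h0 h1 (T := {a | δ * m * (δ / 2) <
    (δ / 2) * (∑ e, ind (a e) * u e - m)} ∪ {a | δ * m * (δ / 2) <
    (-(δ / 2)) * (∑ e, ind (a e) * u e - m)}) fun a ha => ?_) ?_
  · rcases lt_abs.mp (Set.mem_ofPred_eq ▸ ha) with h | h
    · left; rw [Set.mem_ofPred_eq]; nlinarith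
    · right; rw [Set.mem_ofPred_eq]; nlinarith
  · refine (bernProb_union_le h0 h1 _ _).trans ?_
    rw [two_mul]
    exact add_le_add (key _ (abs_of_pos (by linarith)))
      (key _ (by rw [abs_neg, abs_of_pos (by linarith)]))

/-! ### Conditioning on all but one variable -/

/-- Flipping one coordinate permutes the configurations, so summing over both values of that
coordinate counts each configuration twice. -/
theorem sum_update_add_sum_update (e : ι) (F : (ι → Bool) → ℝ) :
    ∑ a, (F (Function.update a e true) + F (Function.update a e false)) = 2 * ∑ a, F a := by
  have hflip : ∑ a : ι → Bool, F (Function.update a e (!a e)) = ∑ a, F a := by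
    refine Finset.sum_nbij' (fun a => Function.update a e (!a e))
      (fun a => Function.update a e (!a e)) ?_ ?_ ?_ ?_ ?_ <;> simp
  rw [two_mul]
  nth_rewrite 2 [← hflip]
  rw [← Finset.sum_add_distrib]
  refine Finset.sum_congr rfl fun a _ => ?_
  have hs := Function.update_eq_self e a
  cases h : a e <;> rw [h] at hs <;> simp [hs, add_comm]

theorem bernWeight_update (a : ι → Bool) (e : ι) (b : Bool) :
    bernWeight p (Function.update a e b) =
      (if b then p e else 1 - p e) * ∏ k ∈ Finset.univ.erase e, if a k then p k else 1 - p k := by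
  rw [bernWeight, ← Finset.mul_prod_erase _ _ (Finset.mem_univ e)]
  congr 1
  · simp
  · refine Finset.prod_congr rfl fun k hk => ?_
    rw [Function.update_of_ne (Finset.ne_of_mem_erase hk)]

theorem bernMean_condition (e : ι) (f : (ι → Bool) → ℝ) :
    bernMean p f = bernMean p fun a =>
      p e * f (Function.update a e true) + (1 - p e) * f (Function.update a e false) := by
  unfold bernMean
  refine mul_left_cancel₀ (two_ne_zero (α := ℝ)) ?_
  rw [← sum_update_add_sum_update e, ← sum_update_add_sum_update e]
  refine Finset.sum_congr rfl fun a _ => ?_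
  simp only [bernWeight_update, Function.update_idem, if_true, Bool.false_eq_true, if_false]
  ring

/-- Integration by parts for a Bernoulli variable: a centered factor becomes a discrete derivative,
weighted by the variance p(1 - p). -/
theorem bernMean_ind_sub_mul (e : ι) (g : (ι → Bool) → ℝ) :
    bernMean p (fun a => (ind (a e) - p e) * g a) = bernMean p fun a =>
      p e * (1 - p e) * (g (Function.update a e true) - g (Function.update a e false)) := by
  rw [bernMean_condition e]
  congr 1; funext a
  simp [ind]; ring

/-- The way back after integration by parts: the sum over both values of one coordinate becomes an
expectation over the original configuration, so the moment recursion closes. -/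
theorem bernMean_update_add_update (e : ι) (h : (ι → Bool) → ℝ) :
    (bernMean p fun a => p e * (1 - p e) *
      (h (Function.update a e true) + h (Function.update a e false))) =
      bernMean p fun a => (if a e then 1 - p e else p e) * h a := by
  rw [bernMean_condition e (fun a => (if a e then 1 - p e else p e) * h a)]
  congr 1; funext a
  simp; ring

end Bernoulli

/-! ### Moments of a random matrix with independent entries -/

section RandomMatrix

open Matrix

variable {ι V : Type*} [Fintype ι]

/-- The centered random matrix `∑ e, (a e - p e) H e`. -/
noncomputable def centeredSum (p : ι → ℝ) (H : ι → Matrix V V ℝ) (a : ι → Bool) : Matrix V V ℝ :=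
  ∑ e, (ind (a e) - p e) • H e

variable {p : ι → ℝ} {H : ι → Matrix V V ℝ}

theorem centeredSum_isSymm (hH : ∀ e, (H e).IsSymm) (a : ι → Bool) :
    (centeredSum p H a).IsSymm := by
  simp only [Matrix.IsSymm, centeredSum, transpose_sum, transpose_smul, (hH _).eq]

variable [DecidableEq ι]

theorem centeredSum_update_sub (a : ι → Bool) (e : ι) :
    centeredSum p H (Function.update a e true) - centeredSum p H (Function.update a e false)
      = H e := by
  unfold centeredSum
  rw [← Finset.sum_sub_distrib, Finset.sum_eq_single e]
  · rw [← sub_smul]; simp [ind]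
  · intro k _ hk; simp [Function.update_of_ne hk]
  · simp

variable [Fintype V] [DecidableEq V]

/-- One factor of the power is expanded as the sum over e and integrated by parts. The derivative in
e changes the matrix by `H e`, so the trace inequality for differences of odd powers applies with `H
e` as the increment. -/
theorem bernMean_trace_pow_le (h0 : ∀ e, 0 ≤ p e) (h1 : ∀ e, p e ≤ 1)
    (hH : ∀ e, (H e).IsSymm) (r : ℕ) :
    bernMean p (fun a => (centeredSum p H a ^ (2 * r + 2)).trace) ≤
      (2 * r + 1) * bernMean p fun a => ∑ e, (if a e then 1 - p e else p e) *
        (H e * H e * centeredSum p H a ^ (2 * r)).trace := by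
  have e1 : ∀ a, (centeredSum p H a ^ (2 * r + 2)).trace = ∑ e, (ind (a e) - p e) *
      (H e * centeredSum p H a ^ (2 * r + 1)).trace := fun a => by
    rw [pow_succ']
    nth_rewrite 1 [centeredSum]
    rw [Finset.sum_mul, trace_sum]
    exact Finset.sum_congr rfl fun e _ => by rw [smul_mul_assoc, trace_smul, smul_eq_mul]
  simp only [e1]
  rw [bernMean_sum, bernMean_sum, Finset.mul_sum]
  refine Finset.sum_le_sum fun e _ => ?_
  rw [bernMean_ind_sub_mul e (fun a => (H e * centeredSum p H a ^ (2 * r + 1)).trace),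
    ← bernMean_update_add_update e (fun a => (H e * H e * centeredSum p H a ^ (2 * r)).trace),
    ← bernMean_const_mul]
  refine bernMean_mono h0 h1 fun a => ?_
  rw [← trace_sub, ← mul_sub]
  have := trace_mul_pow_sub_pow_le (hH e) (centeredSum_isSymm (p := p) hH (Function.update a e true))
    (centeredSum_isSymm (p := p) hH (Function.update a e false)) (centeredSum_update_sub a e) r
  calc _ ≤ p e * (1 - p e) * _ :=
        mul_le_mul_of_nonneg_left this (mul_nonneg (h0 e) (sub_nonneg.mpr (h1 e)))
    _ = _ := by ring

/-- One step of the moment recursion: outside a rare event all row sums are at most `K`. -/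
theorem bernMean_trace_pow_succ_le (h0 : ∀ e, 0 ≤ p e) (h1 : ∀ e, p e ≤ 1)
    (hH : ∀ e, (H e).IsSymm) {u : ι → V → ℝ} (hHu : ∀ e, H e * H e = diagonal (u e))
    (hu : ∀ e i, u e i = 0 ∨ u e i = 1) (hM : ∀ a i j, |centeredSum p H a i j| ≤ 1)
    (hun : ∀ i, ∑ e, u e i ≤ Fintype.card V) {D K : ℝ} (hD : ∀ i, ∑ e, p e * u e i ≤ D)
    (hD0 : 0 ≤ D) (hK : 0 ≤ K) (r : ℕ) :
    bernMean p (fun a => (centeredSum p H a ^ (2 * (r + 1))).trace) ≤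
      (2 * r + 1) * ((K + D) * bernMean p (fun a => (centeredSum p H a ^ (2 * r)).trace) +
        (Fintype.card V : ℝ) ^ (2 * r + 3) * Real.exp (2 * D - K)) := by
  classical
  set N : ℝ := (Fintype.card V : ℝ) with hN
  have hN0 : 0 ≤ N := by positivity
  -- The exceptional event: some row has more than `K` present entries.
  set B : Set (ι → Bool) := ⋃ i : V, {a | K < ∑ e, ind (a e) * u e i} with hB
  have hPB : bernProb p B ≤ N * Real.exp (2 * D - K) := by
    refine (bernProb_iUnion_le h0 h1 _).trans ?_
    calc _ ≤ ∑ _i : V, Real.exp (2 * D - K) :=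
          Finset.sum_le_sum fun i _ => bernProb_lt_sum_le h0 h1 (fun e => hu e i) (hD i) K
      _ = _ := by simp [hN]
  have hu0 : ∀ e i, 0 ≤ u e i := fun e i => by rcases hu e i with h | h <;> simp [h]
  -- Since `H e * H e` is diagonal, only diagonal entries of the even power occur, and these are
  -- nonnegative. Outside `B` their coefficients are at most `K + D`, because each weight is at most
  -- the indicator plus the probability. On `B` the trivial bound N · N^(2r) for each of the N rows
  -- is used.
  have pt : ∀ a, ∑ e, (if a e then 1 - p e else p e) *
      (H e * H e * centeredSum p H a ^ (2 * r)).trace ≤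
      (K + D) * (centeredSum p H a ^ (2 * r)).trace + N ^ (2 * r + 2) * (if a ∈ B then 1 else 0) :=
    fun a => by
    have hd := pow_even_diag_nonneg (centeredSum_isSymm (p := p) hH a) r
    have e1 : ∑ e, (if a e then 1 - p e else p e) *
        (H e * H e * centeredSum p H a ^ (2 * r)).trace =
        ∑ i, (∑ e, (if a e then 1 - p e else p e) * u e i) * (centeredSum p H a ^ (2 * r)) i i := by
      simp only [hHu, trace, diag_apply, diagonal_mul, Finset.mul_sum, Finset.sum_mul]
      rw [Finset.sum_comm]
      exact Finset.sum_congr rfl fun i _ => Finset.sum_congr rfl fun e _ => by ring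
    rw [e1]
    have hKD : 0 ≤ (K + D) * (centeredSum p H a ^ (2 * r)).trace :=
      mul_nonneg (by linarith) (Finset.sum_nonneg fun i _ => hd i)
    by_cases ha : a ∈ B
    · rw [if_pos ha, mul_one]
      refine le_trans ?_ (le_add_of_nonneg_left hKD)
      calc _ ≤ ∑ _i : V, N * N ^ (2 * r) := by
            refine Finset.sum_le_sum fun i _ => mul_le_mul ?_ ?_ (hd i) hN0
            · refine le_trans (Finset.sum_le_sum fun e _ => ?_) (hun i)
              refine mul_le_of_le_one_left (hu0 e i) ?_
              have := h0 e; have := h1 e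
              split_ifs <;> linarith
            · exact (le_abs_self _).trans (abs_pow_apply_le (hM a) _ i i)
        _ = _ := by rw [Finset.sum_const, Finset.card_univ, nsmul_eq_mul, ← hN]; ring
    · rw [if_neg ha, mul_zero, add_zero, trace, Finset.mul_sum]
      refine Finset.sum_le_sum fun i _ => mul_le_mul_of_nonneg_right ?_ (hd i)
      have hi : ∑ e, ind (a e) * u e i ≤ K := by
        by_contra hc
        exact ha (Set.mem_iUnion.mpr ⟨i, not_le.mp hc⟩)
      calc _ ≤ ∑ e, (ind (a e) * u e i + p e * u e i) := by
            refine Finset.sum_le_sum fun e _ => ?_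
            rw [← add_mul]
            refine mul_le_mul_of_nonneg_right ?_ (hu0 e i)
            have := h0 e
            unfold ind
            split_ifs <;> linarith
        _ ≤ _ := by rw [Finset.sum_add_distrib]; exact add_le_add hi (hD i)
  refine (bernMean_trace_pow_le h0 h1 hH r).trans ?_
  refine mul_le_mul_of_nonneg_left ((bernMean_mono h0 h1 pt).trans ?_) (by positivity)
  rw [bernMean_add, bernMean_const_mul, bernMean_const_mul]
  refine add_le_add le_rfl ?_
  calc _ ≤ N ^ (2 * r + 2) * (N * Real.exp (2 * D - K)) :=
        mul_le_mul_of_nonneg_left hPB (by positivity)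
    _ = _ := by ring

/-- Iteration of the recursion up to order `k`. The rarity hypothesis holds the exceptional
contribution below 1 in every round, hence below the running bound, which is at least 1; it turns `K
+ D` into `K + D + 1`. -/
theorem bernMean_trace_pow_le_of_rare (h0 : ∀ e, 0 ≤ p e) (h1 : ∀ e, p e ≤ 1)
    (hH : ∀ e, (H e).IsSymm) {u : ι → V → ℝ} (hHu : ∀ e, H e * H e = diagonal (u e))
    (hu : ∀ e i, u e i = 0 ∨ u e i = 1) (hM : ∀ a i j, |centeredSum p H a i j| ≤ 1)
    (hun : ∀ i, ∑ e, u e i ≤ Fintype.card V) {D K : ℝ} (hD : ∀ i, ∑ e, p e * u e i ≤ D)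
    (hD0 : 0 ≤ D) (hK : 0 ≤ K) {k : ℕ} (hV : 1 ≤ Fintype.card V)
    (hrare : (Fintype.card V : ℝ) ^ (2 * k + 1) * Real.exp (2 * D - K) ≤ 1) {r : ℕ} (hr : r ≤ k) :
    bernMean p (fun a => (centeredSum p H a ^ (2 * r)).trace) ≤
      Fintype.card V * (2 * k * (K + D + 1)) ^ r := by
  have hV' : (1 : ℝ) ≤ Fintype.card V := by exact_mod_cast hV
  induction r with
  | zero => simp [bernMean_const]
  | succ r ih =>
    have hk : (r : ℝ) + 1 ≤ k := by exact_mod_cast hr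
    have ih := ih (by omega)
    set b := Fintype.card V * (2 * k * (K + D + 1)) ^ r with hb
    have hb1 : 1 ≤ b := by
      refine one_le_mul_of_one_le_of_one_le hV' (one_le_pow₀ ?_)
      nlinarith [(Nat.cast_nonneg r : (0 : ℝ) ≤ r)]
    have h3 : (Fintype.card V : ℝ) ^ (2 * r + 3) * Real.exp (2 * D - K) ≤ 1 := by
      refine le_trans (mul_le_mul_of_nonneg_right ?_ (by positivity)) hrare
      exact pow_le_pow_right₀ hV' (by omega)
    refine (bernMean_trace_pow_succ_le h0 h1 hH hHu hu hM hun hD hD0 hK r).trans ?_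
    calc _ ≤ 2 * k * ((K + D) * b + b) := by
          refine mul_le_mul (by linarith) (add_le_add
            (mul_le_mul_of_nonneg_left ih (by linarith)) (h3.trans hb1)) ?_ (by positivity)
          refine add_nonneg (mul_nonneg (by linarith) ?_) (by positivity)
          rw [← bernMean_const (p := p) 0]
          exact bernMean_mono h0 h1 fun a => Finset.sum_nonneg fun i _ =>
            pow_even_diag_nonneg (centeredSum_isSymm hH a) r i
      _ = _ := by rw [hb]; ring

/-- The probability that the quadratic form of the centered matrix is ever above `c`. -/
theorem bernProb_quadForm_le (h0 : ∀ e, 0 ≤ p e) (h1 : ∀ e, p e ≤ 1)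
    (hH : ∀ e, (H e).IsSymm) {u : ι → V → ℝ} (hHu : ∀ e, H e * H e = diagonal (u e))
    (hu : ∀ e i, u e i = 0 ∨ u e i = 1) (hM : ∀ a i j, |centeredSum p H a i j| ≤ 1)
    (hun : ∀ i, ∑ e, u e i ≤ Fintype.card V) {D K : ℝ} (hD : ∀ i, ∑ e, p e * u e i ≤ D)
    (hD0 : 0 ≤ D) (hK : 0 ≤ K) {k : ℕ} (hk : k ≠ 0) (hV : 1 ≤ Fintype.card V)
    (hrare : (Fintype.card V : ℝ) ^ (2 * k + 1) * Real.exp (2 * D - K) ≤ 1) {c : ℝ} (hc : 0 < c) :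
    bernProb p {a | ∃ x : V → ℝ, c * ∑ i, x i ^ 2 < |x ⬝ᵥ centeredSum p H a *ᵥ x|} ≤
      Fintype.card V * (2 * k * (K + D + 1) / c ^ 2) ^ k := by
  have hnn : ∀ a, 0 ≤ (centeredSum p H a ^ (2 * k)).trace := fun a =>
    Finset.sum_nonneg fun i _ => pow_even_diag_nonneg (centeredSum_isSymm hH a) k i
  -- Markov's inequality for the moment of order 2k: a form exceeding `c` forces the trace above
  -- c^(2k).
  calc _ ≤ bernMean p (fun a => (c ^ (2 * k))⁻¹ * (centeredSum p H a ^ (2 * k)).trace) := by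
        refine bernProb_le_bernMean h0 h1 (fun a => mul_nonneg (by positivity) (hnn a)) ?_
        rintro a ⟨x, hx⟩
        by_contra hlt
        push Not at hlt
        rw [inv_mul_lt_iff₀ (by positivity), mul_one] at hlt
        exact absurd (abs_quadForm_le_of_trace_pow_le (centeredSum_isSymm hH a) hk hc.le hlt.le x)
          (not_le.mpr hx)
    _ ≤ (c ^ (2 * k))⁻¹ * (Fintype.card V * (2 * k * (K + D + 1)) ^ k) := by
        rw [bernMean_const_mul]
        exact mul_le_mul_of_nonneg_left (bernMean_trace_pow_le_of_rare h0 h1 hH hHu hu hM hun hD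
          hD0 hK hV hrare le_rfl) (by positivity)
    _ = _ := by rw [div_pow, ← pow_mul]; ring

end RandomMatrix

/-! ### Bounds for the deviation from the mean -/

section Gam

variable {n : ℕ}

theorem gam_nonneg (X : Fin n → ℝ) : 0 ≤ gam X := (gam_isNodeSimilarityMeasure n).nonneg X

theorem gam_add_le (X Y : Fin n → ℝ) : gam (X + Y) ≤ gam X + gam Y :=
  (gam_isNodeSimilarityMeasure n).add_le X Y

theorem mul_gam_sq (hn : 0 < n) (X : Fin n → ℝ) :
    n * gam X ^ 2 = ∑ i, (X i - (∑ j, X j) / n) ^ 2 := by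
  have hn' : (0 : ℝ) < n := by exact_mod_cast hn
  rw [gam, mul_pow, inv_pow, Real.sq_sqrt hn'.le,
    Real.sq_sqrt (Finset.sum_nonneg fun i _ => sq_nonneg _)]
  field_simp

/-- The mean minimizes the sum of squared deviations. -/
theorem mul_gam_sq_le (hn : 0 < n) (X : Fin n → ℝ) (c : ℝ) :
    n * gam X ^ 2 ≤ ∑ i, (X i - c) ^ 2 := by
  have hn' : (0 : ℝ) < n := by exact_mod_cast hn
  rw [mul_gam_sq hn]
  set m := (∑ j, X j) / n with hm
  have hs : ∑ j, X j = n * m := by rw [hm]; field_simp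
  have : ∑ i, (X i - c) ^ 2 = ∑ i, (X i - m) ^ 2 + n * (m - c) ^ 2 := by
    have e : ∀ i, (X i - c) ^ 2 = (X i - m) ^ 2 + (2 * (m - c) * X i + (c ^ 2 - m ^ 2)) :=
      fun i => by ring
    simp only [e, Finset.sum_add_distrib, ← Finset.mul_sum, hs, Finset.sum_const,
      Finset.card_univ, Fintype.card_fin, nsmul_eq_mul]
    ring
  rw [this]
  exact le_add_of_nonneg_right (by positivity)

theorem gam_smul (c : ℝ) (X : Fin n → ℝ) : gam (c • X) = |c| * gam X := by
  have e : ∀ i, ((c • X) i - (∑ j, (c • X) j) / n) ^ 2 = c ^ 2 * (X i - (∑ j, X j) / n) ^ 2 :=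
    fun i => by
      simp only [Pi.smul_apply, smul_eq_mul, ← Finset.mul_sum]
      ring
  unfold gam
  rw [Finset.sum_congr rfl fun i _ => e i, ← Finset.mul_sum, Real.sqrt_mul (sq_nonneg c),
    Real.sqrt_sq_eq_abs]
  ring

theorem gam_le_of_abs_le {X : Fin n → ℝ} {b : ℝ} (hb : 0 ≤ b) (h : ∀ i, |X i| ≤ b) :
    gam X ≤ b := by
  rcases Nat.eq_zero_or_pos n with rfl | hn
  · simpa [gam] using hb
  have hn' : (0 : ℝ) < n := by exact_mod_cast hn
  refine le_of_sq_le_sq ?_ hb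
  refine le_of_mul_le_mul_left ?_ hn'
  refine (mul_gam_sq_le hn X 0).trans ?_
  calc _ ≤ ∑ _i : Fin n, b ^ 2 := Finset.sum_le_sum fun i _ => by
        rw [sub_zero, ← sq_abs]; exact pow_le_pow_left₀ (abs_nonneg _) (h i) 2
    _ = _ := by simp

theorem abs_gam_sub_gam_le {X Y : Fin n → ℝ} {b : ℝ} (hb : 0 ≤ b) (h : ∀ i, |X i - Y i| ≤ b) :
    |gam X - gam Y| ≤ b := by
  have h1 := gam_add_le (X - Y) Y
  have h2 := gam_add_le (Y - X) X
  have h3 := gam_le_of_abs_le (X := X - Y) hb h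
  have h4 := gam_le_of_abs_le (X := Y - X) hb fun i => by
    rw [Pi.sub_apply, abs_sub_comm]; exact h i
  rw [sub_add_cancel] at h1 h2
  exact abs_le.mpr ⟨by linarith, by linarith⟩

end Gam

/-! ### The sign vector of the labels -/

section Signs

variable {n : ℕ}

/-- The label of a node as a sign. -/
def sgn (ε : Fin n → Bool) (i : Fin n) : ℝ := if ε i then 1 else -1

theorem sgn_mul_self (ε : Fin n → Bool) (i : Fin n) : sgn ε i * sgn ε i = 1 := by
  unfold sgn; split_ifs <;> norm_num

theorem abs_sgn (ε : Fin n → Bool) (i : Fin n) : |sgn ε i| = 1 := by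
  unfold sgn; split_ifs <;> norm_num

theorem sgn_mul_sgn (ε : Fin n → Bool) (i j : Fin n) :
    sgn ε i * sgn ε j = if ε i = ε j then 1 else -1 := by
  unfold sgn; cases ε i <;> cases ε j <;> norm_num

/-- The squared deviation of the sign vector is 1 - m², where m is its mean, and here m² ≤ 1/4. -/
theorem le_gam_sgn (hn : 0 < n) {ε : Fin n → Bool} (h : |∑ i, sgn ε i| ≤ n / 2) :
    3 / 4 ≤ gam (sgn ε) := by
  have hn' : (0 : ℝ) < n := by exact_mod_cast hn
  set m := (∑ j, sgn ε j) / n with hm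
  have hs : ∑ j, sgn ε j = n * m := by rw [hm]; field_simp
  have hm2 : m ^ 2 ≤ 1 / 4 := by
    rw [hs, abs_mul, abs_of_pos hn'] at h
    have : |m| ≤ 1 / 2 := by
      refine le_of_mul_le_mul_left ?_ hn'; linarith
    rw [← sq_abs]
    nlinarith [abs_nonneg m]
  have key : gam (sgn ε) ^ 2 = 1 - m ^ 2 := by
    refine mul_left_cancel₀ hn'.ne' ?_
    rw [mul_gam_sq hn, ← hm]
    have e : ∀ i, (sgn ε i - m) ^ 2 = 1 + m ^ 2 - 2 * m * sgn ε i := fun i => by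
      have := sgn_mul_self ε i
      linear_combination this
    simp only [e, Finset.sum_sub_distrib, ← Finset.mul_sum, hs, Finset.sum_const,
      Finset.card_univ, Fintype.card_fin, nsmul_eq_mul]
    ring
  have := gam_nonneg (sgn ε)
  nlinarith

end Signs

/-! ### One attention layer -/

section AttentionLayer

variable {n : ℕ}

/-- The number of neighbours of `i` of its own class. -/
def degSame (ε : Fin n → Bool) (A : Matrix (Fin n) (Fin n) ℝ) (i : Fin n) : ℝ :=
  ∑ j, if ε i = ε j then A i j else 0

/-- The number of neighbours of `i` of the other class. -/
def degDiff (ε : Fin n → Bool) (A : Matrix (Fin n) (Fin n) ℝ) (i : Fin n) : ℝ :=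
  ∑ j, if ε i = ε j then 0 else A i j

theorem degSame_add_degDiff (ε : Fin n → Bool) (A : Matrix (Fin n) (Fin n) ℝ) (i : Fin n) :
    degSame ε A i + degDiff ε A i = ∑ j, A i j := by
  rw [degSame, degDiff, ← Finset.sum_add_distrib]
  exact Finset.sum_congr rfl fun j _ => by split_ifs <;> simp

theorem gatLayer_zero (A : Matrix (Fin n) (Fin n) ℝ) : gatLayer 0 A = gcnLayer A := by
  funext X i
  simp [gatLayer, gcnLayer, attentionCoeff, attention]

theorem gatFeat_zero (ω : Outcome n) : gatFeat 0 ω = gcnFeat ω := by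
  funext l
  rw [gatFeat, gcnFeat, gatLayer_zero]

/-- A layer takes weighted averages. A node without neighbours has normalizing sum 0 and gets the
value 0, so no condition on the degrees is needed. -/
theorem abs_gatLayer_le {A : Matrix (Fin n) (Fin n) ℝ} (hA : ∀ i j, 0 ≤ A i j) (t : ℝ)
    {X : Fin n → ℝ} {b : ℝ} (hb : 0 ≤ b) (h : ∀ i, |X i| ≤ b) (i : Fin n) :
    |gatLayer t A X i| ≤ b := by
  set Z := ∑ k, A i k * Real.exp (attention t (X i) (X k)) with hZ
  have hZ0 : 0 ≤ Z := Finset.sum_nonneg fun k _ => mul_nonneg (hA i k) (Real.exp_pos _).le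
  calc |gatLayer t A X i|
      ≤ ∑ j, |A i j * attentionCoeff t A X i j * X j| := Finset.abs_sum_le_sum_abs _ _
    _ ≤ ∑ j, A i j * Real.exp (attention t (X i) (X j)) / Z * b := by
        refine Finset.sum_le_sum fun j _ => ?_
        have hc : A i j * attentionCoeff t A X i j
            = A i j * Real.exp (attention t (X i) (X j)) / Z := by
          rw [attentionCoeff, ← hZ, mul_div_assoc]
        have : 0 ≤ A i j * Real.exp (attention t (X i) (X j)) / Z :=
          div_nonneg (mul_nonneg (hA i j) (Real.exp_pos _).le) hZ0
        rw [hc, abs_mul, abs_of_nonneg this]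
        exact mul_le_mul_of_nonneg_left (h j) this
    _ = Z / Z * b := by rw [← Finset.sum_mul, ← Finset.sum_div]
    _ ≤ b := mul_le_of_le_one_left hb (div_self_le_one Z)

/-- The fraction of attention that a typical node pays to the other class. -/
noncomputable def leak (p q t : ℝ) : ℝ :=
  q * Real.exp (-t) / (p * Real.exp t + q * Real.exp (-t))

/-- The error is relative to the leaking fraction itself, not to 1. This is what permits arbitrarily
many layers: each loses signal in proportion to the leak, and the errors have to be paid from that
loss. -/
theorem leak_ratio_bound {p q δ S T x y : ℝ} (hp : 0 < p) (hq : 0 ≤ q) (hx : 0 < x) (hy : 0 < y)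
    (hδ : 0 ≤ δ) (hδ1 : δ ≤ 1 / 3) {N : ℝ} (hN : 0 < N) (hS : |S - N * p| ≤ δ * (N * p))
    (hT : |T - N * q| ≤ δ * (N * q)) :
    0 < S * x + T * y ∧ |T * y / (S * x + T * y) - q * y / (p * x + q * y)| ≤
      3 * δ * (q * y / (p * x + q * y)) := by
  obtain ⟨s1, s2⟩ := abs_le.mp hS
  obtain ⟨t1, t2⟩ := abs_le.mp hT
  have hNp : 0 < N * p := by positivity
  have hNq : 0 ≤ N * q := by positivity
  have hZ : 0 < S * x + T * y := by
    have h1 : 0 < S * x := mul_pos (by nlinarith) hx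
    have h2 : 0 ≤ T * y := mul_nonneg (by nlinarith) hy.le
    linarith
  refine ⟨hZ, ?_⟩
  have hW : 0 < p * x + q * y := by positivity
  have hWN : 0 < N * (p * x + q * y) := by positivity
  have hZ1 : (1 - δ) * (N * (p * x + q * y)) ≤ S * x + T * y := by
    have h1 := mul_le_mul_of_nonneg_right (show (1 - δ) * (N * p) ≤ S by linarith) hx.le
    have h2 := mul_le_mul_of_nonneg_right (show (1 - δ) * (N * q) ≤ T by linarith) hy.le
    linarith
  have hZ2 : S * x + T * y ≤ (1 + δ) * (N * (p * x + q * y)) := by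
    have h1 := mul_le_mul_of_nonneg_right (show S ≤ (1 + δ) * (N * p) by linarith) hx.le
    have h2 := mul_le_mul_of_nonneg_right (show T ≤ (1 + δ) * (N * q) by linarith) hy.le
    linarith
  have hQ : q * y / (p * x + q * y) = N * q * y / (N * (p * x + q * y)) := by
    field_simp
  set W := N * (p * x + q * y)
  set Z := S * x + T * y
  have hNy : 0 ≤ N * q * y := by positivity
  have hT1 := mul_le_mul_of_nonneg_right (show (1 - δ) * (N * q) ≤ T by linarith) hy.le
  have hT2 := mul_le_mul_of_nonneg_right (show T ≤ (1 + δ) * (N * q) by linarith) hy.le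
  rw [hQ]
  have c1 : T * y / Z ≤ (1 + 3 * δ) * (N * q * y / W) := by
    rw [← mul_div_assoc, div_le_div_iff₀ hZ hWN]
    have : (1 + δ) * W ≤ (1 + 3 * δ) * Z := by nlinarith
    nlinarith
  have c2 : (1 - 3 * δ) * (N * q * y / W) ≤ T * y / Z := by
    rw [← mul_div_assoc, div_le_div_iff₀ hWN hZ]
    have : (1 - 3 * δ) * Z ≤ (1 - δ) * W := by nlinarith
    nlinarith
  exact abs_le.mpr ⟨by linarith, by linarith⟩

/-- A layer contracts the signal by `1 - 2 * leak` and increases the error only slightly. -/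
theorem abs_sgn_mul_gatLayer_sub_le {A : Matrix (Fin n) (Fin n) ℝ} (hA : ∀ i j, 0 ≤ A i j)
    {ε : Fin n → Bool} {p q δ t : ℝ} (hn : 0 < n) (hp : 0 < p) (hq : 0 ≤ q) (hδ : 0 ≤ δ)
    (hδ1 : δ ≤ 1 / 3)
    (hS : ∀ i, |degSame ε A i - n / 2 * p| ≤ δ * (n / 2 * p))
    (hT : ∀ i, |degDiff ε A i - n / 2 * q| ≤ δ * (n / 2 * q))
    {X : Fin n → ℝ} {b R : ℝ} (hR : R < b) (h : ∀ i, |sgn ε i * X i - b| ≤ R) (i : Fin n) :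
    |sgn ε i * gatLayer t A X i - (1 - 2 * leak p q t) * b| ≤
      R + 2 * (3 * δ) * leak p q t * b := by
  have hn' : (0 : ℝ) < n := by exact_mod_cast hn
  obtain ⟨hZ, hf⟩ := leak_ratio_bound hp hq (Real.exp_pos t) (Real.exp_pos (-t)) hδ hδ1
    (half_pos hn') (hS i) (hT i)
  change |_ - leak p q t| ≤ 3 * δ * leak p q t at hf
  have hb : 0 < b := by
    have := (abs_nonneg _).trans (h i); linarith
  -- Since `R < b`, every feature still has the sign of its label, so the attention depends on the
  -- labels alone.
  have hpos : ∀ j, 0 < sgn ε j * X j := fun j => by have := (abs_le.mp (h j)).1; linarith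
  have hatt : ∀ j, attention t (X i) (X j) = if ε i = ε j then t else -t := fun j => by
    have h2 := mul_pos (hpos i) (hpos j)
    have e : sgn ε i * X i * (sgn ε j * X j) = (if ε i = ε j then 1 else -1) * (X i * X j) := by
      rw [← sgn_mul_sgn]; ring
    rw [e] at h2
    unfold attention
    by_cases hij : ε i = ε j
    · rw [if_pos hij] at h2
      rw [if_pos hij, if_pos (by linarith)]
    · rw [if_neg hij] at h2
      rw [if_neg hij, if_neg (by linarith)]
  set w : Fin n → ℝ := fun j => A i j * Real.exp (attention t (X i) (X j)) with hw
  have hw0 : ∀ j, 0 ≤ w j := fun j => mul_nonneg (hA i j) (Real.exp_pos _).le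
  have hwS : ∑ j, w j = degSame ε A i * Real.exp t + degDiff ε A i * Real.exp (-t) := by
    rw [degSame, degDiff, Finset.sum_mul, Finset.sum_mul, ← Finset.sum_add_distrib]
    refine Finset.sum_congr rfl fun j _ => ?_
    simp only [hw, hatt]
    split_ifs <;> simp
  have hwD : ∑ j, w j * (sgn ε i * sgn ε j)
      = degSame ε A i * Real.exp t - degDiff ε A i * Real.exp (-t) := by
    rw [degSame, degDiff, Finset.sum_mul, Finset.sum_mul, ← Finset.sum_sub_distrib]
    refine Finset.sum_congr rfl fun j _ => ?_
    simp only [hw, hatt, sgn_mul_sgn]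
    split_ifs <;> simp
  set Z := degSame ε A i * Real.exp t + degDiff ε A i * Real.exp (-t) with hZdef
  set f := degDiff ε A i * Real.exp (-t) / Z with hfdef
  have hfZ : degDiff ε A i * Real.exp (-t) = f * Z := by rw [hfdef]; field_simp
  -- The signed weights sum to (1 - 2f)Z, so subtracting the contracted signal leaves an average, up
  -- to signs, of the incoming deviations. Therefore old errors are not amplified.
  have hlayer : sgn ε i * gatLayer t A X i - (1 - 2 * f) * b
      = (∑ j, w j * (sgn ε i * sgn ε j) * (sgn ε j * X j - b)) / Z := by
    have e1 : gatLayer t A X i = (∑ j, w j * X j) / Z := by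
      rw [gatLayer, Finset.sum_div]
      refine Finset.sum_congr rfl fun j _ => ?_
      have : attentionCoeff t A X i j = Real.exp (attention t (X i) (X j)) / Z := by
        rw [attentionCoeff]; congr 1
      rw [this]
      simp only [hw]
      ring
    have e2 : ∑ j, w j * (sgn ε i * sgn ε j) * (sgn ε j * X j - b)
        = sgn ε i * (∑ j, w j * X j) - (Z - 2 * (f * Z)) * b := by
      have : Z - 2 * (f * Z) = ∑ j, w j * (sgn ε i * sgn ε j) := by rw [hwD, ← hfZ, hZdef]; ring
      rw [this, Finset.mul_sum, Finset.sum_mul, ← Finset.sum_sub_distrib]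
      refine Finset.sum_congr rfl fun j _ => ?_
      linear_combination w j * sgn ε i * X j * sgn_mul_self ε j
    rw [e1, e2]
    field_simp
  have h1 : |sgn ε i * gatLayer t A X i - (1 - 2 * f) * b| ≤ R := by
    rw [hlayer, abs_div, abs_of_pos hZ, div_le_iff₀ hZ, ← hwS, Finset.mul_sum]
    refine (Finset.abs_sum_le_sum_abs _ _).trans (Finset.sum_le_sum fun j _ => ?_)
    rw [abs_mul, abs_mul (w j), abs_mul (sgn ε i), abs_sgn, abs_sgn, abs_of_nonneg (hw0 j), mul_one,
      mul_one, mul_comm]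
    exact mul_le_mul_of_nonneg_right (h j) (hw0 j)
  have h2 : |(1 - 2 * f) * b - (1 - 2 * leak p q t) * b| ≤ 2 * (3 * δ) * leak p q t * b := by
    have : (1 - 2 * f) * b - (1 - 2 * leak p q t) * b = -(2 * b * (f - leak p q t)) := by ring
    rw [this, abs_neg, abs_mul, abs_of_pos (by positivity)]
    nlinarith
  calc _ = |(sgn ε i * gatLayer t A X i - (1 - 2 * f) * b) +
        ((1 - 2 * f) * b - (1 - 2 * leak p q t) * b)| := by congr 1; ring
    _ ≤ _ := (abs_add_le _ _).trans (add_le_add h1 h2)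

theorem leak_nonneg {p q : ℝ} (hp : 0 ≤ p) (hq : 0 ≤ q) (t : ℝ) : 0 ≤ leak p q t := by
  unfold leak; positivity

theorem one_sub_two_mul_leak {p q : ℝ} (hp : 0 < p) (hq : 0 ≤ q) (t : ℝ) :
    1 - 2 * leak p q t = (p * Real.exp t - q * Real.exp (-t)) /
      (p * Real.exp t + q * Real.exp (-t)) := by
  have : 0 < p * Real.exp t + q * Real.exp (-t) := by positivity
  rw [leak]; field_simp; ring

theorem one_sub_two_mul_leak_nonneg {p q t : ℝ} (hp : 0 < p) (hq : 0 ≤ q) (hqp : q ≤ p)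
    (ht : 0 ≤ t) : 0 ≤ 1 - 2 * leak p q t := by
  rw [one_sub_two_mul_leak hp hq]
  have h1 : Real.exp (-t) ≤ Real.exp t := Real.exp_le_exp.mpr (by linarith)
  have h2 : q * Real.exp (-t) ≤ p * Real.exp t :=
    mul_le_mul hqp h1 (Real.exp_pos _).le hp.le
  exact div_nonneg (by linarith) (by positivity)

/-- In every layer the features stay close to the contracted sign vector. -/
theorem abs_iterate_gatLayer_sub_le {A : Matrix (Fin n) (Fin n) ℝ} (hA : ∀ i j, 0 ≤ A i j)
    {ε : Fin n → Bool} {p q δ t μ : ℝ} (hn : 0 < n) (hp : 0 < p) (hq : 0 ≤ q) (hqp : q ≤ p)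
    (ht : 0 ≤ t) (hμ : 0 < μ) (hδ : 0 ≤ δ) (hδ1 : δ ≤ 1 / 3)
    (hS : ∀ i, |degSame ε A i - n / 2 * p| ≤ δ * (n / 2 * p))
    (hT : ∀ i, |degDiff ε A i - n / 2 * q| ≤ δ * (n / 2 * q))
    {X : Fin n → ℝ} (h : ∀ i, |sgn ε i * X i - μ| ≤ δ * μ) (l : ℕ) (i : Fin n) :
    |(gatLayer t A)^[l] X i - (1 - 2 * leak p q t) ^ l * μ * sgn ε i| ≤ 12 * δ * μ := by
  set f := leak p q t with hf
  have hf0 : 0 ≤ f := leak_nonneg hp.le hq t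
  have hr0 : 0 ≤ 1 - 2 * f := one_sub_two_mul_leak_nonneg hp hq hqp ht
  set r := 1 - 2 * f with hr
  have hr1 : r ≤ 1 := by linarith
  have hrl : ∀ l, 0 ≤ r ^ l ∧ r ^ l ≤ 1 := fun l => ⟨pow_nonneg hr0 l, pow_le_one₀ hr0 hr1⟩
  have hδμ : 0 ≤ δ * μ := by positivity
  have e : ∀ (y c : ℝ) (i : Fin n), |sgn ε i * y - c| = |y - c * sgn ε i| := fun y c i => by
    have : sgn ε i * y - c = sgn ε i * (y - c * sgn ε i) := by
      linear_combination c * sgn_mul_self ε i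
    rw [this, abs_mul, abs_sgn, one_mul]
  -- Two regimes. With a visible signal, layer l adds the error 3δμ(1-r)r^l = 3δμ(r^l - r^(l+1)),
  -- which telescopes. After r^l has dropped to 4δ, the features are at most 4δμ + 4δμ in absolute
  -- value and stay so by averaging.
  have inv : (∀ i, |sgn ε i * (gatLayer t A)^[l] X i - r ^ l * μ| ≤
      δ * μ + 3 * δ * μ * (1 - r ^ l)) ∨
      ((∀ i, |(gatLayer t A)^[l] X i| ≤ 8 * δ * μ) ∧ r ^ l ≤ 4 * δ) := by
    induction l with
    | zero => left; intro i; simpa using h i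
    | succ l ih =>
      rw [Function.iterate_succ_apply']
      have hpow : r ^ (l + 1) = r * r ^ l := pow_succ' r l
      have hle : r ^ (l + 1) ≤ r ^ l := by
        rw [hpow]; exact mul_le_of_le_one_left (hrl l).1 hr1
      have sup : (∀ i, |(gatLayer t A)^[l] X i| ≤ 8 * δ * μ) → r ^ l ≤ 4 * δ →
          ((∀ i, |gatLayer t A ((gatLayer t A)^[l] X) i| ≤ 8 * δ * μ) ∧ r ^ (l + 1) ≤ 4 * δ) :=
        fun h1 h2 => ⟨fun i => abs_gatLayer_le hA t (by linarith) h1 i, hle.trans h2⟩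
      rcases ih with ih | ih
      · by_cases hrδ : r ^ l ≤ 4 * δ
        · right
          refine sup (fun i => ?_) hrδ
          have h1 := ih i
          rw [e] at h1
          have h2 : |r ^ l * μ * sgn ε i| ≤ 4 * δ * μ := by
            rw [abs_mul, abs_sgn, mul_one, abs_of_nonneg (mul_nonneg (hrl l).1 hμ.le)]
            exact mul_le_mul_of_nonneg_right hrδ hμ.le
          have h3 := abs_add_le ((gatLayer t A)^[l] X i - r ^ l * μ * sgn ε i)
            (r ^ l * μ * sgn ε i)
          rw [sub_add_cancel] at h3
          nlinarith [(hrl l).1]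
        · left
          intro i
          -- The threshold 4δ is chosen so that above it the accumulated error is still smaller than
          -- the signal.
          have hb : δ * μ + 3 * δ * μ * (1 - r ^ l) < r ^ l * μ := by
            nlinarith [(hrl l).1, mul_nonneg hδμ (hrl l).1]
          have := abs_sgn_mul_gatLayer_sub_le (t := t) hA hn hp hq hδ hδ1 hS hT hb ih i
          rw [← hf] at this
          calc _ = |sgn ε i * gatLayer t A ((gatLayer t A)^[l] X) i - (1 - 2 * f) * (r ^ l * μ)| := by
                rw [hpow, mul_assoc]
            _ ≤ _ := this
            _ = _ := by rw [hpow, hr]; ring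
      · exact Or.inr (sup ih.1 ih.2)
  rcases inv with inv | ⟨h1, h2⟩
  · rw [← e]
    refine (inv i).trans ?_
    nlinarith [(hrl l).1]
  · refine (abs_sub _ _).trans ?_
    rw [abs_mul (r ^ l * μ), abs_sgn, mul_one, abs_of_nonneg (mul_nonneg (hrl l).1 hμ.le)]
    have := h1 i
    have := mul_le_mul_of_nonneg_right h2 hμ.le
    linarith

/-- The similarity follows the powers of the contraction factor. -/
theorem abs_gam_iterate_gatLayer_sub_le {A : Matrix (Fin n) (Fin n) ℝ} (hA : ∀ i j, 0 ≤ A i j)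
    {ε : Fin n → Bool} {p q δ t μ : ℝ} (hn : 0 < n) (hp : 0 < p) (hq : 0 ≤ q) (hqp : q ≤ p)
    (ht : 0 ≤ t) (hμ : 0 < μ) (hδ : 0 ≤ δ) (hδ1 : δ ≤ 1 / 4)
    (hε : |∑ i, sgn ε i| ≤ n / 2)
    (hS : ∀ i, |degSame ε A i - n / 2 * p| ≤ δ * (n / 2 * p))
    (hT : ∀ i, |degDiff ε A i - n / 2 * q| ≤ δ * (n / 2 * q))
    {X : Fin n → ℝ} (h : ∀ i, |sgn ε i * X i - μ| ≤ δ * μ) (l : ℕ) :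
    μ / 2 ≤ gam X ∧
      |gam ((gatLayer t A)^[l] X) - ((p * Real.exp t - q * Real.exp (-t)) /
        (p * Real.exp t + q * Real.exp (-t))) ^ l * gam X| ≤ 26 * δ * gam X := by
  rw [← one_sub_two_mul_leak hp hq]
  have hr0 : 0 ≤ 1 - 2 * leak p q t := one_sub_two_mul_leak_nonneg hp hq hqp ht
  have hf0 : 0 ≤ leak p q t := leak_nonneg hp.le hq t
  have hl := abs_iterate_gatLayer_sub_le hA hn hp hq hqp ht hμ hδ (by linarith) hS hT h l
  set r := 1 - 2 * leak p q t with hr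
  have hr1 : r ≤ 1 := by linarith
  have hrl0 := pow_nonneg hr0 l
  have hrl1 : r ^ l ≤ 1 := pow_le_one₀ hr0 hr1
  have hδμ : 0 ≤ δ * μ := by positivity
  have g1 : |gam ((gatLayer t A)^[l] X) - r ^ l * μ * gam (sgn ε)| ≤ 12 * δ * μ := by
    have := abs_gam_sub_gam_le (Y := (r ^ l * μ) • sgn ε) (by linarith) hl
    rwa [gam_smul, abs_of_nonneg (show 0 ≤ r ^ l * μ from mul_nonneg hrl0 hμ.le)] at this
  have g0 : |gam X - μ * gam (sgn ε)| ≤ δ * μ := by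
    have := abs_gam_sub_gam_le (X := X) (Y := μ • sgn ε) hδμ fun i => by
      have h1 := h i
      have : sgn ε i * X i - μ = sgn ε i * (X i - μ * sgn ε i) := by
        linear_combination μ * sgn_mul_self ε i
      rwa [this, abs_mul, abs_sgn, one_mul] at h1
    rwa [gam_smul, abs_of_nonneg hμ.le] at this
  have hs := le_gam_sgn hn hε
  -- 3/4 from the balanced labels, minus δ ≤ 1/4 from the noise. This converts the total error 12δμ
  -- + δμ into 26δ times the initial similarity.
  have hX : μ / 2 ≤ gam X := by
    have := (abs_le.mp g0).1
    nlinarith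
  refine ⟨hX, ?_⟩
  have g2 : |r ^ l * μ * gam (sgn ε) - r ^ l * gam X| ≤ δ * μ := by
    have : r ^ l * μ * gam (sgn ε) - r ^ l * gam X = -(r ^ l * (gam X - μ * gam (sgn ε))) := by
      ring
    rw [this, abs_neg, abs_mul, abs_of_nonneg hrl0]
    exact (mul_le_of_le_one_left (abs_nonneg _) hrl1).trans g0
  have g3 := abs_sub_le (gam ((gatLayer t A)^[l] X)) (r ^ l * μ * gam (sgn ε)) (r ^ l * gam X)
  nlinarith

end AttentionLayer

/-! ### Contraction of the graph convolution from a bound on quadratic forms -/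

section Contraction

variable {n : ℕ} {A : Matrix (Fin n) (Fin n) ℝ}

/-- The degree of a node. -/
def deg (A : Matrix (Fin n) (Fin n) ℝ) (i : Fin n) : ℝ := ∑ j, A i j

/-- The bilinear form of a matrix. -/
def biForm (A : Matrix (Fin n) (Fin n) ℝ) (x y : Fin n → ℝ) : ℝ := ∑ i, ∑ j, x i * A i j * y j

theorem biForm_comm (hA : ∀ i j, A i j = A j i) (x y : Fin n → ℝ) :
    biForm A x y = biForm A y x := by
  unfold biForm
  rw [Finset.sum_comm]
  exact Finset.sum_congr rfl fun i _ => Finset.sum_congr rfl fun j _ => by rw [hA j i]; ring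

theorem biForm_add_sub (hA : ∀ i j, A i j = A j i) (x y : Fin n → ℝ) :
    biForm A (x + y) (x + y) - biForm A (x - y) (x - y) = 4 * biForm A y x := by
  have : biForm A (x + y) (x + y) - biForm A (x - y) (x - y)
      = 2 * biForm A x y + 2 * biForm A y x := by
    simp only [biForm, Finset.mul_sum, ← Finset.sum_add_distrib, ← Finset.sum_sub_distrib]
    refine Finset.sum_congr rfl fun i _ => Finset.sum_congr rfl fun j _ => ?_
    simp only [Pi.add_apply, Pi.sub_apply]
    ring
  rw [this, biForm_comm hA x y]; ring

/-- The degree distribution is stationary for the random walk; orthogonality to the degrees is thus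
preserved by every layer. -/
theorem sum_deg_mul_gcnLayer (hA : ∀ i j, A i j = A j i) (hd : ∀ i, 0 < deg A i)
    (x : Fin n → ℝ) : ∑ i, deg A i * gcnLayer A x i = ∑ i, deg A i * x i := by
  have : ∀ i, deg A i * gcnLayer A x i = ∑ j, A i j * x j := fun i => by
    rw [gcnLayer, Finset.mul_sum]
    refine Finset.sum_congr rfl fun j _ => ?_
    have := (hd i).ne'
    rw [← deg]; field_simp
  simp only [this]
  rw [Finset.sum_comm]
  refine Finset.sum_congr rfl fun j _ => ?_
  rw [deg, Finset.sum_mul]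
  exact Finset.sum_congr rfl fun i _ => by rw [hA i j]

theorem biForm_eq_sum_deg_mul (hd : ∀ i, 0 < deg A i) (x y : Fin n → ℝ) :
    biForm A x y = ∑ i, deg A i * (x i * gcnLayer A y i) := by
  refine Finset.sum_congr rfl fun i _ => ?_
  rw [gcnLayer, Finset.mul_sum, Finset.mul_sum]
  refine Finset.sum_congr rfl fun j _ => ?_
  have := (hd i).ne'
  rw [← deg]; field_simp

theorem gcnLayer_sub_const (hd : ∀ i, 0 < deg A i) (x : Fin n → ℝ) (c : ℝ) (i : Fin n) :
    gcnLayer A (fun j => x j - c) i = gcnLayer A x i - c := by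
  have h1 : ∑ j, A i j * (deg A i)⁻¹ * c = c := by
    rw [← Finset.sum_mul, ← Finset.sum_mul, ← deg, mul_inv_cancel₀ (hd i).ne', one_mul]
  nth_rewrite 2 [← h1]
  simp only [gcnLayer, mul_sub, Finset.sum_sub_distrib]
  rfl

/-- The convolution is self-adjoint for the degree-weighted inner product, so a bound on its form is
a bound on its norm. Polarization with g and h = ρ⁻¹ times the layer output gives this without a
spectral decomposition: the pairing of h with the output is ρ⁻¹ times the squared norm to be
bounded. -/
theorem sum_deg_mul_gcnLayer_sq_le (hA : ∀ i j, A i j = A j i) (hd : ∀ i, 0 < deg A i) {ρ : ℝ}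
    (hρ : 0 < ρ)
    (hform : ∀ g : Fin n → ℝ, ∑ i, deg A i * g i = 0 →
      |biForm A g g| ≤ ρ * ∑ i, deg A i * g i ^ 2)
    {g : Fin n → ℝ} (hg : ∑ i, deg A i * g i = 0) :
    ∑ i, deg A i * gcnLayer A g i ^ 2 ≤ ρ ^ 2 * ∑ i, deg A i * g i ^ 2 := by
  set h : Fin n → ℝ := fun i => ρ⁻¹ * gcnLayer A g i with hh
  have hh0 : ∑ i, deg A i * h i = 0 := by
    have : ∑ i, deg A i * h i = ρ⁻¹ * ∑ i, deg A i * gcnLayer A g i := by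
      rw [Finset.mul_sum]; exact Finset.sum_congr rfl fun i _ => by rw [hh]; ring
    rw [this, sum_deg_mul_gcnLayer hA hd, hg, mul_zero]
  have hp := hform (g + h) (by
    simp only [Pi.add_apply, mul_add, Finset.sum_add_distrib, hg, hh0, add_zero])
  have hm := hform (g - h) (by
    simp only [Pi.sub_apply, mul_sub, Finset.sum_sub_distrib, hg, hh0, sub_zero])
  have hpol := biForm_add_sub hA g h
  have hsum : ∑ i, deg A i * (g + h) i ^ 2 + ∑ i, deg A i * (g - h) i ^ 2
      = 2 * ∑ i, deg A i * g i ^ 2 + 2 * ∑ i, deg A i * h i ^ 2 := by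
    simp only [Finset.mul_sum, ← Finset.sum_add_distrib]
    refine Finset.sum_congr rfl fun i _ => ?_
    simp only [Pi.add_apply, Pi.sub_apply]
    ring
  set N := ∑ i, deg A i * gcnLayer A g i ^ 2 with hN
  have hB : biForm A h g = ρ⁻¹ * N := by
    rw [biForm_eq_sum_deg_mul hd, hN, Finset.mul_sum]
    exact Finset.sum_congr rfl fun i _ => by rw [hh]; ring
  have hhN : ∑ i, deg A i * h i ^ 2 = ρ⁻¹ ^ 2 * N := by
    rw [hN, Finset.mul_sum]
    exact Finset.sum_congr rfl fun i _ => by rw [hh]; ring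
  rw [hhN] at hsum
  rw [hB] at hpol
  have h1 := (abs_le.mp hp).2
  have h2 := (abs_le.mp hm).1
  have h3 : 4 * (ρ⁻¹ * N) ≤ ρ * (2 * ∑ i, deg A i * g i ^ 2 + 2 * (ρ⁻¹ ^ 2 * N)) := by
    rw [← hpol, ← hsum]; linarith
  have h4 : ρ * (4 * (ρ⁻¹ * N)) ≤ ρ * (ρ * (2 * ∑ i, deg A i * g i ^ 2 + 2 * (ρ⁻¹ ^ 2 * N))) :=
    mul_le_mul_of_nonneg_left h3 hρ.le
  have e1 : ρ * (4 * (ρ⁻¹ * N)) = 4 * N := by field_simp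
  have e2 : ρ * (ρ * (2 * ∑ i, deg A i * g i ^ 2 + 2 * (ρ⁻¹ ^ 2 * N)))
      = 2 * (ρ ^ 2 * ∑ i, deg A i * g i ^ 2) + 2 * N := by field_simp
  linarith

/-- Geometric decay of the similarity under graph convolution. -/
theorem gam_iterate_gcnLayer_le (hn : 0 < n) (hA : ∀ i j, A i j = A j i) {ρ a b : ℝ}
    (ha : 0 < a) (hda : ∀ i, a ≤ deg A i) (hdb : ∀ i, deg A i ≤ b) (hρ : 0 < ρ)
    (hform : ∀ g : Fin n → ℝ, ∑ i, deg A i * g i = 0 →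
      |biForm A g g| ≤ ρ * ∑ i, deg A i * g i ^ 2)
    {C : ℝ} (hC : 0 ≤ C) (hCab : b ≤ C ^ 2 * a) (X : Fin n → ℝ) (l : ℕ) :
    gam ((gcnLayer A)^[l] X) ≤ C * ρ ^ l * gam X := by
  have hn' : (0 : ℝ) < n := by exact_mod_cast hn
  have hd : ∀ i, 0 < deg A i := fun i => ha.trans_le (hda i)
  have hD : 0 < ∑ i, deg A i := by
    have : Nonempty (Fin n) := ⟨⟨0, hn⟩⟩
    exact Finset.sum_pos (fun i _ => hd i) Finset.univ_nonempty
  -- The degree-weighted mean is the limit that the layers preserve. Passing between it and the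
  -- ordinary mean costs the ratio `b / a` of the degree bounds, once, independently of the layer.
  set c := (∑ i, deg A i * X i) / ∑ i, deg A i with hc
  have hcs : ∑ i, deg A i * (X i - c) = 0 := by
    simp only [mul_sub, Finset.sum_sub_distrib, ← Finset.sum_mul, hc]
    field_simp; ring
  have hpres : ∀ l, ∑ i, deg A i * ((gcnLayer A)^[l] X i - c) = 0 := fun l => by
    have h1 : ∑ i, deg A i * (gcnLayer A)^[l] X i = ∑ i, deg A i * X i := by
      induction l with
      | zero => rfl
      | succ l ih => rw [Function.iterate_succ_apply', sum_deg_mul_gcnLayer hA hd, ih]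
    rw [← hcs]
    simp only [mul_sub, Finset.sum_sub_distrib, h1]
  have hE : ∑ i, deg A i * ((gcnLayer A)^[l] X i - c) ^ 2 ≤
      ρ ^ (2 * l) * ∑ i, deg A i * (X i - c) ^ 2 := by
    induction l with
    | zero => simp
    | succ l ih =>
      have := sum_deg_mul_gcnLayer_sq_le hA hd hρ hform (hpres l)
      simp only [gcnLayer_sub_const hd] at this
      rw [Function.iterate_succ_apply']
      calc _ ≤ _ := this
        _ ≤ ρ ^ 2 * _ := mul_le_mul_of_nonneg_left ih (by positivity)
        _ = _ := by ring
  have hE0 : ∑ i, deg A i * (X i - c) ^ 2 ≤ b * (n * gam X ^ 2) := by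
    rw [mul_gam_sq hn]
    set m := (∑ j, X j) / n
    have e : ∑ i, deg A i * (X i - m) ^ 2 = ∑ i, deg A i * (X i - c) ^ 2 +
        (∑ i, deg A i) * (c - m) ^ 2 := by
      have e2 : ∀ i, deg A i * (X i - m) ^ 2 = deg A i * (X i - c) ^ 2 + deg A i * (c - m) ^ 2 +
        2 * (c - m) * (deg A i * (X i - c)) := fun i => by ring
      simp only [e2, Finset.sum_add_distrib, ← Finset.mul_sum, hcs, mul_zero, add_zero,
        ← Finset.sum_mul]
    calc _ ≤ ∑ i, deg A i * (X i - m) ^ 2 := by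
          rw [e]; exact le_add_of_nonneg_right (by positivity)
      _ ≤ _ := by
          rw [Finset.mul_sum]
          exact Finset.sum_le_sum fun i _ => mul_le_mul_of_nonneg_right (hdb i) (sq_nonneg _)
  have hEl : a * (n * gam ((gcnLayer A)^[l] X) ^ 2) ≤
      ∑ i, deg A i * ((gcnLayer A)^[l] X i - c) ^ 2 := by
    refine (mul_le_mul_of_nonneg_left (mul_gam_sq_le hn _ c) ha.le).trans ?_
    rw [Finset.mul_sum]
    exact Finset.sum_le_sum fun i _ => mul_le_mul_of_nonneg_right (hda i) (sq_nonneg _)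
  have hg := gam_nonneg X
  refine le_of_sq_le_sq ?_ (by positivity)
  refine le_of_mul_le_mul_left ?_ (mul_pos ha hn')
  calc a * n * gam ((gcnLayer A)^[l] X) ^ 2 = a * (n * gam ((gcnLayer A)^[l] X) ^ 2) := by ring
    _ ≤ ρ ^ (2 * l) * (b * (n * gam X ^ 2)) :=
        hEl.trans (hE.trans (mul_le_mul_of_nonneg_left hE0 (by positivity)))
    _ ≤ ρ ^ (2 * l) * (C ^ 2 * a * (n * gam X ^ 2)) := by gcongr
    _ = _ := by ring

end Contraction

/-! ### The quadratic form of a typical graph -/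

section TypicalGraph

variable {n : ℕ} {A : Matrix (Fin n) (Fin n) ℝ} {ε : Fin n → Bool}

/-- The part of a matrix inside the classes. -/
def samePart (ε : Fin n → Bool) (A : Matrix (Fin n) (Fin n) ℝ) : Matrix (Fin n) (Fin n) ℝ :=
  fun i j => if ε i = ε j then A i j else 0

/-- The part of a matrix between the classes. -/
def diffPart (ε : Fin n → Bool) (A : Matrix (Fin n) (Fin n) ℝ) : Matrix (Fin n) (Fin n) ℝ :=
  fun i j => if ε i = ε j then 0 else A i j

/-- The sum of `x` over a class. -/
def classSum (ε : Fin n → Bool) (b : Bool) (x : Fin n → ℝ) : ℝ := ∑ i, if ε i = b then x i else 0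

theorem biForm_samePart_add_diffPart (x y : Fin n → ℝ) :
    biForm (samePart ε A) x y + biForm (diffPart ε A) x y = biForm A x y := by
  simp only [biForm, ← Finset.sum_add_distrib]
  refine Finset.sum_congr rfl fun i _ => Finset.sum_congr rfl fun j _ => ?_
  unfold samePart diffPart
  split_ifs <;> ring

theorem classSum_true_add_false (x : Fin n → ℝ) :
    classSum ε true x + classSum ε false x = ∑ i, x i := by
  rw [classSum, classSum, ← Finset.sum_add_distrib]
  exact Finset.sum_congr rfl fun i _ => by cases ε i <;> simp

/-- The form `∑ d_i x_i² - ∑ x_i A_ij x_j` is half the sum of `A_ij (x_i - x_j)²`. -/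
theorem two_mul_laplacian (hA : ∀ i j, A i j = A j i) (x : Fin n → ℝ) :
    2 * (∑ i, deg A i * x i ^ 2 - biForm A x x) = ∑ i, ∑ j, A i j * (x i - x j) ^ 2 := by
  have e1 : ∑ i, deg A i * x i ^ 2 = ∑ i, ∑ j, A i j * x i ^ 2 :=
    Finset.sum_congr rfl fun i _ => by rw [deg, Finset.sum_mul]
  have e2 : ∑ i, deg A i * x i ^ 2 = ∑ i, ∑ j, A i j * x j ^ 2 := by
    rw [e1, Finset.sum_comm]
    exact Finset.sum_congr rfl fun i _ => Finset.sum_congr rfl fun j _ => by rw [hA j i]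
  have e3 : 2 * (∑ i, deg A i * x i ^ 2 - biForm A x x)
      = ∑ i, ∑ j, A i j * x i ^ 2 + ∑ i, ∑ j, A i j * x j ^ 2 - 2 * biForm A x x := by
    rw [← e1, ← e2]; ring
  rw [e3, biForm]
  simp only [Finset.mul_sum, ← Finset.sum_add_distrib, ← Finset.sum_sub_distrib]
  exact Finset.sum_congr rfl fun i _ => Finset.sum_congr rfl fun j _ => by ring

theorem samePart_symm (hA : ∀ i j, A i j = A j i) (i j : Fin n) :
    samePart ε A i j = samePart ε A j i := by
  simp only [samePart, hA i j, eq_comm]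

theorem deg_samePart (i : Fin n) : deg (samePart ε A) i = degSame ε A i := rfl

/-- Bounds on a graph which hold with high probability. -/
structure IsTypicalGraph (δ p q : ℝ) (ε : Fin n → Bool) (A : Matrix (Fin n) (Fin n) ℝ) : Prop where
  degSame_sub_le : ∀ i, |degSame ε A i - n / 2 * p| ≤ δ * (n / 2 * p)
  degDiff_sub_le : ∀ i, |degDiff ε A i - n / 2 * q| ≤ δ * (n / 2 * q)
  same_form_le : ∀ x : Fin n → ℝ, |biForm (samePart ε A) x x -
    p * (classSum ε true x ^ 2 + classSum ε false x ^ 2 - ∑ i, x i ^ 2)| ≤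
      δ * (n * p) * ∑ i, x i ^ 2
  diff_form_le : ∀ x : Fin n → ℝ, |biForm (diffPart ε A) x x -
    2 * q * (classSum ε true x * classSum ε false x)| ≤ δ * (n * q) * ∑ i, x i ^ 2

/-- By homophily the class-sum part of the mean form is nonnegative: it equals q(a+b)² +
(p-q)(a²+b²) in the class sums a, b. Only the two errors and the removed diagonal, each at most δnp,
are left. -/
theorem IsTypicalGraph.neg_le_biForm {δ p q : ℝ} (h : IsTypicalGraph δ p q ε A) (hq : 0 ≤ q)
    (hqp : q ≤ p) (hδ : 0 ≤ δ) (hδn : 1 ≤ δ * n) (x : Fin n → ℝ) :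
    -(3 * δ * (n * p)) * ∑ i, x i ^ 2 ≤ biForm A x x := by
  have h1 := (abs_le.mp (h.same_form_le x)).1
  have h2 := (abs_le.mp (h.diff_form_le x)).1
  rw [← biForm_samePart_add_diffPart (ε := ε)]
  have hs : 0 ≤ ∑ i, x i ^ 2 := Finset.sum_nonneg fun i _ => sq_nonneg _
  set s := ∑ i, x i ^ 2
  set a := classSum ε true x
  set b := classSum ε false x
  have hp : 0 ≤ p := hq.trans hqp
  have e1 : 0 ≤ p * (a ^ 2 + b ^ 2) + 2 * q * (a * b) := by
    have : p * (a ^ 2 + b ^ 2) + 2 * q * (a * b) = q * (a + b) ^ 2 + (p - q) * (a ^ 2 + b ^ 2) := by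
      ring
    rw [this]
    have := sub_nonneg.mpr hqp
    positivity
  have e2 : δ * (n * q) * s ≤ δ * (n * p) * s := by gcongr
  have e3 : p * s ≤ δ * (n * p) * s := by
    have := mul_le_mul_of_nonneg_right hδn (mul_nonneg hp hs)
    linarith
  linarith

/-- Write g - c = α·sgn + z with z of sum 0 in each class. The within-class Laplacian sees only z,
and there its size np/2 absorbs its error δnp. The direction α·sgn is charged only by the
between-class part, whose errors are of order δnq. So the bound is sharp up to a relative error in
nq, even if q is much smaller than p. -/
theorem IsTypicalGraph.le_laplacian {δ p q : ℝ} (h : IsTypicalGraph δ p q ε A) (hn : 0 < n)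
    (hA : ∀ i j, A i j = A j i) (hq : 0 ≤ q) (hqp : q ≤ p) (hδ : 0 ≤ δ) (hδ1 : δ ≤ 1 / 4)
    (hε : |∑ i, sgn ε i| ≤ δ * n) (g : Fin n → ℝ) :
    ∃ c : ℝ, (1 - 3 * δ) * (n * q) * ∑ i, (g i - c) ^ 2 ≤
      ∑ i, deg A i * (g i - c) ^ 2 - biForm A (fun i => g i - c) (fun i => g i - c) := by
  have hn' : (0 : ℝ) < n := by exact_mod_cast hn
  have hp : 0 ≤ p := hq.trans hqp
  set nt := classSum ε true 1 with hnt
  set nf := classSum ε false 1 with hnf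
  have hsum : nt + nf = n := by rw [hnt, hnf, classSum_true_add_false]; simp
  have hdiff : nt - nf = ∑ i, sgn ε i := by
    rw [hnt, hnf, classSum, classSum, ← Finset.sum_sub_distrib]
    exact Finset.sum_congr rfl fun i _ => by unfold sgn; cases ε i <;> simp
  rw [← hdiff] at hε
  obtain ⟨b1, b2⟩ := abs_le.mp hε
  have hnt0 : 0 < nt := by nlinarith
  have hnf0 : 0 < nf := by nlinarith
  set mt := classSum ε true g / nt with hmt
  set mf := classSum ε false g / nf with hmf
  -- The shift c is the midpoint of the two class means; then both class means of g - c are ±α.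
  set α := (mt - mf) / 2 with hα
  set c := (mt + mf) / 2 with hc
  set y : Fin n → ℝ := fun i => g i - c with hy
  set z : Fin n → ℝ := fun i => y i - α * sgn ε i with hz
  have hzt : ∀ i, z i = g i - if ε i then mt else mf := fun i => by
    simp only [hz, hy, hα, hc, sgn]; split_ifs <;> ring
  have hz1 : classSum ε true z = 0 := by
    have : classSum ε true z = classSum ε true g - mt * nt := by
      rw [hnt, classSum, classSum, classSum, Finset.mul_sum, ← Finset.sum_sub_distrib]
      exact Finset.sum_congr rfl fun i _ => by rw [hzt]; cases ε i <;> simp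
    rw [this, hmt]; field_simp; ring
  have hz2 : classSum ε false z = 0 := by
    have : classSum ε false z = classSum ε false g - mf * nf := by
      rw [hnf, classSum, classSum, classSum, Finset.mul_sum, ← Finset.sum_sub_distrib]
      exact Finset.sum_congr rfl fun i _ => by rw [hzt]; cases ε i <;> simp
    rw [this, hmf]; field_simp; ring
  have hyt : classSum ε true y = α * nt := by
    have : classSum ε true y = classSum ε true z + α * nt := by
      rw [hnt, classSum, classSum, classSum, Finset.mul_sum, ← Finset.sum_add_distrib]
      exact Finset.sum_congr rfl fun i _ => by simp only [hz, sgn]; cases ε i <;> simp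
    rw [this, hz1, zero_add]
  have hyf : classSum ε false y = -(α * nf) := by
    have : classSum ε false y = classSum ε false z - α * nf := by
      rw [hnf, classSum, classSum, classSum, Finset.mul_sum, ← Finset.sum_sub_distrib]
      exact Finset.sum_congr rfl fun i _ => by simp only [hz, sgn]; cases ε i <;> simp
    rw [this, hz2, zero_sub]
  have hsz : ∑ i, sgn ε i * z i = 0 := by
    have : ∑ i, sgn ε i * z i = classSum ε true z - classSum ε false z := by
      rw [classSum, classSum, ← Finset.sum_sub_distrib]
      exact Finset.sum_congr rfl fun i _ => by unfold sgn; cases ε i <;> simp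
    rw [this, hz1, hz2, sub_zero]
  have hnorm : ∑ i, y i ^ 2 = n * α ^ 2 + ∑ i, z i ^ 2 := by
    have e : ∀ i, y i ^ 2 = α ^ 2 + 2 * α * (sgn ε i * z i) + z i ^ 2 := fun i => by
      simp only [hz]; linear_combination α ^ 2 * sgn_mul_self ε i
    simp only [e, Finset.sum_add_distrib, ← Finset.mul_sum, hsz]
    simp
  -- The vectors y and z differ by a constant on each class, which differences along within-class
  -- edges do not see.
  have hlap : ∑ i, degSame ε A i * y i ^ 2 - biForm (samePart ε A) y y
      = ∑ i, degSame ε A i * z i ^ 2 - biForm (samePart ε A) z z := by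
    refine mul_left_cancel₀ (two_ne_zero (α := ℝ)) ?_
    simp only [← deg_samePart]
    rw [two_mul_laplacian (samePart_symm hA), two_mul_laplacian (samePart_symm hA)]
    refine Finset.sum_congr rfl fun i _ => Finset.sum_congr rfl fun j _ => ?_
    unfold samePart
    split_ifs with hij
    · have : z i - z j = y i - y j := by simp only [hz, sgn, hij]; ring
      rw [this]
    · simp
  have hdeg : ∑ i, deg A i * y i ^ 2
      = ∑ i, degSame ε A i * y i ^ 2 + ∑ i, degDiff ε A i * y i ^ 2 := by
    rw [← Finset.sum_add_distrib]
    exact Finset.sum_congr rfl fun i _ => by rw [deg, ← degSame_add_degDiff ε A, add_mul]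
  have hS : (1 - δ) * (n / 2 * p) * ∑ i, z i ^ 2 ≤ ∑ i, degSame ε A i * z i ^ 2 := by
    rw [Finset.mul_sum]
    refine Finset.sum_le_sum fun i _ => mul_le_mul_of_nonneg_right ?_ (sq_nonneg _)
    have := (abs_le.mp (h.degSame_sub_le i)).1
    linarith
  have hT : (1 - δ) * (n / 2 * q) * ∑ i, y i ^ 2 ≤ ∑ i, degDiff ε A i * y i ^ 2 := by
    rw [Finset.mul_sum]
    refine Finset.sum_le_sum fun i _ => mul_le_mul_of_nonneg_right ?_ (sq_nonneg _)
    have := (abs_le.mp (h.degDiff_sub_le i)).1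
    linarith
  have hfs := (abs_le.mp (h.same_form_le z)).2
  have hfd := (abs_le.mp (h.diff_form_le y)).2
  rw [hz1, hz2] at hfs
  rw [hyt, hyf] at hfd
  refine ⟨c, ?_⟩
  change (1 - 3 * δ) * (n * q) * ∑ i, y i ^ 2 ≤ ∑ i, deg A i * y i ^ 2 - biForm A y y
  rw [hdeg, ← biForm_samePart_add_diffPart (ε := ε)]
  have hzn : 0 ≤ ∑ i, z i ^ 2 := Finset.sum_nonneg fun i _ => sq_nonneg _
  have hprod : (1 - δ) * n ^ 2 / 4 ≤ nt * nf := by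
    have h4 : 4 * (nt * nf) = n ^ 2 - (nt - nf) ^ 2 := by rw [← hsum]; ring
    have h5 : (nt - nf) ^ 2 ≤ (δ * n) ^ 2 := sq_le_sq' b1 b2
    nlinarith [sq_nonneg (n : ℝ)]
  have k1 : (1 - δ) * (n ^ 2) / 2 * q * α ^ 2 ≤ 2 * q * (α * nt * (α * nf)) := by
    have := mul_le_mul_of_nonneg_right hprod (mul_nonneg hq (sq_nonneg α))
    linarith
  -- The surplus from q ≤ p is given away here; δ ≤ 1/4 makes the coefficient nonnegative.
  have k2 : ((1 - δ) / 2 - δ) * (n * q) * ∑ i, z i ^ 2 ≤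
      ((1 - δ) / 2 - δ) * (n * p) * ∑ i, z i ^ 2 := by
    have : 0 ≤ (1 - δ) / 2 - δ := by linarith
    gcongr
  have k3 : 0 ≤ p * ∑ i, z i ^ 2 := mul_nonneg hp hzn
  have k4 : 0 ≤ δ * (n * q) * (n * α ^ 2) := by positivity
  rw [hnorm] at hT hfd ⊢
  linarith

/-- The two sides need different precision. From below the factor is at least η, so an error of
order δnp is harmless. From above the gap itself is at stake, and the Laplacian bound is used; both
it and the orthogonality condition survive the shift by c, which only increases the degree-weighted
norm. -/
theorem IsTypicalGraph.abs_biForm_le {δ p q η : ℝ} (h : IsTypicalGraph δ p q ε A) (hn : 0 < n)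
    (hA : ∀ i j, A i j = A j i) (hp : 0 < p) (hq : 0 ≤ q) (hqp : q ≤ p) (hδ : 0 ≤ δ)
    (hη : 0 < η) (hη1 : η < 1) (hδη : δ ≤ η / 8) (hδn : 1 ≤ δ * n)
    (hε : |∑ i, sgn ε i| ≤ δ * n) {g : Fin n → ℝ} (hg : ∑ i, deg A i * g i = 0) :
    |biForm A g g| ≤
      (1 - (1 - η) * (1 - (p - q) / (p + q))) * ∑ i, deg A i * g i ^ 2 := by
  have hn' : (0 : ℝ) < n := by exact_mod_cast hn
  have hpq : 0 < p + q := by linarith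
  have hgap : 1 - (p - q) / (p + q) = 2 * q / (p + q) := by field_simp; ring
  have hgap1 : 2 * q / (p + q) ≤ 1 := by rw [div_le_one hpq]; linarith
  have hgap0 : 0 ≤ 2 * q / (p + q) := by positivity
  rw [hgap]
  set κ := 2 * q / (p + q) with hκ
  have hκq : κ * (p + q) = 2 * q := by rw [hκ]; field_simp
  have hdl : ∀ i, (1 - δ) * (n / 2 * (p + q)) ≤ deg A i := fun i => by
    rw [deg, ← degSame_add_degDiff ε A]
    have h1 := (abs_le.mp (h.degSame_sub_le i)).1
    have h2 := (abs_le.mp (h.degDiff_sub_le i)).1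
    linarith
  have hdu : ∀ i, deg A i ≤ (1 + δ) * (n / 2 * (p + q)) := fun i => by
    rw [deg, ← degSame_add_degDiff ε A]
    have h1 := (abs_le.mp (h.degSame_sub_le i)).2
    have h2 := (abs_le.mp (h.degDiff_sub_le i)).2
    linarith
  refine abs_le.mpr ⟨?_, ?_⟩
  · refine le_trans ?_ (h.neg_le_biForm hq hqp hδ hδn g)
    have hs : 0 ≤ ∑ i, g i ^ 2 := Finset.sum_nonneg fun i _ => sq_nonneg _
    have h1 : (1 - δ) * (n / 2 * (p + q)) * ∑ i, g i ^ 2 ≤ ∑ i, deg A i * g i ^ 2 := by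
      rw [Finset.mul_sum]
      exact Finset.sum_le_sum fun i _ => mul_le_mul_of_nonneg_right (hdl i) (sq_nonneg _)
    have h2 : η ≤ 1 - (1 - η) * κ := by nlinarith
    have h3 : η * ((1 - δ) * (n / 2 * (p + q)) * ∑ i, g i ^ 2) ≤
        (1 - (1 - η) * κ) * ∑ i, deg A i * g i ^ 2 := by
      refine mul_le_mul h2 h1 ?_ (hη.le.trans h2)
      have : 0 ≤ 1 - δ := by linarith
      positivity
    have h4 : 3 * δ * (n * p) ≤ η * ((1 - δ) * (n / 2 * (p + q))) := by
      have c1 : 6 * δ ≤ η * (1 - δ) := by nlinarith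
      have c2 : 0 ≤ η * (1 - δ) * (n / 2 * q) := by
        have : 0 ≤ 1 - δ := by linarith
        positivity
      have c3 := mul_le_mul_of_nonneg_right c1 (show 0 ≤ n / 2 * p by positivity)
      linarith
    have h5 := mul_le_mul_of_nonneg_right h4 hs
    linarith
  · obtain ⟨c, hc⟩ := h.le_laplacian hn hA hq hqp hδ (by linarith) hε g
    have e : ∑ i, deg A i * (g i - c) ^ 2 - biForm A (fun i => g i - c) (fun i => g i - c)
        = ∑ i, deg A i * g i ^ 2 - biForm A g g := by
      refine mul_left_cancel₀ (two_ne_zero (α := ℝ)) ?_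
      rw [two_mul_laplacian hA, two_mul_laplacian hA]
      exact Finset.sum_congr rfl fun i _ => Finset.sum_congr rfl fun j _ => by ring
    rw [e] at hc
    have hD : ∑ i, deg A i * g i ^ 2 ≤ (1 + δ) * (n / 2 * (p + q)) * ∑ i, (g i - c) ^ 2 := by
      have e2 : ∑ i, deg A i * (g i - c) ^ 2
          = ∑ i, deg A i * g i ^ 2 + (∑ i, deg A i) * c ^ 2 := by
        have e3 : ∀ i, deg A i * (g i - c) ^ 2
            = deg A i * g i ^ 2 - 2 * c * (deg A i * g i) + deg A i * c ^ 2 := fun i => by ring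
        simp only [e3, Finset.sum_add_distrib, Finset.sum_sub_distrib, ← Finset.mul_sum, hg,
          ← Finset.sum_mul]
        ring
      have e4 : 0 ≤ (∑ i, deg A i) * c ^ 2 := by
        refine mul_nonneg (Finset.sum_nonneg fun i _ => le_trans ?_ (hdl i)) (sq_nonneg _)
        have : 0 ≤ 1 - δ := by linarith
        positivity
      calc _ ≤ ∑ i, deg A i * (g i - c) ^ 2 := by linarith
        _ ≤ _ := by
          rw [Finset.mul_sum]
          exact Finset.sum_le_sum fun i _ => mul_le_mul_of_nonneg_right (hdu i) (sq_nonneg _)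
    set s := ∑ i, (g i - c) ^ 2 with hs
    have hs0 : 0 ≤ s := Finset.sum_nonneg fun i _ => sq_nonneg _
    have h1 : (1 - η) * κ * ∑ i, deg A i * g i ^ 2 ≤
        (1 - η) * κ * ((1 + δ) * (n / 2 * (p + q)) * s) :=
      mul_le_mul_of_nonneg_left hD (mul_nonneg (by linarith) hgap0)
    have h2 : (1 - η) * κ * ((1 + δ) * (n / 2 * (p + q)) * s) = (1 - η) * (1 + δ) * (n * q * s) := by
      linear_combination (1 - η) * (1 + δ) * n / 2 * s * hκq
    -- The loss of η in the gap pays for both δ's, as 4δ ≤ η.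
    have h3 : (1 - η) * (1 + δ) * (n * q * s) ≤ (1 - 3 * δ) * (n * q * s) := by
      refine mul_le_mul_of_nonneg_right ?_ (by positivity)
      nlinarith
    linarith

/-- Graph convolution on a typical graph contracts almost by the factor `(p - q) / (p + q)`. -/
theorem IsTypicalGraph.gam_iterate_gcnLayer_le {δ p q η : ℝ} (h : IsTypicalGraph δ p q ε A)
    (hn : 0 < n) (hA : ∀ i j, A i j = A j i) (hp : 0 < p) (hq : 0 ≤ q) (hqp : q ≤ p) (hδ : 0 ≤ δ)
    (hη : 0 < η) (hη1 : η < 1) (hδη : δ ≤ η / 8) (hδn : 1 ≤ δ * n)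
    (hε : |∑ i, sgn ε i| ≤ δ * n) (X : Fin n → ℝ) (l : ℕ) :
    gam ((gcnLayer A)^[l] X) ≤
      2 * (1 - (1 - η) * (1 - (p - q) / (p + q))) ^ l * gam X := by
  have hn' : (0 : ℝ) < n := by exact_mod_cast hn
  have hpq : 0 < p + q := by linarith
  have hgap : 1 - (p - q) / (p + q) = 2 * q / (p + q) := by field_simp; ring
  have hgap1 : 2 * q / (p + q) ≤ 1 := by rw [div_le_one hpq]; linarith
  have hδ1 : δ ≤ 1 / 8 := by linarith
  have hN : 0 < n / 2 * (p + q) := by positivity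
  -- The constant 2 works because (1 + δ) ≤ 4(1 - δ) for δ ≤ 1/8.
  refine GraphAttention.gam_iterate_gcnLayer_le hn hA (a := (1 - δ) * (n / 2 * (p + q)))
    (b := (1 + δ) * (n / 2 * (p + q))) (mul_pos (by linarith) hN) (fun i => ?_) (fun i => ?_) ?_
    (fun g hg => h.abs_biForm_le hn hA hp hq hqp hδ hη hη1 hδη hδn hε hg) zero_le_two
    (by nlinarith) X l
  · rw [deg, ← degSame_add_degDiff ε A]
    have h1 := (abs_le.mp (h.degSame_sub_le i)).1
    have h2 := (abs_le.mp (h.degDiff_sub_le i)).1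
    linarith
  · rw [deg, ← degSame_add_degDiff ε A]
    have h1 := (abs_le.mp (h.degSame_sub_le i)).2
    have h2 := (abs_le.mp (h.degDiff_sub_le i)).2
    linarith
  · rw [hgap]; nlinarith

end TypicalGraph

/-! ### The adjacency matrix as a sum over the edges -/

section EdgeMatrices

open Matrix

variable {n : ℕ}

/-- The symmetric matrix with zero diagonal and the given values at the pairs of nodes. -/
def symMat (x : NodePair n → ℝ) : Matrix (Fin n) (Fin n) ℝ := fun i j =>
  if h : i < j then x ⟨(i, j), h⟩ else if h : j < i then x ⟨(j, i), h⟩ else 0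

/-- The adjacency matrix of a single edge. -/
def edgeMat (e : NodePair n) : Matrix (Fin n) (Fin n) ℝ :=
  single e.1.1 e.1.2 1 + single e.1.2 e.1.1 1

/-- The indicator of the nodes of an edge. -/
def incid (e : NodePair n) (i : Fin n) : ℝ := if i = e.1.1 ∨ i = e.1.2 then 1 else 0

theorem edgeMat_isSymm (e : NodePair n) : (edgeMat e).IsSymm := by
  simp [Matrix.IsSymm, edgeMat, transpose_add, transpose_single, add_comm]

theorem edgeMat_mul_self (e : NodePair n) : edgeMat e * edgeMat e = diagonal (incid e) := by
  have h : e.1.1 ≠ e.1.2 := e.2.ne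
  have : edgeMat e * edgeMat e = single e.1.1 e.1.1 1 + single e.1.2 e.1.2 1 := by
    simp [edgeMat, add_mul, mul_add, single_mul_single_of_ne, h, h.symm, add_comm]
  rw [this]
  ext i j
  simp only [Matrix.add_apply, single_apply, diagonal_apply, incid]
  by_cases hij : i = j
  · subst hij
    by_cases h1 : i = e.1.1
    · subst h1; simp [h.symm]
    · by_cases h2 : i = e.1.2
      · subst h2; simp [h]
      · simp [h1, h2, Ne.symm h1, Ne.symm h2]
  · rw [if_neg hij, if_neg (by rintro ⟨a, b⟩; exact hij (a.symm.trans b)),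
      if_neg (by rintro ⟨a, b⟩; exact hij (a.symm.trans b)), add_zero]

theorem sum_smul_edgeMat (x : NodePair n → ℝ) : ∑ e, x e • edgeMat e = symMat x := by
  ext i j
  rw [Matrix.sum_apply]
  have hap : ∀ e : NodePair n, (x e • edgeMat e) i j =
      if e.1 = (i, j) ∨ e.1 = (j, i) then x e else 0 := fun e => by
    have h : e.1.1 ≠ e.1.2 := e.2.ne
    simp only [edgeMat, Matrix.smul_apply, Matrix.add_apply, single_apply, smul_eq_mul,
      Prod.ext_iff]
    by_cases h1 : e.1.1 = i ∧ e.1.2 = j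
    · have h2 : ¬ (e.1.2 = i ∧ e.1.1 = j) := fun h2 => h (h1.1.trans h2.1.symm)
      rw [if_pos h1, if_neg h2, if_pos (Or.inl h1), add_zero, mul_one]
    · by_cases h2 : e.1.2 = i ∧ e.1.1 = j
      · rw [if_neg h1, if_pos h2, if_pos (Or.inr h2.symm), zero_add, mul_one]
      · rw [if_neg h1, if_neg h2, if_neg (by rintro (h3 | h3) <;> [exact h1 h3; exact h2 h3.symm]),
          add_zero, mul_zero]
  simp only [hap]
  unfold symMat
  split_ifs with h1 h2
  · rw [Finset.sum_eq_single ⟨(i, j), h1⟩]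
    · simp
    · intro e _ he
      rw [if_neg]
      rintro (h | h)
      · exact he (Subtype.ext h)
      · have := e.2; rw [h] at this; exact absurd this (not_lt.mpr h1.le)
    · simp
  · rw [Finset.sum_eq_single ⟨(j, i), h2⟩]
    · simp
    · intro e _ he
      rw [if_neg]
      rintro (h | h)
      · have := e.2; rw [h] at this; exact absurd this h1
      · exact he (Subtype.ext h)
    · simp
  · refine Finset.sum_eq_zero fun e _ => if_neg ?_
    have := e.2
    rintro (h | h) <;> rw [h] at this
    · exact h1 this
    · exact h2 this

theorem sum_edgeMat_apply (e : NodePair n) (i : Fin n) : ∑ j, edgeMat e i j = incid e i := by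
  have h : e.1.1 ≠ e.1.2 := e.2.ne
  simp only [edgeMat, Matrix.add_apply, single_apply, Finset.sum_add_distrib, incid]
  by_cases h1 : i = e.1.1
  · subst h1; simp [h.symm]
  · by_cases h2 : i = e.1.2
    · subst h2; simp [h]
    · simp [h1, h2, Ne.symm h1, Ne.symm h2]

theorem sum_mul_incid (x : NodePair n → ℝ) (i : Fin n) :
    ∑ e, x e * incid e i = ∑ j, symMat x i j := by
  rw [← sum_smul_edgeMat]
  simp only [Matrix.sum_apply, Matrix.smul_apply, smul_eq_mul]
  rw [Finset.sum_comm]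
  exact Finset.sum_congr rfl fun e _ => by rw [← Finset.mul_sum, sum_edgeMat_apply]

theorem symMat_mul {K : Fin n → Fin n → ℝ} (hK : ∀ i j, K i j = K j i) (x : NodePair n → ℝ)
    (i j : Fin n) : symMat (fun e => x e * K e.1.1 e.1.2) i j = symMat x i j * K i j := by
  unfold symMat
  split_ifs
  · rfl
  · rw [hK i j]
  · simp

theorem symMat_sub (x y : NodePair n → ℝ) (i j : Fin n) :
    symMat (fun e => x e - y e) i j = symMat x i j - symMat y i j := by
  unfold symMat; split_ifs <;> simp

theorem symMat_const (c : ℝ) (i j : Fin n) :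
    symMat (fun _ => c) i j = if i = j then 0 else c := by
  unfold symMat
  rcases lt_trichotomy i j with h | h | h
  · simp [h, h.ne]
  · simp [h]
  · simp [h, h.ne', not_lt.mpr h.le]

theorem symMat_symm (x : NodePair n → ℝ) (i j : Fin n) : symMat x i j = symMat x j i := by
  unfold symMat
  rcases lt_trichotomy i j with h | h | h
  · simp [h, not_lt.mpr h.le]
  · simp [h]
  · simp [h, not_lt.mpr h.le]

theorem abs_symMat_le {x : NodePair n → ℝ} (hx : ∀ e, |x e| ≤ 1) (i j : Fin n) :
    |symMat x i j| ≤ 1 := by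
  unfold symMat; split_ifs <;> simp [hx]

/-- The adjacency matrix of the graph with given edge indicators. -/
def graphMat (a : NodePair n → Bool) : Matrix (Fin n) (Fin n) ℝ := symMat fun e => ind (a e)

theorem adj_eq_graphMat (ω : Outcome n) : adj ω = graphMat ω.2.1 := rfl

theorem ind_nonneg (b : Bool) : 0 ≤ ind b := by cases b <;> simp [ind]

theorem graphMat_nonneg (a : NodePair n → Bool) (i j : Fin n) : 0 ≤ graphMat a i j := by
  unfold graphMat symMat; split_ifs <;> simp [ind_nonneg]

end EdgeMatrices

/-! ### Concentration of the degrees and of the quadratic form for one kind of edges -/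

section OneKind

open Matrix

variable {n : ℕ} {K : Fin n → Fin n → ℝ} {P : NodePair n → ℝ} {r : ℝ}

/-- The mask `K` selects the edges inside or between the classes, on which all probabilities equal
`r`; this treats both kinds at once. -/
theorem bernProb_degree_le (hK : ∀ i j, K i j = K j i) (hK01 : ∀ i j, K i j = 0 ∨ K i j = 1)
    (h0 : ∀ e, 0 ≤ P e) (h1 : ∀ e, P e ≤ 1)
    (hP : ∀ e, P e * K e.1.1 e.1.2 = r * K e.1.1 e.1.2) {δ : ℝ} (hδ : 0 < δ) (hδ1 : δ ≤ 1)
    (i : Fin n) :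
    bernProb P {a | δ * (r * ∑ j, if i = j then 0 else K i j) <
      |∑ j, graphMat a i j * K i j - r * ∑ j, if i = j then 0 else K i j|} ≤
      2 * Real.exp (-(δ ^ 2 / 4 * (r * ∑ j, if i = j then 0 else K i j))) := by
  have e1 : ∑ e, P e * (K e.1.1 e.1.2 * incid e i) = r * ∑ j, if i = j then 0 else K i j := by
    simp only [← mul_assoc, hP]
    rw [sum_mul_incid, Finset.mul_sum]
    refine Finset.sum_congr rfl fun j _ => ?_
    rw [symMat_mul hK, symMat_const]
    split_ifs <;> simp
  have e2 : ∀ a : NodePair n → Bool, ∑ e, ind (a e) * (K e.1.1 e.1.2 * incid e i)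
      = ∑ j, graphMat a i j * K i j := fun a => by
    simp only [← mul_assoc]
    rw [sum_mul_incid]
    exact Finset.sum_congr rfl fun j _ => symMat_mul hK _ i j
  have := bernProb_abs_sub_gt_le h0 h1 (u := fun e => K e.1.1 e.1.2 * incid e i) (fun e => by
    unfold incid
    rcases hK01 e.1.1 e.1.2 with h | h <;> rw [h] <;> split_ifs <;> simp) hδ hδ1
  simpa only [e1, e2] using this

theorem bernProb_form_le (hK : ∀ i j, K i j = K j i) (hK01 : ∀ i j, K i j = 0 ∨ K i j = 1)
    (h0 : ∀ e, 0 ≤ P e) (h1 : ∀ e, P e ≤ 1) (hr : 0 ≤ r)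
    (hP : ∀ e, P e * K e.1.1 e.1.2 = r * K e.1.1 e.1.2) (hn : 1 ≤ n) {k : ℕ} (hk : k ≠ 0)
    {c : ℝ} (hc : 0 < c) :
    bernProb P {a | ∃ x : Fin n → ℝ, c * ∑ i, x i ^ 2 <
      |biForm (fun i j => graphMat a i j * K i j) x x -
        biForm (fun i j => if i = j then 0 else r * K i j) x x|} ≤
      n * (2 * k * (3 * (n * r) + (2 * k + 1) * Real.log n + 1) / c ^ 2) ^ k := by
  have hn' : (0 : ℝ) < n := by exact_mod_cast hn
  have hlog : 0 ≤ Real.log n := Real.log_nonneg (by exact_mod_cast hn)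
  have hKa : ∀ i j, 0 ≤ K i j ∧ K i j ≤ 1 := fun i j => by
    rcases hK01 i j with h | h <;> rw [h] <;> norm_num
  have hcs : ∀ a, centeredSum P (fun e : NodePair n => K e.1.1 e.1.2 • edgeMat e) a =
      symMat fun e => (ind (a e) - P e) * K e.1.1 e.1.2 := fun a => by
    rw [← sum_smul_edgeMat, centeredSum]
    exact Finset.sum_congr rfl fun e _ => smul_smul _ _ _
  have hu : ∀ x : NodePair n → ℝ, ∀ i, ∑ e, x e * (K e.1.1 e.1.2 * incid e i)
      = ∑ j, symMat x i j * K i j := fun x i => by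
    simp only [← mul_assoc]
    rw [sum_mul_incid]
    exact Finset.sum_congr rfl fun j _ => symMat_mul hK _ i j
  -- The mean degree is at most nr, and the degree threshold is chosen so that exp(2D - K) is
  -- exactly n^(-(2k+1)), which is what the rarity condition asks.
  have key := bernProb_quadForm_le (p := P) (H := fun e : NodePair n => K e.1.1 e.1.2 • edgeMat e)
    (u := fun e i => K e.1.1 e.1.2 * incid e i) (D := n * r)
    (K := 2 * (n * r) + (2 * k + 1) * Real.log n) (k := k) h0 h1
    (fun e => (edgeMat_isSymm e).smul _) (fun e => ?_) (fun e i => ?_) (fun a i j => ?_)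
    (fun i => ?_) (fun i => ?_) (by positivity) (by positivity) hk (by simpa using hn) ?_ hc
  · rw [Fintype.card_fin] at key
    refine le_trans (bernProb_mono h0 h1 ?_) (key.trans (le_of_eq ?_))
    · rintro a ⟨x, hx⟩
      refine ⟨x, hx.trans_eq ?_⟩
      congr 1
      unfold biForm
      rw [hcs, ← Finset.sum_sub_distrib, dotProduct]
      refine Finset.sum_congr rfl fun i _ => ?_
      rw [← Finset.sum_sub_distrib, mulVec, dotProduct, Finset.mul_sum]
      refine Finset.sum_congr rfl fun j _ => ?_
      have : symMat (fun e => (ind (a e) - P e) * K e.1.1 e.1.2) i j =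
          graphMat a i j * K i j - if i = j then 0 else r * K i j := by
        simp only [sub_mul, hP]
        rw [symMat_sub, symMat_mul hK, symMat_mul hK, symMat_const, graphMat]
        split_ifs <;> simp
      rw [this]; ring
    · ring
  · rw [smul_mul_smul_comm, edgeMat_mul_self]
    ext i j
    have : K e.1.1 e.1.2 * K e.1.1 e.1.2 = K e.1.1 e.1.2 := by
      rcases hK01 e.1.1 e.1.2 with h | h <;> rw [h] <;> norm_num
    simp only [Matrix.smul_apply, diagonal_apply, this, smul_eq_mul]
    split_ifs <;> simp
  · unfold incid
    rcases hK01 e.1.1 e.1.2 with h | h <;> rw [h] <;> split_ifs <;> simp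
  · rw [hcs]
    refine abs_symMat_le (fun e => ?_) i j
    have := hKa e.1.1 e.1.2
    have := h0 e
    have := h1 e
    rw [abs_mul, abs_of_nonneg (hKa e.1.1 e.1.2).1]
    refine mul_le_one₀ ?_ (hKa e.1.1 e.1.2).1 (hKa e.1.1 e.1.2).2
    unfold ind
    split_ifs <;> exact abs_le.mpr ⟨by linarith, by linarith⟩
  · have := hu (fun _ => 1) i
    simp only [one_mul] at this
    rw [this]
    refine (Finset.sum_le_sum (g := fun _ => (1 : ℝ)) fun j _ => ?_).trans (by simp)
    rw [symMat_const]
    split_ifs <;> simp [(hKa i j).2]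
  · have : ∑ e, P e * (K e.1.1 e.1.2 * incid e i) = ∑ e, r * (K e.1.1 e.1.2 * incid e i) :=
      Finset.sum_congr rfl fun e _ => by rw [← mul_assoc, hP, mul_assoc]
    rw [this, hu]
    refine (Finset.sum_le_sum (g := fun _ => r) fun j _ => ?_).trans (by simp)
    rw [symMat_const]
    split_ifs
    · simpa using hr
    · exact mul_le_of_le_one_right hr (hKa i j).2
  · rw [Fintype.card_fin, sub_add_cancel_left, Real.exp_neg]
    have : Real.exp ((2 * k + 1) * Real.log n) = (n : ℝ) ^ (2 * k + 1) := by
      rw [← Real.exp_log hn', ← Real.exp_nat_mul, Real.log_exp]; push_cast; rfl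
    rw [this, mul_inv_cancel₀ (by positivity)]

end OneKind

/-! ### Typical graphs have high probability -/

section Typical

variable {n : ℕ}

/-- With moment order k = ⌈log n⌉ and nr ≥ log² n / C, the ratio inside the power is at most B / log
n. Once this is below e^(-2), the bound is n·e^(-2 log n). -/
theorem moment_bound_le_inv {C δ : ℝ} (hC : 0 < C) (hδ : 0 < δ) :
    ∃ ℓ₀ : ℝ, 1 ≤ ℓ₀ ∧ ∀ (n : ℕ) (r : ℝ), ℓ₀ ≤ Real.log n → Real.log n ^ 2 ≤ C * (n * r) →
      (n : ℝ) * (2 * ⌈Real.log n⌉₊ * (3 * (n * r) + (2 * ⌈Real.log n⌉₊ + 1) * Real.log n + 1) /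
        (δ * (n * r)) ^ 2) ^ ⌈Real.log n⌉₊ ≤ 1 / n := by
  set B := 4 * (3 + 6 * C) * C / δ ^ 2 with hB
  have hB0 : 0 < B := by positivity
  refine ⟨max 1 (B * Real.exp 2), le_max_left _ _, fun n r h1 h2 => ?_⟩
  set ℓ := Real.log n with hℓ
  have hℓ1 : 1 ≤ ℓ := (le_max_left _ _).trans h1
  have hℓB : B * Real.exp 2 ≤ ℓ := (le_max_right _ _).trans h1
  have hn : (0 : ℝ) < n := by
    rcases Nat.eq_zero_or_pos n with rfl | h
    · simp [hℓ] at hℓ1; linarith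
    · exact_mod_cast h
  set m := n * r with hm
  have hm0 : 0 < m := by
    by_contra hc
    nlinarith [mul_nonneg hC.le (neg_nonneg.mpr (not_lt.mp hc))]
  set k := ⌈ℓ⌉₊ with hk
  have hk1 : ℓ ≤ k := Nat.le_ceil ℓ
  have hk2 : (k : ℝ) ≤ 2 * ℓ := by
    have := (Nat.ceil_lt_add_one (show 0 ≤ ℓ by linarith)).le
    linarith
  have hbase : 2 * k * (3 * m + (2 * k + 1) * ℓ + 1) / (δ * m) ^ 2 ≤ Real.exp (-2) := by
    have c1 : 2 * k * (3 * m + (2 * k + 1) * ℓ + 1) ≤ 4 * ℓ * (3 * m + 6 * ℓ ^ 2) := by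
      refine mul_le_mul (by linarith) ?_ (by positivity) (by positivity)
      nlinarith
    have c2 : 4 * ℓ * (3 * m + 6 * ℓ ^ 2) ≤ 4 * ℓ * (m * (3 + 6 * C)) := by
      refine mul_le_mul_of_nonneg_left ?_ (by positivity)
      linarith
    have c3 : 4 * ℓ * (m * (3 + 6 * C)) ≤ Real.exp (-2) * (δ * m) ^ 2 := by
      have d1 : B * ℓ ≤ Real.exp (-2) * ℓ ^ 2 := by
        have : B ≤ Real.exp (-2) * ℓ := by
          rw [Real.exp_neg, ← div_eq_inv_mul, le_div_iff₀ (Real.exp_pos _)]; exact hℓB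
        nlinarith
      have d2 : B * ℓ ≤ Real.exp (-2) * (C * m) :=
        d1.trans (mul_le_mul_of_nonneg_left h2 (Real.exp_pos _).le)
      have d3 : B * δ ^ 2 = 4 * (3 + 6 * C) * C := by rw [hB]; field_simp
      have d4 := mul_le_mul_of_nonneg_right d2 (show 0 ≤ δ ^ 2 * m by positivity)
      have d5 : C * (4 * ℓ * (m * (3 + 6 * C))) ≤ C * (Real.exp (-2) * (δ * m) ^ 2) := by
        calc _ = B * ℓ * (δ ^ 2 * m) := by linear_combination (-(ℓ * m)) * d3
          _ ≤ _ := d4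
          _ = _ := by ring
      exact le_of_mul_le_mul_left d5 hC
    rw [div_le_iff₀ (by positivity)]
    exact c1.trans (c2.trans c3)
  have hexp : (n : ℝ) = Real.exp ℓ := (Real.exp_log hn).symm
  calc _ ≤ (n : ℝ) * Real.exp (-2) ^ k := by
        refine mul_le_mul_of_nonneg_left (pow_le_pow_left₀ (by positivity) hbase k) hn.le
    _ ≤ Real.exp ℓ * Real.exp (-2 * ℓ) := by
        rw [← Real.exp_nat_mul, ← hexp]
        refine mul_le_mul_of_nonneg_left (Real.exp_le_exp.mpr ?_) hn.le
        linarith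
    _ = _ := by rw [← Real.exp_add, hexp, one_div, ← Real.exp_neg]; ring_nf

theorem bernProb_oneKind_le {C δ : ℝ} (hC : 0 < C) (hδ : 0 < δ) (hδ1 : δ ≤ 1) :
    ∃ ℓ₀ : ℝ, 1 ≤ ℓ₀ ∧ ∀ (n : ℕ) (r : ℝ) (K : Fin n → Fin n → ℝ) (P : NodePair n → ℝ),
      ℓ₀ ≤ Real.log n → Real.log n ^ 2 ≤ C * (n * r) → (∀ i j, K i j = K j i) →
      (∀ i j, K i j = 0 ∨ K i j = 1) → (∀ e, 0 ≤ P e) → (∀ e, P e ≤ 1) →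
      (∀ e, P e * K e.1.1 e.1.2 = r * K e.1.1 e.1.2) →
      (∀ i, |(∑ j, if i = j then 0 else K i j) - n / 2| ≤ δ / 4 * (n / 2)) →
      bernProb P {a | ¬ ((∀ i, |∑ j, graphMat a i j * K i j - n / 2 * r| ≤ δ * (n / 2 * r)) ∧
        ∀ x : Fin n → ℝ, |biForm (fun i j => graphMat a i j * K i j) x x -
          biForm (fun i j => if i = j then 0 else r * K i j) x x| ≤
            δ * (n * r) * ∑ i, x i ^ 2)} ≤ 3 / n := by
  obtain ⟨ℓ₁, hℓ₁, hmom⟩ := moment_bound_le_inv hC hδ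
  -- The second threshold makes the Chernoff exponent δ²nr/256 at least 2 log n, so that a union
  -- over the n nodes still vanishes.
  refine ⟨max ℓ₁ (512 * C / δ ^ 2), hℓ₁.trans (le_max_left _ _),
    fun n r K P hlog hr hK hK01 h0 h1 hP hs => ?_⟩
  have hl1 : ℓ₁ ≤ Real.log n := (le_max_left _ _).trans hlog
  have hl2 : 512 * C / δ ^ 2 ≤ Real.log n := (le_max_right _ _).trans hlog
  have hl3 : 1 ≤ Real.log n := hℓ₁.trans hl1
  have hn0 : 0 < n := by
    rcases Nat.eq_zero_or_pos n with rfl | h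
    · simp at hl3; linarith
    · exact h
  have hn : (0 : ℝ) < n := by exact_mod_cast hn0
  have hm : 0 < n * r := by
    by_contra hc
    nlinarith [mul_nonneg hC.le (neg_nonneg.mpr (not_lt.mp hc))]
  have hr0 : 0 < r := pos_of_mul_pos_right hm hn.le
  -- The allowance δ is shared: δ/4 for the row sum of the mask differing from n/2, and at most δ/2
  -- for the random fluctuation.
  have hdeg : ∀ i, bernProb P {a | δ * (n / 2 * r) < |∑ j, graphMat a i j * K i j - n / 2 * r|} ≤
      2 * Real.exp (-2 * Real.log n) := fun i => by
    have hi := hs i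
    set s := ∑ j, if i = j then 0 else K i j with hsdef
    obtain ⟨i1, i2⟩ := abs_le.mp hi
    have hrs1 : r * s ≤ (1 + δ / 4) * (n / 2 * r) := by nlinarith
    have hrs2 : (1 - δ / 4) * (n / 2 * r) ≤ r * s := by nlinarith
    refine le_trans (bernProb_mono h0 h1 ?_)
      ((bernProb_degree_le (r := r) hK hK01 h0 h1 hP (δ := δ / 4) (by linarith) (by linarith)
        i).trans ?_)
    · intro a ha
      rw [Set.mem_ofPred_eq] at ha ⊢
      rw [← hsdef]
      have t1 := abs_sub_le (∑ j, graphMat a i j * K i j) (r * s) (n / 2 * r)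
      have t2 : |r * s - n / 2 * r| ≤ δ / 4 * (n / 2 * r) :=
        abs_le.mpr ⟨by linarith, by linarith⟩
      have t3 : δ / 4 * (r * s) ≤ δ / 4 * (2 * (n / 2 * r)) := by
        refine mul_le_mul_of_nonneg_left ?_ (by linarith)
        nlinarith
      have : 0 < δ * (n / 2 * r) := by positivity
      linarith
    · rw [← hsdef]
      refine mul_le_mul_of_nonneg_left (Real.exp_le_exp.mpr ?_) zero_le_two
      have u1 : n * r / 4 ≤ r * s := by nlinarith
      have u2 : 2 * Real.log n ≤ δ ^ 2 / 256 * (n * r) := by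
        have v1 : 512 * C ≤ Real.log n * δ ^ 2 := by rwa [div_le_iff₀ (by positivity)] at hl2
        have v2 : 512 * C * Real.log n ≤ Real.log n ^ 2 * δ ^ 2 := by nlinarith
        have v3 : Real.log n ^ 2 * δ ^ 2 ≤ C * (n * r) * δ ^ 2 :=
          mul_le_mul_of_nonneg_right hr (by positivity)
        have v4 : C * (512 * Real.log n) ≤ C * (n * r * δ ^ 2) := by linarith
        have := le_of_mul_le_mul_left v4 hC
        linarith
      have u3 := mul_le_mul_of_nonneg_left u1 (show 0 ≤ (δ / 4) ^ 2 / 4 by positivity)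
      linarith
  have hform : bernProb P {a | ∃ x : Fin n → ℝ, δ * (n * r) * ∑ i, x i ^ 2 <
      |biForm (fun i j => graphMat a i j * K i j) x x -
        biForm (fun i j => if i = j then 0 else r * K i j) x x|} ≤ 1 / n :=
    (bernProb_form_le hK hK01 h0 h1 hr0.le hP hn0 (k := ⌈Real.log n⌉₊)
      (Nat.ceil_pos.mpr (by linarith)).ne' (by positivity)).trans (hmom n r hl1 hr)
  refine le_trans (bernProb_mono h0 h1 (T := (⋃ i, {a | δ * (n / 2 * r) <
    |∑ j, graphMat a i j * K i j - n / 2 * r|}) ∪ {a | ∃ x : Fin n → ℝ,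
      δ * (n * r) * ∑ i, x i ^ 2 < |biForm (fun i j => graphMat a i j * K i j) x x -
        biForm (fun i j => if i = j then 0 else r * K i j) x x|}) ?_) ?_
  · intro a ha
    rw [Set.mem_ofPred_eq, not_and_or] at ha
    rcases ha with ha | ha
    · push Not at ha
      exact Or.inl (Set.mem_iUnion.mpr ha)
    · push Not at ha
      exact Or.inr ha
  · refine (bernProb_union_le h0 h1 _ _).trans ?_
    have h2 := (bernProb_iUnion_le h0 h1 (fun i : Fin n => {a | δ * (n / 2 * r) <
      |∑ j, graphMat a i j * K i j - n / 2 * r|})).trans (Finset.sum_le_sum fun i _ => hdeg i)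
    have h3 : ∑ _i : Fin n, 2 * Real.exp (-2 * Real.log n) = 2 / n := by
      have : Real.exp (-2 * Real.log n) = ((n : ℝ) ^ 2)⁻¹ := by
        rw [neg_mul, Real.exp_neg, two_mul, Real.exp_add, Real.exp_log hn, sq]
      rw [this]
      simp
      field_simp
    rw [h3] at h2
    have : (3 : ℝ) / n = 2 / n + 1 / n := by ring
    rw [this]
    exact add_le_add h2 hform

/-- The edge probabilities given the labels. -/
def edgeProb (p q : ℝ) (ε : Fin n → Bool) (e : NodePair n) : ℝ :=
  if ε e.1.1 = ε e.1.2 then p else q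

/-- The indicator of two nodes being in the same class. -/
def sameInd (ε : Fin n → Bool) (i j : Fin n) : ℝ := if ε i = ε j then 1 else 0

theorem sameInd_eq (ε : Fin n → Bool) (i j : Fin n) :
    sameInd ε i j = (1 + sgn ε i * sgn ε j) / 2 := by
  rw [sgn_mul_sgn, sameInd]; split_ifs <;> norm_num

theorem sum_sum_sgn (ε : Fin n → Bool) (i : Fin n) :
    ∑ j, sameInd ε i j = (n + sgn ε i * ∑ j, sgn ε j) / 2 := by
  simp only [sameInd_eq, ← Finset.sum_div, Finset.sum_add_distrib, Finset.mul_sum]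
  simp

theorem biForm_sameInd (ε : Fin n → Bool) (p : ℝ) (x : Fin n → ℝ) :
    biForm (fun i j => if i = j then 0 else p * sameInd ε i j) x x =
      p * (classSum ε true x ^ 2 + classSum ε false x ^ 2 - ∑ i, x i ^ 2) := by
  have e : ∀ i j, x i * (if i = j then 0 else p * sameInd ε i j) * x j =
      p * ((if ε i = true then x i else 0) * (if ε j = true then x j else 0) +
        (if ε i = false then x i else 0) * (if ε j = false then x j else 0)) -
      if i = j then p * x i ^ 2 else 0 := fun i j => by
    by_cases hij : i = j
    · subst hij; cases h : ε i <;> simp <;> ring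
    · unfold sameInd; cases h : ε i <;> cases h' : ε j <;> simp [hij] <;> ring
  simp only [biForm, e, Finset.sum_sub_distrib, Finset.sum_ite_eq, Finset.mem_univ, if_true,
    ← Finset.mul_sum, Finset.sum_add_distrib, ← Finset.sum_mul]
  unfold classSum
  ring

theorem biForm_diffInd (ε : Fin n → Bool) (q : ℝ) (x : Fin n → ℝ) :
    biForm (fun i j => if i = j then 0 else q * (1 - sameInd ε i j)) x x =
      2 * q * (classSum ε true x * classSum ε false x) := by
  have e : ∀ i j, x i * (if i = j then 0 else q * (1 - sameInd ε i j)) * x j =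
      q * ((if ε i = true then x i else 0) * (if ε j = false then x j else 0) +
        (if ε i = false then x i else 0) * (if ε j = true then x j else 0)) := fun i j => by
    by_cases hij : i = j
    · subst hij; cases h : ε i <;> simp
    · unfold sameInd; cases h : ε i <;> cases h' : ε j <;> simp [hij] <;> ring
  simp only [biForm, e, ← Finset.mul_sum, Finset.sum_add_distrib, ← Finset.sum_mul]
  unfold classSum
  ring

theorem bernProb_not_isTypicalGraph_le {C δ : ℝ} (hC : 0 < C) (hδ : 0 < δ) (hδ1 : δ ≤ 1) :
    ∃ ℓ₀ : ℝ, 1 ≤ ℓ₀ ∧ ∀ (n : ℕ) (p q : ℝ) (ε : Fin n → Bool), ℓ₀ ≤ Real.log n →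
      16 ≤ δ * n → Real.log n ^ 2 ≤ C * (n * q) → 0 ≤ q → q ≤ p → p ≤ 1 →
      |∑ i, sgn ε i| ≤ δ / 8 * n →
      bernProb (edgeProb p q ε) {a | ¬ IsTypicalGraph δ p q ε (graphMat a)} ≤ 6 / n := by
  obtain ⟨ℓ₀, hℓ₀, H⟩ := bernProb_oneKind_le hC hδ hδ1
  refine ⟨ℓ₀, hℓ₀, fun n p q ε hlog hδn hlq hq hqp hp hε => ?_⟩
  have hP0 : ∀ e, 0 ≤ edgeProb p q ε e := fun e => by unfold edgeProb; split_ifs <;> linarith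
  have hP1 : ∀ e, edgeProb p q ε e ≤ 1 := fun e => by unfold edgeProb; split_ifs <;> linarith
  have hlp : Real.log n ^ 2 ≤ C * (n * p) := hlq.trans (by gcongr)
  have hsym : ∀ i j, sameInd ε i j = sameInd ε j i := fun i j => by
    simp only [sameInd, eq_comm]
  have hrow : ∀ i, |sgn ε i * ∑ j, sgn ε j| ≤ δ / 8 * n := fun i => by
    rw [abs_mul, abs_sgn, one_mul]; exact hε
  have hS := H n p (sameInd ε) (edgeProb p q ε) hlog hlp hsym
    (fun i j => by unfold sameInd; split_ifs <;> simp) hP0 hP1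
    -- A node is not its own neighbour, which shifts the count by 1; together with the label
    -- imbalance this fits into δ/4 · n/2 since 16 ≤ δn.
    (fun e => by unfold edgeProb sameInd; split_ifs <;> simp) (fun i => by
      have : (∑ j, if i = j then 0 else sameInd ε i j) = ∑ j, sameInd ε i j - 1 := by
        have e : ∀ j, (if i = j then 0 else sameInd ε i j) =
            sameInd ε i j - if i = j then 1 else 0 := fun j => by
          by_cases hij : i = j
          · subst hij; simp [sameInd]
          · simp [hij]
        simp only [e, Finset.sum_sub_distrib]
        simp
      rw [this, sum_sum_sgn]
      obtain ⟨b1, b2⟩ := abs_le.mp (hrow i)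
      exact abs_le.mpr ⟨by linarith, by linarith⟩)
  have hD := H n q (fun i j => 1 - sameInd ε i j) (edgeProb p q ε) hlog hlq
    (fun i j => by rw [hsym])
    (fun i j => by unfold sameInd; split_ifs <;> simp) hP0 hP1
    (fun e => by unfold edgeProb sameInd; split_ifs <;> simp) (fun i => by
      have : (∑ j, if i = j then 0 else 1 - sameInd ε i j) = n - ∑ j, sameInd ε i j := by
        have e : ∀ j, (if i = j then 0 else 1 - sameInd ε i j) = 1 - sameInd ε i j := fun j => by
          by_cases hij : i = j
          · subst hij; simp [sameInd]
          · simp [hij]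
        simp only [e, Finset.sum_sub_distrib]
        simp
      rw [this, sum_sum_sgn]
      obtain ⟨b1, b2⟩ := abs_le.mp (hrow i)
      exact abs_le.mpr ⟨by linarith, by linarith⟩)
  have hsum : (6 : ℝ) / n = 3 / n + 3 / n := by ring
  rw [hsum]
  refine le_trans ?_ (add_le_add hS hD)
  refine (bernProb_mono hP0 hP1 fun a ha => ?_).trans (bernProb_union_le hP0 hP1 _ _)
  by_contra hc
  rw [Set.mem_union, not_or] at hc
  obtain ⟨⟨s1, s2⟩, ⟨d1, d2⟩⟩ := And.intro (not_not.mp hc.1) (not_not.mp hc.2)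
  have eS : (fun i j => graphMat a i j * sameInd ε i j) = samePart ε (graphMat a) := by
    funext i j; unfold sameInd samePart; split_ifs <;> simp
  have eD : (fun i j => graphMat a i j * (1 - sameInd ε i j)) = diffPart ε (graphMat a) := by
    funext i j; unfold sameInd diffPart; split_ifs <;> simp
  refine ha ⟨fun i => ?_, fun i => ?_, fun x => ?_, fun x => ?_⟩
  · have := s1 i
    rwa [Finset.sum_congr rfl fun j _ => congrFun (congrFun eS i) j] at this
  · have := d1 i
    rwa [Finset.sum_congr rfl fun j _ => congrFun (congrFun eD i) j] at this
  · have := s2 x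
    rwa [eS, biForm_sameInd] at this
  · have := d2 x
    rwa [eD, biForm_diffInd] at this

end Typical

/-! ### The typical event of the contextual stochastic block model -/

section Model

variable {n : ℕ}

instance (p : ℝ) : IsProbabilityMeasure (bern p) := by unfold bern; infer_instance

instance (p q : ℝ) (ε : Fin n → Bool) : IsProbabilityMeasure (edgeLaw n p q ε) := by
  unfold edgeLaw; infer_instance

instance (μ σ : ℝ) (ε : Fin n → Bool) : IsProbabilityMeasure (featureLaw n μ σ ε) := by
  unfold featureLaw; infer_instance

theorem bern_singleton {p : ℝ} (h0 : 0 ≤ p) (h1 : p ≤ 1) (b : Bool) :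
    bern p {b} = ENNReal.ofReal (if b then p else 1 - p) := by
  have hp : Set.projIcc (0 : ℝ) 1 zero_le_one p = ⟨p, h0, h1⟩ :=
    Set.projIcc_of_mem zero_le_one ⟨h0, h1⟩
  rw [bern, hp]
  cases b
  · rw [bernoulliMeasure_apply_of_notMem_of_mem _ (MeasurableSet.singleton _) (by simp) (by simp)]
    rw [if_neg (by simp), ENNReal.ofReal]
    congr 1
    ext
    rw [Real.coe_toNNReal _ (by linarith)]
    rfl
  · rw [bernoulliMeasure_apply_of_mem_of_notMem _ (MeasurableSet.singleton _) (by simp) (by simp)]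
    rw [if_pos rfl, ENNReal.ofReal]
    congr 1
    ext
    rw [Real.coe_toNNReal _ h0]
    rfl

theorem edgeLaw_apply {p q : ℝ} (hq : 0 ≤ q) (hqp : q ≤ p) (hp : p ≤ 1) (ε : Fin n → Bool)
    (S : Set (NodePair n → Bool)) :
    edgeLaw n p q ε S = ENNReal.ofReal (bernProb (edgeProb p q ε) S) := by
  classical
  have h0 : ∀ e, 0 ≤ edgeProb p q ε e := fun e => by unfold edgeProb; split_ifs <;> linarith
  have h1 : ∀ e, edgeProb p q ε e ≤ 1 := fun e => by unfold edgeProb; split_ifs <;> linarith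
  have hS : S = ((Finset.univ.filter (· ∈ S) : Finset (NodePair n → Bool)) : Set _) := by
    ext; simp
  rw [hS, ← sum_measure_singleton, ← hS, bernProb, bernMean,
    ENNReal.ofReal_sum_of_nonneg (fun a _ => mul_nonneg (bernWeight_nonneg h0 h1 a)
      (by split_ifs <;> norm_num)), Finset.sum_filter]
  refine Finset.sum_congr rfl fun a _ => ?_
  split_ifs with ha
  · rw [mul_one, edgeLaw, Measure.pi_singleton, bernWeight,
      ENNReal.ofReal_prod_of_nonneg (fun e _ => by
        have := h0 e; have := h1 e; split_ifs <;> linarith)]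
    exact Finset.prod_congr rfl fun e _ => bern_singleton (h0 e) (h1 e) (a e)
  · simp

theorem hasSubgaussianMGF_sub_gaussianReal (m : ℝ) (v : NNReal) :
    HasSubgaussianMGF (fun x => x - m) v (gaussianReal m v) where
  integrable_exp_mul t := by
    have := (integrable_exp_mul_gaussianReal (μ := m) (v := v) t).const_mul (Real.exp (-(t * m)))
    refine this.congr (Eventually.of_forall fun x => ?_)
    dsimp only
    rw [← Real.exp_add]; ring_nf
  mgf_le t := by
    have : (fun x => x - m) = fun x => x + (-m) := by funext x; ring
    have h : (gaussianReal m v).map (fun x => x - m) = gaussianReal 0 v := by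
      rw [gaussianReal_map_sub_const, sub_self]
    rw [mgf_gaussianReal h, zero_mul, zero_add]

theorem gaussianReal_tail_le (m : ℝ) (v : NNReal) {τ : ℝ} (hτ : 0 ≤ τ) :
    (gaussianReal m v).real {x | τ < |x - m|} ≤ 2 * Real.exp (-τ ^ 2 / (2 * v)) := by
  have h := hasSubgaussianMGF_sub_gaussianReal m v
  have h1 := h.measure_ge_le hτ
  have h2 := h.neg.measure_ge_le hτ
  refine (measureReal_mono (s₂ := {x | τ ≤ x - m} ∪ {x | τ ≤ (-fun x => x - m) x})
    (fun x hx => ?_)).trans ((measureReal_union_le _ _).trans ?_)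
  · rw [Set.mem_ofPred_eq] at hx
    rcases lt_abs.mp hx with h | h
    · exact Or.inl h.le
    · exact Or.inr h.le
  · rw [two_mul]; exact add_le_add h1 h2

theorem featureLaw_tail_le {μ σ : ℝ} (hμ : 0 < μ) (hσ : 0 < σ) {δ : ℝ} (hδ : 0 ≤ δ)
    (ε : Fin n → Bool) :
    (featureLaw n μ σ ε).real {x | ∀ i, |sgn ε i * x i - μ| ≤ δ * μ}ᶜ ≤
      n * (2 * Real.exp (-(δ ^ 2 / 2 * (μ / σ) ^ 2))) := by
  have hone : ∀ i, (featureLaw n μ σ ε).real {x | δ * μ < |sgn ε i * x i - μ|} ≤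
      2 * Real.exp (-(δ ^ 2 / 2 * (μ / σ) ^ 2)) := fun i => by
    set m : ℝ := if ε i then μ else -μ with hm
    have hme : ∀ y : ℝ, |sgn ε i * y - μ| = |y - m| := fun y => by
      rw [hm]; unfold sgn
      split_ifs
      · rw [one_mul]
      · rw [← abs_neg]; ring_nf
    have hmp := measurePreserving_eval
      (fun i : Fin n => gaussianReal (if ε i then μ else -μ) (σ ^ 2).toNNReal) i
    have hset : {x : Fin n → ℝ | δ * μ < |sgn ε i * x i - μ|}
        = Function.eval i ⁻¹' {y | δ * μ < |y - m|} := by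
      ext x; simp only [Set.mem_ofPred_eq, Set.mem_preimage, hme, Function.eval]
    have hmeas : MeasurableSet {y : ℝ | δ * μ < |y - m|} :=
      measurableSet_lt measurable_const (by fun_prop)
    rw [hset, featureLaw, measureReal_def, hmp.measure_preimage hmeas.nullMeasurableSet,
      ← measureReal_def]
    refine (gaussianReal_tail_le m _ (by positivity)).trans (le_of_eq ?_)
    rw [Real.coe_toNNReal _ (sq_nonneg σ)]
    congr 2
    field_simp
  have hsub : {x : Fin n → ℝ | ∀ i, |sgn ε i * x i - μ| ≤ δ * μ}ᶜ =
      ⋃ i, {x | δ * μ < |sgn ε i * x i - μ|} := by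
    ext x; simp
  rw [hsub]
  refine (measureReal_iUnion_fintype_le _).trans ((Finset.sum_le_sum fun i _ => hone i).trans ?_)
  simp

/-- Only a lower bound is claimed, which is valid for every set, measurable or not. -/
theorem csbm_apply_ge (p q μ σ : ℝ) (G : Set (Outcome n)) :
    ∑ ε : Fin n → Bool, (2 : ENNReal)⁻¹ ^ n *
      ((edgeLaw n p q ε).prod (featureLaw n μ σ ε)) (Prod.mk ε ⁻¹' G) ≤ csbm n p q μ σ G := by
  rw [csbm, Measure.finsetSum_apply]
  refine Finset.sum_le_sum fun ε _ => ?_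
  rw [Measure.smul_apply, smul_eq_mul, Measure.dirac_prod]
  gcongr
  exact Measure.le_map_apply measurable_prodMk_left.aemeasurable G

theorem sum_two_inv_pow : ∑ _ε : Fin n → Bool, (2 : ENNReal)⁻¹ ^ n = 1 := by
  rw [Finset.sum_const, Finset.card_univ, Fintype.card_fun, Fintype.card_bool, Fintype.card_fin,
    nsmul_eq_mul]
  push_cast
  rw [← mul_pow, ENNReal.mul_inv_cancel (by norm_num) (by norm_num), one_pow]

instance (p q μ σ : ℝ) : IsProbabilityMeasure (csbm n p q μ σ) where
  measure_univ := by
    rw [csbm, Measure.finsetSum_apply]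
    simp only [Measure.smul_apply, smul_eq_mul, measure_univ, mul_one]
    exact sum_two_inv_pow

/-- The labels are balanced, the graph is typical and the noise is small. -/
def goodEvent (n : ℕ) (δ p q μ : ℝ) : Set (Outcome n) :=
  {ω | |∑ i, sgn ω.1 i| ≤ δ / 8 * n ∧ IsTypicalGraph δ p q ω.1 (graphMat ω.2.1) ∧
    ∀ i, |sgn ω.1 i * feat ω i - μ| ≤ δ * μ}

theorem measurableSet_goodEvent (n : ℕ) (δ p q μ : ℝ) :
    MeasurableSet (goodEvent n δ p q μ) := by
  have h1 : MeasurableSet {ω : Outcome n | (ω.1, ω.2.1) ∈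
      {y : (Fin n → Bool) × (NodePair n → Bool) | |∑ i, sgn y.1 i| ≤ δ / 8 * n ∧
        IsTypicalGraph δ p q y.1 (graphMat y.2)}} :=
    (measurable_fst.prodMk (measurable_fst.comp measurable_snd)) (Set.toFinite _).measurableSet
  have h2 : MeasurableSet {ω : Outcome n | ∀ i, |sgn ω.1 i * feat ω i - μ| ≤ δ * μ} := by
    rw [Set.ofPred_forall]
    refine MeasurableSet.iInter fun i => measurableSet_le ?_ measurable_const
    have hs : Measurable fun ω : Outcome n => sgn ω.1 i :=
      (measurable_of_finite fun ε : Fin n → Bool => sgn ε i).comp measurable_fst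
    have hf : Measurable fun ω : Outcome n => feat ω i :=
      (measurable_pi_apply i).comp (measurable_snd.comp measurable_snd)
    exact ((hs.mul hf).sub_const μ).abs
  have : goodEvent n δ p q μ = {ω : Outcome n | (ω.1, ω.2.1) ∈
      {y : (Fin n → Bool) × (NodePair n → Bool) | |∑ i, sgn y.1 i| ≤ δ / 8 * n ∧
        IsTypicalGraph δ p q y.1 (graphMat y.2)}} ∩
      {ω : Outcome n | ∀ i, |sgn ω.1 i * feat ω i - μ| ≤ δ * μ} := by
    ext ω; simp only [goodEvent, Set.mem_ofPred_eq, Set.mem_inter_iff, and_assoc]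
  rw [this]
  exact h1.inter h2

/-- The labels are themselves Bernoulli variables of parameter 1/2, so the Chernoff bound proved for
edges applies to them. -/
theorem sum_balanced_ge {δ : ℝ} (hδ : 0 < δ) (hδ1 : δ ≤ 1) :
    ENNReal.ofReal (1 - 2 * Real.exp (-(δ ^ 2 / 8 * n))) ≤
      ∑ ε : Fin n → Bool, open Classical in
        if |∑ i, sgn ε i| ≤ δ * n then (2 : ENNReal)⁻¹ ^ n else 0 := by
  classical
  set P : Fin n → ℝ := fun _ => 1 / 2 with hP
  have h0 : ∀ e, 0 ≤ P e := fun e => by norm_num [hP]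
  have h1 : ∀ e, P e ≤ 1 := fun e => by norm_num [hP]
  have hw : ∀ ε, bernWeight P ε = (1 / 2) ^ n := fun ε => by
    rw [bernWeight, Finset.prod_congr rfl (g := fun _ => (1 / 2 : ℝ))
      (fun i _ => by simp only [hP]; split_ifs <;> norm_num)]
    simp
  have hbad := bernProb_abs_sub_gt_le h0 h1 (u := fun _ => 1) (fun _ => Or.inr rfl) hδ hδ1
  have hm : ∑ e, P e * 1 = n / 2 := by simp [hP]; ring
  rw [hm] at hbad
  have hsub : bernProb P {ε | ¬ |∑ i, sgn ε i| ≤ δ * n} ≤ 2 * Real.exp (-(δ ^ 2 / 8 * n)) := by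
    refine (bernProb_mono h0 h1 fun ε hε => ?_).trans (hbad.trans (le_of_eq (by ring_nf)))
    rw [Set.mem_ofPred_eq, not_le] at hε
    rw [Set.mem_ofPred_eq]
    have : ∑ i, sgn ε i = 2 * (∑ e, ind (ε e) * 1 - n / 2) := by
      have e : ∀ i, sgn ε i = 2 * (ind (ε i) * 1) - 1 := fun i => by
        unfold sgn ind; split_ifs <;> norm_num
      simp only [e, Finset.sum_sub_distrib, ← Finset.mul_sum]
      simp; ring
    rw [this, abs_mul, abs_two] at hε
    linarith
  have htot : bernProb P {ε | ¬ |∑ i, sgn ε i| ≤ δ * n} +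
      bernProb P {ε | |∑ i, sgn ε i| ≤ δ * n} = 1 := by
    rw [bernProb, bernProb, ← bernMean_add]
    refine Eq.trans ?_ (bernMean_const (p := P) 1)
    congr 1; funext ε
    by_cases h : |∑ i, sgn ε i| ≤ δ * n <;> simp [h]
  calc _ ≤ ENNReal.ofReal (bernProb P {ε | |∑ i, sgn ε i| ≤ δ * n}) :=
        ENNReal.ofReal_le_ofReal (by linarith)
    _ = _ := by
        rw [bernProb, bernMean, ENNReal.ofReal_sum_of_nonneg (fun a _ =>
          mul_nonneg (bernWeight_nonneg h0 h1 a) (by split_ifs <;> norm_num))]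
        refine Finset.sum_congr rfl fun ε _ => ?_
        rw [hw, Set.mem_ofPred_eq]
        split_ifs
        · rw [mul_one, ENNReal.ofReal_pow (by norm_num), one_div,
            ENNReal.ofReal_inv_of_pos two_pos]
          simp
        · simp

theorem csbm_goodEvent_ge {δ p q μ σ b c : ℝ} (hδ : 0 < δ) (hδ1 : δ ≤ 1)
    (hq : 0 ≤ q) (hqp : q ≤ p) (hp : p ≤ 1)
    (hb : ∀ ε : Fin n → Bool, |∑ i, sgn ε i| ≤ δ / 8 * n →
      bernProb (edgeProb p q ε) {a | ¬ IsTypicalGraph δ p q ε (graphMat a)} ≤ b)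
    (hc : ∀ ε : Fin n → Bool,
      (featureLaw n μ σ ε).real {x | ∀ i, |sgn ε i * x i - μ| ≤ δ * μ}ᶜ ≤ c) :
    ENNReal.ofReal (1 - 2 * Real.exp (-((δ / 8) ^ 2 / 8 * n))) *
      (ENNReal.ofReal (1 - b) * ENNReal.ofReal (1 - c)) ≤
      csbm n p q μ σ (goodEvent n δ p q μ) := by
  classical
  refine le_trans ?_ (csbm_apply_ge p q μ σ _)
  refine (mul_le_mul_left (sum_balanced_ge (n := n) (δ := δ / 8) (by linarith) (by linarith)) _).trans ?_
  rw [Finset.sum_mul]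
  refine Finset.sum_le_sum fun ε _ => ?_
  split_ifs with hε
  · gcongr
    have hE : ENNReal.ofReal (1 - b) ≤
        edgeLaw n p q ε {a | IsTypicalGraph δ p q ε (graphMat a)} := by
      have h1 : edgeLaw n p q ε {a | ¬ IsTypicalGraph δ p q ε (graphMat a)} ≤
          ENNReal.ofReal b := by
        rw [edgeLaw_apply hq hqp hp]; exact ENNReal.ofReal_le_ofReal (hb ε hε)
      have h2 : {a | IsTypicalGraph δ p q ε (graphMat a)} =
          {a | ¬ IsTypicalGraph δ p q ε (graphMat a)}ᶜ := by ext; simp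
      rw [h2, prob_compl_eq_one_sub (Set.toFinite _).measurableSet]
      have hb0 : 0 ≤ b := (bernProb_nonneg (fun e => by unfold edgeProb; split_ifs <;> linarith)
        (fun e => by unfold edgeProb; split_ifs <;> linarith) _).trans (hb ε hε)
      rw [ENNReal.ofReal_sub _ hb0, ENNReal.ofReal_one]
      exact tsub_le_tsub_left h1 1
    have hF : ENNReal.ofReal (1 - c) ≤
        featureLaw n μ σ ε {x | ∀ i, |sgn ε i * x i - μ| ≤ δ * μ} := by
      have hmeas : MeasurableSet {x : Fin n → ℝ | ∀ i, |sgn ε i * x i - μ| ≤ δ * μ} := by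
        rw [Set.ofPred_forall]
        exact MeasurableSet.iInter fun i => measurableSet_le (by fun_prop) measurable_const
      have h1 := hc ε
      rw [measureReal_compl hmeas, probReal_univ] at h1
      rw [← ofReal_measureReal]
      exact ENNReal.ofReal_le_ofReal (by linarith)
    calc _ ≤ _ := mul_le_mul' hE hF
      _ = _ := (Measure.prod_prod _ _).symm
      _ ≤ _ := measure_mono (by
        rintro ⟨a, x⟩ ⟨ha, hx⟩
        exact ⟨hε, ha, hx⟩)
  · simp

theorem withHighProbability_goodEvent {p q μ σ : ℕ → ℝ}
    (hq : ∀ n, 0 ≤ q n) (hqp : ∀ n, q n < p n) (hp : ∀ n, p n ≤ 1)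
    (hqn : (fun n : ℕ => Real.log n ^ 2 / n) =O[atTop] q)
    (hμ : ∀ n, 0 < μ n) (hσ : ∀ n, 0 < σ n)
    (hSNR : (fun n : ℕ => √(Real.log n)) =o[atTop] fun n => μ n / σ n)
    {δ : ℝ} (hδ : 0 < δ) (hδ1 : δ ≤ 1) :
    WithHighProbability p q μ σ fun n => goodEvent n δ (p n) (q n) (μ n) := by
  obtain ⟨C, hC, hCq⟩ := hqn.exists_pos
  rw [IsBigOWith] at hCq
  obtain ⟨ℓ₀, hℓ₀, H⟩ := bernProb_not_isTypicalGraph_le hC hδ hδ1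
  have hlog : Tendsto (fun n : ℕ => Real.log n) atTop atTop :=
    Real.tendsto_log_atTop.comp tendsto_natCast_atTop_atTop
  have hlow : ∀ᶠ n : ℕ in atTop,
      ENNReal.ofReal (1 - 2 * Real.exp (-((δ / 8) ^ 2 / 8 * n))) *
        (ENNReal.ofReal (1 - 6 / n) * ENNReal.ofReal (1 - 2 / n)) ≤
      csbm n (p n) (q n) (μ n) (σ n) (goodEvent n δ (p n) (q n) (μ n)) := by
    have hδn : ∀ᶠ n : ℕ in atTop, 16 ≤ δ * n :=
      (tendsto_natCast_atTop_atTop.const_mul_atTop hδ).eventually_ge_atTop 16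
    filter_upwards [hCq, hlog.eventually_ge_atTop ℓ₀, hδn, eventually_gt_atTop 0,
      hSNR.bound (half_pos hδ)] with n h1 h2 h3 h4 h5
    have hn : (0 : ℝ) < n := by exact_mod_cast h4
    have hlog1 : 1 ≤ Real.log n := hℓ₀.trans h2
    refine csbm_goodEvent_ge hδ hδ1 (hq n) (hqp n).le (hp n) (fun ε hε => ?_) fun ε => ?_
    · refine H n (p n) (q n) ε h2 h3 ?_ (hq n) (hqp n).le (hp n) hε
      rw [Real.norm_of_nonneg (by positivity), Real.norm_of_nonneg (hq n),
        div_le_iff₀ hn] at h1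
      linarith
    · refine (featureLaw_tail_le (hμ n) (hσ n) hδ.le ε).trans ?_
      have hs : 0 < μ n / σ n := div_pos (hμ n) (hσ n)
      rw [Real.norm_of_nonneg (Real.sqrt_nonneg _), Real.norm_of_nonneg hs.le] at h5
      -- With SNR at least (2/δ)√(log n) each feature fails with probability at most 2/n², hence
      -- some feature fails with probability at most 2/n.
      have h6 : Real.log n ≤ (δ / 2 * (μ n / σ n)) ^ 2 := by
        rw [← Real.sq_sqrt (show 0 ≤ Real.log n by linarith)]
        exact pow_le_pow_left₀ (Real.sqrt_nonneg _) h5 2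
      have h7 : Real.exp (-(δ ^ 2 / 2 * (μ n / σ n) ^ 2)) ≤ ((n : ℝ) ^ 2)⁻¹ := by
        have : ((n : ℝ) ^ 2)⁻¹ = Real.exp (-(2 * Real.log n)) := by
          rw [Real.exp_neg, two_mul, Real.exp_add, Real.exp_log hn, sq]
        rw [this, Real.exp_le_exp]
        nlinarith
      calc _ ≤ (n : ℝ) * (2 * ((n : ℝ) ^ 2)⁻¹) := by gcongr
        _ = _ := by field_simp
  have hlim : Tendsto (fun n : ℕ =>
      ENNReal.ofReal (1 - 2 * Real.exp (-((δ / 8) ^ 2 / 8 * n))) *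
        (ENNReal.ofReal (1 - 6 / n) * ENNReal.ofReal (1 - 2 / n))) atTop (𝓝 1) := by
    have e1 : Tendsto (fun n : ℕ => 1 - 2 * Real.exp (-((δ / 8) ^ 2 / 8 * n))) atTop (𝓝 1) := by
      have : Tendsto (fun n : ℕ => Real.exp (-((δ / 8) ^ 2 / 8 * n))) atTop (𝓝 0) :=
        Real.tendsto_exp_neg_atTop_nhds_zero.comp
          (tendsto_natCast_atTop_atTop.const_mul_atTop (by positivity))
      simpa using (this.const_mul 2).const_sub 1
    have e2 : ∀ c : ℝ, Tendsto (fun n : ℕ => 1 - c / (n : ℝ)) atTop (𝓝 1) := fun c => by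
      simpa using (tendsto_const_div_atTop_nhds_zero_nat c).const_sub 1
    have o : ∀ {f : ℕ → ℝ}, Tendsto f atTop (𝓝 1) →
        Tendsto (fun n => ENNReal.ofReal (f n)) atTop (𝓝 1) := fun h => by
      simpa using ENNReal.tendsto_ofReal h
    have m := ENNReal.Tendsto.mul (o (e2 6)) (by simp) (o (e2 2)) (by simp)
    have m2 := ENNReal.Tendsto.mul (o e1) (by simp) m (by simp)
    simpa using m2
  exact tendsto_of_tendsto_of_tendsto_of_le_of_le' hlim tendsto_const_nhds hlow
    (Eventually.of_forall fun _ => prob_le_one)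

theorem WithHighProbability.mono {p q μ σ : ℕ → ℝ} {E F : ∀ n, Set (Outcome n)}
    (h : WithHighProbability p q μ σ E) (hEF : ∀ᶠ n in atTop, E n ⊆ F n) :
    WithHighProbability p q μ σ F :=
  tendsto_of_tendsto_of_tendsto_of_le_of_le' h tendsto_const_nhds
    (hEF.mono fun _ hn => measure_mono hn) (Eventually.of_forall fun _ => prob_le_one)

/-- Measurability is required only of the good event; the over-smoothing event is merely contained
in its complement. -/
theorem WithHighProbability.vanishing {p q μ σ : ℕ → ℝ} {E F : ∀ n, Set (Outcome n)}
    (h : WithHighProbability p q μ σ E) (hE : ∀ n, MeasurableSet (E n))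
    (hEF : ∀ᶠ n in atTop, Disjoint (E n) (F n)) : WithVanishingProbability p q μ σ F := by
  have h1 : Tendsto (fun n => csbm n (p n) (q n) (μ n) (σ n) (E n)ᶜ) atTop (𝓝 0) := by
    have h2 := ENNReal.Tendsto.sub (tendsto_const_nhds (x := (1 : ENNReal))) h (by simp)
    rw [tsub_self] at h2
    refine h2.congr fun n => ?_
    rw [prob_compl_eq_one_sub (hE n)]
  exact tendsto_of_tendsto_of_tendsto_of_le_of_le' tendsto_const_nhds h1
    (Eventually.of_forall fun _ => zero_le)
    (hEF.mono fun n hn => measure_mono hn.symm.subset_compl_right)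

end Model

/-! ### Layers on the typical event -/

section Layers

variable {n : ℕ} {ω : Outcome n} {δ p q μ : ℝ}

theorem adj_symm (ω : Outcome n) (i j : Fin n) : adj ω i j = adj ω j i := by
  rw [adj_eq_graphMat]; exact symMat_symm _ i j

theorem abs_gam_gatFeat_sub_le (hω : ω ∈ goodEvent n δ p q μ) (hn : 0 < n) (hp : 0 < p)
    (hq : 0 ≤ q) (hqp : q ≤ p) (hμ : 0 < μ) (hδ : 0 ≤ δ) (hδ1 : δ ≤ 1 / 4) {t : ℝ} (ht : 0 ≤ t)
    (l : ℕ) :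
    |gam (gatFeat t ω l) - ((p * Real.exp t - q * Real.exp (-t)) /
      (p * Real.exp t + q * Real.exp (-t))) ^ l * gam (feat ω)| ≤ 26 * δ * gam (feat ω) := by
  obtain ⟨h1, h2, h3⟩ := hω
  have hn' : (0 : ℝ) < n := by exact_mod_cast hn
  exact (abs_gam_iterate_gatLayer_sub_le (A := adj ω) (graphMat_nonneg _) hn hp hq hqp ht hμ hδ hδ1
    (h1.trans (by nlinarith)) h2.degSame_sub_le h2.degDiff_sub_le h3 l).2

theorem half_le_gam_feat (hω : ω ∈ goodEvent n δ p q μ) (hn : 0 < n) (hp : 0 < p)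
    (hq : 0 ≤ q) (hqp : q ≤ p) (hμ : 0 < μ) (hδ : 0 ≤ δ) (hδ1 : δ ≤ 1 / 4) :
    μ / 2 ≤ gam (feat ω) := by
  obtain ⟨h1, h2, h3⟩ := hω
  have hn' : (0 : ℝ) < n := by exact_mod_cast hn
  exact (abs_gam_iterate_gatLayer_sub_le (A := adj ω) (graphMat_nonneg _) hn hp hq hqp le_rfl hμ hδ
    hδ1 (h1.trans (by nlinarith)) h2.degSame_sub_le h2.degDiff_sub_le h3 0).1

theorem gam_gcnFeat_le (hω : ω ∈ goodEvent n δ p q μ) (hn : 0 < n) (hp : 0 < p)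
    (hq : 0 ≤ q) (hqp : q ≤ p) (hδ : 0 ≤ δ) {η : ℝ} (hη : 0 < η) (hη1 : η < 1)
    (hδη : δ ≤ η / 8) (hδn : 1 ≤ δ * n) (l : ℕ) :
    gam (gcnFeat ω l) ≤ 2 * (1 - (1 - η) * (1 - (p - q) / (p + q))) ^ l * gam (feat ω) := by
  obtain ⟨h1, h2, -⟩ := hω
  exact h2.gam_iterate_gcnLayer_le (A := adj ω) hn (adj_symm ω) hp hq hqp hδ hη hη1 hδη hδn
    (h1.trans (by linarith)) _ l

end Layers

/-! ### The contraction factor of an attention layer -/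

section ContractionFactor

theorem leak_le {p q : ℝ} (hp : 0 < p) (hq : 0 ≤ q) (t : ℝ) :
    leak p q t ≤ q / (p * Real.exp (2 * t)) := by
  unfold leak
  rw [div_le_div_iff₀ (by positivity) (by positivity)]
  have h : Real.exp (-t) * Real.exp (2 * t) = Real.exp t := by rw [← Real.exp_add]; ring_nf
  have h2 : 0 ≤ q * (q * Real.exp (-t)) := by positivity
  calc _ = q * p * (Real.exp (-t) * Real.exp (2 * t)) := by ring
    _ = q * (p * Real.exp t) := by rw [h]; ring
    _ ≤ _ := by rw [mul_add]; linarith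

theorem leak_le_exp {p q : ℝ} (hp : 0 < p) (hq : 0 ≤ q) (hqp : q ≤ p) (t : ℝ) :
    leak p q t ≤ Real.exp (-(2 * t)) := by
  refine (leak_le hp hq t).trans ?_
  rw [div_le_iff₀ (by positivity), Real.exp_neg]
  field_simp
  exact hqp

theorem exp_neg_two_mul_le_one_sub {x : ℝ} (h0 : 0 ≤ x) (h1 : x ≤ 1 / 2) :
    Real.exp (-(2 * x)) ≤ 1 - x := by
  rw [Real.exp_neg, inv_le_iff_one_le_mul₀ (Real.exp_pos _)]
  have := Real.add_one_le_exp (2 * x)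
  calc (1 : ℝ) ≤ (1 - x) * (2 * x + 1) := by nlinarith
    _ ≤ _ := mul_le_mul_of_nonneg_left this (by linarith)

/-- By e^(-2x) ≤ 1 - x with x = 2 `leak`, the signal survives as long as the total leak over all
layers is bounded. -/
theorem exp_neg_le_factor_pow {p q t : ℝ} (hp : 0 < p) (hq : 0 ≤ q)
    (h : leak p q t ≤ 1 / 4) (l : ℕ) :
    Real.exp (-(4 * (l * leak p q t))) ≤ ((p * Real.exp t - q * Real.exp (-t)) /
      (p * Real.exp t + q * Real.exp (-t))) ^ l := by
  have h0 := leak_nonneg hp.le hq t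
  rw [← one_sub_two_mul_leak hp hq]
  calc _ = Real.exp (-(2 * (2 * leak p q t))) ^ l := by rw [← Real.exp_nat_mul]; ring_nf
    _ ≤ _ := pow_le_pow_left₀ (Real.exp_pos _).le
      (exp_neg_two_mul_le_one_sub (by linarith) (by linarith)) l

theorem factor_pow_le_one {p q t : ℝ} (hp : 0 < p) (hq : 0 ≤ q) (hqp : q ≤ p) (ht : 0 ≤ t)
    (l : ℕ) : ((p * Real.exp t - q * Real.exp (-t)) /
      (p * Real.exp t + q * Real.exp (-t))) ^ l ≤ 1 := by
  have h0 := leak_nonneg hp.le hq t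
  have h1 := one_sub_two_mul_leak_nonneg hp hq hqp ht
  rw [← one_sub_two_mul_leak hp hq]
  exact pow_le_one₀ h1 (by linarith)

end ContractionFactor

/-! ### Over-smoothing and its absence -/

section Oversmoothing

variable {p q μ σ t : ℕ → ℝ}

theorem tendsto_leak (hq : ∀ n, 0 ≤ q n) (hqp : ∀ n, q n < p n)
    (htn : (fun n : ℕ => √(Real.log n)) =o[atTop] t) (ht : ∀ n, 0 < t n) :
    Tendsto (fun n => leak (p n) (q n) (t n)) atTop (𝓝 0) := by
  have hlog : Tendsto (fun n : ℕ => √(Real.log n)) atTop atTop :=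
    Real.tendsto_sqrt_atTop.comp (Real.tendsto_log_atTop.comp tendsto_natCast_atTop_atTop)
  have htt : Tendsto t atTop atTop := by
    refine tendsto_atTop_mono' _ ?_ hlog
    filter_upwards [htn.bound one_pos] with n hn
    rwa [Real.norm_of_nonneg (Real.sqrt_nonneg _), Real.norm_of_nonneg (ht n).le, one_mul] at hn
  have hexp : Tendsto (fun n => Real.exp (-(2 * t n))) atTop (𝓝 0) :=
    Real.tendsto_exp_neg_atTop_nhds_zero.comp (htt.const_mul_atTop two_pos)
  exact tendsto_of_tendsto_of_tendsto_of_le_of_le tendsto_const_nhds hexp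
    (fun n => leak_nonneg ((hq n).trans (hqp n).le) (hq n) _)
    (fun n => leak_le_exp ((hq n).trans_lt (hqp n)) (hq n) (hqp n).le _)

variable (hq : ∀ n, 0 ≤ q n) (hqp : ∀ n, q n < p n) (hp : ∀ n, p n ≤ 1)
  (hqn : (fun n : ℕ => Real.log n ^ 2 / n) =O[atTop] q)
  (hμ : ∀ n, 0 < μ n) (hσ : ∀ n, 0 < σ n)
  (hSNR : (fun n : ℕ => √(Real.log n)) =o[atTop] fun n => μ n / σ n)

include hq hqp hp hqn hμ hσ hSNR

theorem whp_gam_gatFeat (ht : ∀ n, 0 ≤ t n) {δ : ℝ} (hδ : 0 < δ) :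
    WithHighProbability p q μ σ fun n => {ω | ∀ l : ℕ,
      |gam (gatFeat (t n) ω l) - ((p n * Real.exp (t n) - q n * Real.exp (-t n)) /
        (p n * Real.exp (t n) + q n * Real.exp (-t n))) ^ l * gam (gatFeat (t n) ω 0)| ≤
        δ * gam (gatFeat (t n) ω 0)} := by
  set d := min (1 / 4) (δ / 26) with hd
  have hd0 : 0 < d := lt_min (by norm_num) (by linarith)
  have hd1 : d ≤ 1 / 4 := min_le_left _ _
  have hd2 : 26 * d ≤ δ := by have := min_le_right (1 / 4) (δ / 26); linarith
  refine (withHighProbability_goodEvent hq hqp hp hqn hμ hσ hSNR hd0 (by linarith)).mono ?_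
  filter_upwards [eventually_gt_atTop 0] with n hn ω hω l
  exact (abs_gam_gatFeat_sub_le hω hn ((hq n).trans_lt (hqp n)) (hq n) (hqp n).le (hμ n) hd0.le hd1
    (ht n) l).trans (mul_le_mul_of_nonneg_right hd2 (gam_nonneg _))

/-- Convolution is attention of intensity 0, for which the factor becomes (p-q)/(p+q). -/
theorem whp_gam_gcnFeat {δ : ℝ} (hδ : 0 < δ) :
    WithHighProbability p q μ σ fun n => {ω | ∀ l : ℕ,
      |gam (gcnFeat ω l) - ((p n - q n) / (p n + q n)) ^ l * gam (gcnFeat ω 0)| ≤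
        δ * gam (gcnFeat ω 0)} := by
  have := whp_gam_gatFeat hq hqp hp hqn hμ hσ hSNR (t := fun _ => 0) (fun _ => le_rfl) hδ
  simpa only [gatFeat_zero, neg_zero, Real.exp_zero, mul_one] using this

theorem whp_gam_gcnFeat_le {η : ℝ} (hη : 0 < η) (hη1 : η < 1) :
    WithHighProbability p q μ σ fun n => {ω | ∀ l : ℕ, gam (gcnFeat ω l) ≤
      2 * (1 - (1 - η) * (1 - (p n - q n) / (p n + q n))) ^ l * gam (gcnFeat ω 0)} := by
  refine (withHighProbability_goodEvent hq hqp hp hqn hμ hσ hSNR (δ := η / 8) (by linarith)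
    (by linarith)).mono ?_
  have hδn : ∀ᶠ n : ℕ in atTop, 1 ≤ η / 8 * n :=
    (tendsto_natCast_atTop_atTop.const_mul_atTop (by linarith)).eventually_ge_atTop 1
  filter_upwards [eventually_gt_atTop 0, hδn] with n hn hn1 ω hω l
  exact gam_gcnFeat_le hω hn ((hq n).trans_lt (hqp n)) (hq n) (hqp n).le (by linarith) hη hη1 le_rfl
    hn1 l

theorem whp_gcn_overSmooths (L : ℕ → ℕ) (hpq : p =O[atTop] q) :
    ∃ C₁ > 0, ∃ C₂ > 0, WithHighProbability p q μ σ fun n =>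
      {ω | OverSmooths C₁ C₂ (L n) (gcnFeat ω)} := by
  obtain ⟨C, hC, hCpq⟩ := hpq.exists_pos
  rw [IsBigOWith] at hCpq
  -- From p ≤ Cq the gap 2q/(p+q) is at least 2/(C+1); half of it is kept by η = 1/2, and 1 - x ≤
  -- e^(-x).
  refine ⟨2, two_pos, 1 / (C + 1), by positivity,
    (whp_gam_gcnFeat_le hq hqp hp hqn hμ hσ hSNR one_half_pos one_half_lt_one).mono ?_⟩
  filter_upwards [hCpq] with n hn ω hω l _ _
  have hp0 : 0 < p n := (hq n).trans_lt (hqp n)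
  rw [Real.norm_of_nonneg hp0.le, Real.norm_of_nonneg (hq n)] at hn
  refine (hω l).trans (mul_le_mul_of_nonneg_right (mul_le_mul_of_nonneg_left ?_ two_pos.le)
    (gam_nonneg _))
  have hpq0 : 0 < p n + q n := by linarith [hq n]
  have hgap : 1 - (p n - q n) / (p n + q n) = 2 * q n / (p n + q n) := by field_simp; ring
  have hgap1 : 2 * q n / (p n + q n) ≤ 1 := by rw [div_le_one hpq0]; linarith [hqp n]
  have hgap2 : 2 * (1 / (C + 1)) ≤ 2 * q n / (p n + q n) := by
    rw [mul_one_div, div_le_div_iff₀ (by positivity) hpq0]; linarith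
  rw [hgap]
  have hexp : Real.exp (-(1 / (C + 1)) * l) = Real.exp (-(1 / (C + 1))) ^ l := by
    rw [← Real.exp_nat_mul]; ring_nf
  rw [hexp]
  refine pow_le_pow_left₀ (by linarith) ?_ l
  have := Real.add_one_le_exp (-(1 / (C + 1)))
  linarith

theorem gat_not_overSmooths {L : ℕ → ℕ} (ht : ∀ n, 0 < t n)
    (htn : (fun n : ℕ => √(Real.log n)) =o[atTop] t) (hL : Tendsto L atTop atTop) {C₁ C₂ : ℝ}
    (hC₂ : 0 < C₂) :
    WithVanishingProbability p q μ σ fun n =>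
      {ω | OverSmooths C₁ C₂ (L n) (gatFeat (t n) ω)} := by
  have hdecay : Tendsto (fun l : ℕ => C₁ * Real.exp (-C₂ * l)) atTop (𝓝 0) := by
    have h1 : Tendsto (fun l : ℕ => C₂ * (l : ℝ)) atTop atTop :=
      tendsto_natCast_atTop_atTop.const_mul_atTop hC₂
    have h2 := (Real.tendsto_exp_neg_atTop_nhds_zero.comp h1).const_mul C₁
    simpa [Function.comp_def] using h2
  -- A single fixed layer is enough for the contradiction. There over-smoothing demands less than
  -- 1/4 of the initial similarity, while the network keeps at least 1/2 - 26/104 = 1/4.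
  obtain ⟨l, hl, hl1⟩ := ((hdecay.eventually_lt_const (show (0 : ℝ) < 1 / 4 by norm_num)).and
    (eventually_ge_atTop 1)).exists
  refine (withHighProbability_goodEvent hq hqp hp hqn hμ hσ hSNR (δ := 1 / 104) (by norm_num)
    (by norm_num)).vanishing (fun n => measurableSet_goodEvent _ _ _ _ _) ?_
  have hleak := tendsto_leak hq hqp htn ht
  have hfac : Tendsto (fun n => Real.exp (-(4 * (l * leak (p n) (q n) (t n))))) atTop (𝓝 1) := by
    have := (Real.continuous_exp.tendsto _).comp (((hleak.const_mul (l : ℝ)).const_mul 4).neg)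
    simpa [Function.comp_def] using this
  filter_upwards [eventually_gt_atTop 0, hL.eventually_ge_atTop l,
    hleak.eventually_le_const (show (0 : ℝ) < 1 / 4 by norm_num),
    hfac.eventually_const_le (show (1 / 2 : ℝ) < 1 by norm_num)] with n hn hLn hlk hf
  rw [Set.disjoint_left]
  intro ω hω hov
  have hp0 : 0 < p n := (hq n).trans_lt (hqp n)
  have h1 := abs_gam_gatFeat_sub_le hω hn hp0 (hq n) (hqp n).le (hμ n) (by norm_num) (by norm_num)
    (ht n).le l
  have h2 := half_le_gam_feat hω hn hp0 (hq n) (hqp n).le (hμ n) (by norm_num) (by norm_num)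
  have h3 : gam (gatFeat (t n) ω l) ≤ C₁ * Real.exp (-C₂ * l) * gam (feat ω) := hov l hl1 hLn
  have h4 := hf.trans (exp_neg_le_factor_pow hp0 (hq n) hlk l)
  have h5 : 0 < gam (feat ω) := (half_pos (hμ n)).trans_le h2
  have h6 := (abs_le.mp h1).1
  have h7 := mul_le_mul_of_nonneg_right h4 h5.le
  have h8 := mul_lt_mul_of_pos_right hl h5
  linarith

theorem whp_gat_comparable {L : ℕ → ℕ} (ht : ∀ n, 0 < t n)
    (htn : (fun n : ℕ => √(Real.log n)) =o[atTop] t)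
    (hLq : (fun n => (L n : ℝ) * q n) =O[atTop] fun n => p n * Real.exp (2 * t n)) :
    ∃ c > 0, ∃ C > 0, WithHighProbability p q μ σ fun n => {ω | ∀ l : ℕ, 1 ≤ l → l ≤ L n →
      c * gam (gatFeat (t n) ω 0) ≤ gam (gatFeat (t n) ω l) ∧
        gam (gatFeat (t n) ω l) ≤ C * gam (gatFeat (t n) ω 0)} := by
  obtain ⟨K, hK, hKL⟩ := hLq.exists_pos
  rw [IsBigOWith] at hKL
  -- The power of the factor is at least e^(-4K) = 2c because the total leak is at most K; the
  -- approximation error c leaves a factor c.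
  set c := Real.exp (-(4 * K)) / 2 with hc
  have hc0 : 0 < c := by positivity
  refine ⟨c, hc0, 1 + c, by linarith,
    (whp_gam_gatFeat hq hqp hp hqn hμ hσ hSNR (fun n => (ht n).le) hc0).mono ?_⟩
  filter_upwards [hKL, (tendsto_leak hq hqp htn ht).eventually_le_const
    (show (0 : ℝ) < 1 / 4 by norm_num)] with n hn hlk ω hω l _ hl
  have hp0 : 0 < p n := (hq n).trans_lt (hqp n)
  have hlK : l * leak (p n) (q n) (t n) ≤ K := by
    have hl' : (l : ℝ) ≤ L n := by exact_mod_cast hl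
    rw [Real.norm_of_nonneg (mul_nonneg (Nat.cast_nonneg _) (hq n)),
      Real.norm_of_nonneg (by positivity)] at hn
    calc _ ≤ (L n : ℝ) * (q n / (p n * Real.exp (2 * t n))) :=
          mul_le_mul hl' (leak_le hp0 (hq n) _) (leak_nonneg hp0.le (hq n) _) (by positivity)
      _ ≤ K := by rw [← mul_div_assoc, div_le_iff₀ (by positivity)]; exact hn
  have h1 : 2 * c ≤ ((p n * Real.exp (t n) - q n * Real.exp (-t n)) /
      (p n * Real.exp (t n) + q n * Real.exp (-t n))) ^ l := by
    refine le_trans ?_ (exp_neg_le_factor_pow hp0 (hq n) hlk l)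
    rw [hc, mul_div_cancel₀ _ two_ne_zero, Real.exp_le_exp]
    linarith
  have h2 := factor_pow_le_one hp0 (hq n) (hqp n).le (ht n).le l
  have h3 := gam_nonneg (gatFeat (t n) ω 0)
  obtain ⟨h4, h5⟩ := abs_le.mp (hω l)
  have h6 := mul_le_mul_of_nonneg_right h1 h3
  have h7 := mul_le_mul_of_nonneg_right h2 h3
  exact ⟨by linarith, by linarith⟩

end Oversmoothing

end GraphAttention

theorem theorem4 (p q μ σ t : ℕ → ℝ) (L : ℕ → ℕ)
    -- parameters of the model, homophily and density
    (hq : ∀ n, 0 ≤ q n) (hqp : ∀ n, q n < p n) (hp : ∀ n, p n ≤ 1)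
    (hpn : (fun n : ℕ => Real.log n ^ 2 / n) =O[Filter.atTop] p)
    (hqn : (fun n : ℕ => Real.log n ^ 2 / n) =O[Filter.atTop] q)
    (hμ : ∀ n, 0 < μ n) (hσ : ∀ n, 0 < σ n)
    -- the signal-to-noise ratio is `ω(√(log n))`
    (hSNR : (fun n : ℕ => √(Real.log n)) =o[Filter.atTop] fun n => μ n / σ n)
    -- the number of layers is `O(n)`
    (hL : (fun n : ℕ => (L n : ℝ)) =O[Filter.atTop] fun n : ℕ => (n : ℝ))
    -- the attention intensity is `ω(√(log n))`
    (ht : ∀ n, 0 < t n) (htn : (fun n : ℕ => √(Real.log n)) =o[Filter.atTop] t) :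
    -- graph convolutional networks: over-smoothing with constants independent of `n`
    ((p =O[Filter.atTop] q) → ∃ C₁ > 0, ∃ C₂ > 0,
      GraphAttention.WithHighProbability p q μ σ fun n =>
        {ω | GraphAttention.OverSmooths C₁ C₂ (L n) (GraphAttention.gcnFeat ω)}) ∧
    -- exponential decay in all regimes, with a gap as close as desired to `1 - (p-q)/(p+q)`
    (∃ C₁ > 0, ∀ η : ℝ, 0 < η → η < 1 →
      GraphAttention.WithHighProbability p q μ σ fun n =>
        {ω | ∀ l : ℕ, 1 ≤ l → l ≤ L n →
          GraphAttention.gam (GraphAttention.gcnFeat ω l) ≤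
            C₁ * (1 - (1 - η) * (1 - (p n - q n) / (p n + q n))) ^ l *
              GraphAttention.gam (GraphAttention.gcnFeat ω 0)}) ∧
    -- the decay factor per layer is `(p-q)/(p+q)`
    (∀ δ : ℝ, 0 < δ → GraphAttention.WithHighProbability p q μ σ fun n =>
        {ω | ∀ l : ℕ, 1 ≤ l → l ≤ L n →
          |GraphAttention.gam (GraphAttention.gcnFeat ω l) -
            ((p n - q n) / (p n + q n)) ^ l * GraphAttention.gam (GraphAttention.gcnFeat ω 0)| ≤
            δ * GraphAttention.gam (GraphAttention.gcnFeat ω 0)}) ∧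
    -- graph attention networks: no over-smoothing
    (Filter.Tendsto L Filter.atTop Filter.atTop → ∀ C₁ > 0, ∀ C₂ > 0,
      GraphAttention.WithVanishingProbability p q μ σ fun n =>
        {ω | GraphAttention.OverSmooths C₁ C₂ (L n) (GraphAttention.gatFeat (t n) ω)}) ∧
    -- the factor per layer is `(p e^t - q e^(-t)) / (p e^t + q e^(-t))`
    (∀ δ : ℝ, 0 < δ → GraphAttention.WithHighProbability p q μ σ fun n =>
        {ω | ∀ l : ℕ, 1 ≤ l → l ≤ L n →
          |GraphAttention.gam (GraphAttention.gatFeat (t n) ω l) -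
            ((p n * Real.exp (t n) - q n * Real.exp (-t n)) /
              (p n * Real.exp (t n) + q n * Real.exp (-t n))) ^ l *
              GraphAttention.gam (GraphAttention.gatFeat (t n) ω 0)| ≤
            δ * GraphAttention.gam (GraphAttention.gatFeat (t n) ω 0)}) ∧
    -- the similarity stays of the order of its initial value
    (((fun n => (L n : ℝ) * q n) =O[Filter.atTop] fun n => p n * Real.exp (2 * t n)) →
      ∃ c > 0, ∃ C > 0, GraphAttention.WithHighProbability p q μ σ fun n =>
        {ω | ∀ l : ℕ, 1 ≤ l → l ≤ L n →
          c * GraphAttention.gam (GraphAttention.gatFeat (t n) ω 0) ≤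
              GraphAttention.gam (GraphAttention.gatFeat (t n) ω l) ∧
            GraphAttention.gam (GraphAttention.gatFeat (t n) ω l) ≤
              C * GraphAttention.gam (GraphAttention.gatFeat (t n) ω 0)}) := by
  exact ⟨GraphAttention.whp_gcn_overSmooths hq hqp hp hqn hμ hσ hSNR L,
    ⟨2, two_pos, fun η hη hη1 =>
      (GraphAttention.whp_gam_gcnFeat_le hq hqp hp hqn hμ hσ hSNR hη hη1).mono
        (Eventually.of_forall fun _ _ h l _ _ => h l)⟩,
    fun δ hδ => (GraphAttention.whp_gam_gcnFeat hq hqp hp hqn hμ hσ hSNR hδ).mono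
      (Eventually.of_forall fun _ _ h l _ _ => h l),
    fun hLt C₁ _ C₂ hC₂ =>
      GraphAttention.gat_not_overSmooths hq hqp hp hqn hμ hσ hSNR ht htn hLt hC₂,
    fun δ hδ => (GraphAttention.whp_gam_gatFeat hq hqp hp hqn hμ hσ hSNR (fun n => (ht n).le) hδ).mono
      (Eventually.of_forall fun _ _ h l _ _ => h l),
    GraphAttention.whp_gat_comparable hq hqp hp hqn hμ hσ hSNR ht htn⟩
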